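/- Let $m,n\ge 0$, let $F_n$ be the free group on $x_1,\dots,x_n$, and let $G=\mathbb{Z}^m\times F_n$, with standard generators $t_1,\dots,t_m,x_1,\dots,x_n$; elements of $G$ are given as words in these generators and their inverses. Write $t^{a}w$ for the element $(a,w)$ of $G$ and $\pi\colon G\to F_n$ for the projection. A basis of a free-abelian times free group $K$ (i.e. a group isomorphic to the direct product of a free-abelian group and a free group) is a pair $(A,B)$ of subsets of $K$ such that $A$ is an abelian basis of the center of $K$, $B$ is empty or a free basis of a non-abelian free subgroup of $K$, and $A\cup B$ generates $K$. (1) The Subgroup Intersection Problem for $G$ is solvable: there is an algorithm which, given two finite lists of words generating subgroups $H$ and $H'$ of $G$, decides whether $H\cap H'$ is finitely generated and, if it is, outputs a finite set of generators of $H\cap H'$; moreover, the set that it outputs is a basis $(A,B)$ of $H\cap H'$, with $A$ and $B$ given as two finite lists of words. (2) Let $H,H'\le G$ be finitely generated subgroups. Then $H\pi$, $H'\pi$ and $H\pi\cap H'\pi$ have finite free bases. Hence there are finite free bases $u_1,\dots,u_{n_1}$ of $H\pi$, $u'_1,\dots,u'_{n_2}$ of $H'\pi$ and $v_1,\dots,v_{n_3}$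 of $H\pi\cap H'\pi$, together with integer matrices $\mathbf A\in\mathcal M_{n_1\times m}(\mathbb Z)$ and $\mathbf A'\in\mathcal M_{n_2\times m}(\mathbb Z)$ whose rows $a_i$, $a'_i$ satisfy $t^{a_i}u_i\in H$ and $t^{a'_i}u'_i\in H'$ for all $i$. For every such choice, let $\mathbf P\in\mathcal M_{n_3\times n_1}(\mathbb Z)$ and $\mathbf P'\in\mathcal M_{n_3\times n_2}(\mathbb Z)$ be the matrices (acting on row vectors) of the abelianized inclusions $H\pi\cap H'\pi\hookrightarrow H\pi$ and $H\pi\cap H'\pi\hookrightarrow H'\pi$ with respect to these bases, put $L=H\cap\mathbb Z^m$ and $L'=H'\cap\mathbb Z^m$, and let $M\le\mathbb Z^{n_3}$ be the preimage of $L+L'\le\mathbb Z^m$ under the linear map $\mathbf P\mathbf A-\mathbf P'\mathbf A'\colon\mathbb Z^{n_3}\to\mathbb Z^m$. Then $H\cap H'$ is finitely generated if and only if either $n_3=1$ and $M=\{0\}$, or $\operatorname{rk}(M)=n_3$. -/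

import Mathlib

/-- The group `ℤ^m × F_n`, with `ℤ^m` written multiplicatively. -/
abbrev ZF (m n : ℕ) : Type := Multiplicative (Fin m → ℤ) × FreeGroup (Fin n)

namespace ZF

/-- The standard generators `t_1, …, t_m, x_1, …, x_n` of `ℤ^m × F_n`. -/
def gen (m n : ℕ) : Fin m ⊕ Fin n → ZF m n
  | Sum.inl i => (Multiplicative.ofAdd (Pi.single i 1), 1)
  | Sum.inr j => (1, FreeGroup.of j)

end ZF

/-- Words on an alphabet `α` and its formal inverses: `(x, true)` stands for the letter `x`,
`(x, false)` for `x⁻¹`. No reducedness is required. -/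
abbrev GroupWord (α : Type) : Type := List (α × Bool)

section Words

variable {α G : Type} [Group G]

/-- The element of `G` that a word represents, when each letter `x` stands for `gen x`. -/
def wordEval (gen : α → G) (w : GroupWord α) : G := FreeGroup.lift gen (FreeGroup.mk w)

/-- The subgroup generated by the elements that a finite list of words represents. -/
def wordSubgroup (gen : α → G) (S : List (GroupWord α)) : Subgroup G :=
  Subgroup.closure {g | ∃ w ∈ S, wordEval gen w = g}

/-- `f` is an algorithm that solves the Subgroup Intersection Problem for the group `G`, whose
elements are given as words on the generators `gen`: for two finite lists `S`, `S'` of words, `f`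
answers `none` if the intersection of the subgroups that they generate is not finitely generated,
and otherwise it answers `some E` with `E` a finite list of words generating the intersection. -/
def SolvesSubgroupIntersectionProblem [Primcodable α] (gen : α → G)
    (f : List (GroupWord α) × List (GroupWord α) → Option (List (GroupWord α))) : Prop :=
  Computable f ∧
  ∀ S S' : List (GroupWord α),
    (f (S, S') = none ↔ ¬ (wordSubgroup gen S ⊓ wordSubgroup gen S').FG) ∧
    ∀ E, f (S, S') = some E → wordSubgroup gen E = wordSubgroup gen S ⊓ wordSubgroup gen S'

end Words

/-- The pair of families `(a, b)` is a basis of the free-abelian times free group `H`: `a` is an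
abelian basis of the center of `H`, the family `b` is empty or a free basis of a non-abelian
(free) subgroup of `H`, and together they generate `H`. -/
structure IsFreeAbelianTimesFreeBasis {H ι κ : Type} [Group H] (a : ι → H) (b : κ → H) :
    Prop where
  abelian_part : ∃ e : Multiplicative (ι →₀ ℤ) ≃* Subgroup.center H,
    ∀ i, (e (Multiplicative.ofAdd (Finsupp.single i 1)) : H) = a i
  free_part : IsEmpty κ ∨ ∃ K : Subgroup H, (∃ x ∈ K, ∃ y ∈ K, x * y ≠ y * x) ∧
    ∃ e : FreeGroupBasis κ K, ∀ j, (e j : H) = b j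
  closure_eq_top : Subgroup.closure (Set.range a ∪ Set.range b) = ⊤

/-- The lists of words `A` and `B` represent elements of the subgroup `K` that form a basis
of `K`, with free-abelian component `A` and free component `B`. -/
def WordsFormBasis {α G : Type} [Group G] (gen : α → G) (K : Subgroup G)
    (A B : List (GroupWord α)) : Prop :=
  ∃ (a : Fin A.length → K) (b : Fin B.length → K),
    (∀ i, (a i : G) = wordEval gen (A.get i)) ∧ (∀ j, (b j : G) = wordEval gen (B.get j)) ∧
    IsFreeAbelianTimesFreeBasis a b

namespace ZF

variable {m n : ℕ}

/-- The projection `H π ≤ F_n` of a subgroup `H` of `ℤ^m × F_n` to the free part. -/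
def freeProj (H : Subgroup (ZF m n)) : Subgroup (FreeGroup (Fin n)) :=
  H.map (MonoidHom.snd _ _)

/-- The lattice `L = H ∩ ℤ^m`, as an additive subgroup of `ℤ^m`. -/
def abelianPart (H : Subgroup (ZF m n)) : AddSubgroup (Fin m → ℤ) :=
  Subgroup.toAddSubgroup' (H.comap (MonoidHom.inl _ _))

/-- The abelianization map `K → ℤ^k` of a free group `K` with respect to a free basis: it counts
the exponent sums of the basis elements. -/
def abelianization {K : Type} [Group K] {k : ℕ} (u : FreeGroupBasis (Fin k) K) :
    K →* Multiplicative (Fin k → ℤ) :=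
  u.lift fun i => Multiplicative.ofAdd (Pi.single i 1)

/-- Coordinates for a pair of subgroups `H`, `H'` of `ℤ^m × F_n`: finite free bases `u`, `u'`, `v`
of `H π`, `H' π` and `H π ∩ H' π`, and integer matrices `A`, `A'` whose rows lift the elements of
`u` and `u'` to elements `t^(a_i) u_i` of `H` and `t^(a'_i) u'_i` of `H'`. -/
structure Coordinates (H H' : Subgroup (ZF m n)) where
  n₁ : ℕ
  n₂ : ℕ
  n₃ : ℕ
  u : FreeGroupBasis (Fin n₁) (freeProj H)
  u' : FreeGroupBasis (Fin n₂) (freeProj H')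
  v : FreeGroupBasis (Fin n₃) (freeProj H ⊓ freeProj H' : Subgroup (FreeGroup (Fin n)))
  A : Matrix (Fin n₁) (Fin m) ℤ
  A' : Matrix (Fin n₂) (Fin m) ℤ
  lift_mem : ∀ i, ((Multiplicative.ofAdd (A i), (u i : FreeGroup (Fin n))) : ZF m n) ∈ H
  lift_mem' : ∀ i, ((Multiplicative.ofAdd (A' i), (u' i : FreeGroup (Fin n))) : ZF m n) ∈ H'

namespace Coordinates

variable {H H' : Subgroup (ZF m n)} (D : Coordinates H H')

/-- The matrix of the abelianized inclusion `H π ∩ H' π → H π`. -/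
def P : Matrix (Fin D.n₃) (Fin D.n₁) ℤ :=
  fun i => (abelianization D.u (Subgroup.inclusion inf_le_left (D.v i))).toAdd

/-- The matrix of the abelianized inclusion `H π ∩ H' π → H' π`. -/
def P' : Matrix (Fin D.n₃) (Fin D.n₂) ℤ :=
  fun i => (abelianization D.u' (Subgroup.inclusion inf_le_right (D.v i))).toAdd

/-- The preimage `M ≤ ℤ^(n₃)` of `L + L'` under `x ↦ x (P A - P' A')` (row vectors). -/
def M : AddSubgroup (Fin D.n₃ → ℤ) :=
  (abelianPart H ⊔ abelianPart H').comap
    (Matrix.vecMulLinear (D.P * D.A - D.P' * D.A')).toAddMonoidHom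

end Coordinates

end ZF

/-!
Let `H` and `H'` be finitely generated subgroups of `ℤ^m × F_n`, let `J = H ∩ H'`, let
`K = H π ∩ H' π` and let `L`, `L'` be the intersections of `H`, `H'` with `ℤ^m`.

*The criterion.* A subgroup of `ℤ^m × F_n` is finitely generated if and only if its projection to
`F_n` is. Lifts of an element of `K` to `H` and to `H'` differ by a vector in `ℤ^m` that is well
defined modulo `L + L'`, and the element lies in `J π` if and only if this vector lies in `L + L'`
(`ZF.mem_freeProj_inf_iff`). Thus `J π` is a normal subgroup of `K` with abelian quotient. By
Howson's theorem (`FreeGroup.fg_inf`) `K` is finitely generated, and a normal subgroup of a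
nonabelian free group that contains all commutators is finitely generated only if its index is
finite (`FreeGroup.finite_quotient_of_fg`). Hence `J` is finitely generated if and only if `K` is
commutative or every element of `K` is torsion modulo `J π` (`ZF.fg_inf_iff`). In coordinates
`K / J π` is `ℤ^(n₃) / M`, which gives the numerical criterion (`ZF.Coordinates.fg_inf_iff`).

*The algorithm.* It suffices to show that the relation between inputs and correct answers is
semidecidable: an algorithm then searches for an answer together with a certificate
(`Semidecidable.exists_computable`). Every input has a correct answer (`ZF.exists_isAnswer`), and
the certificates are as follows.

* For `w ∉ P` with `P ≤ F_n` finitely generated: an action of `F_n` on finitely many points, as in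
  Marshall Hall's theorem, in which `P` fixes a point that `w` moves. When the points are letters
  of a free group, and the moves also multiply by elements of a free group, such actions certify
  that words are freely independent (`FreeGroup.exists_actionTable`).
* For generators of the intersection of two subgroups of `F_n`: finitely many coset representatives
  that are closed under the steps along prefixes of reduced words
  (`FreeGroup.semidecidable_generates_inf`).
* For vectors in `ℤ^m` outside a lattice, or independent of it: linear functionals.
* For generators of `L`: a freely independent lift that completes them to generators of `H`
  (`ZF.semidecidable_eq_latticePart`).
* For generators of `L ∩ L'`: lifts of independent elements under `L × L' → ℤ^m`, `(x, y) ↦ x - y`,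
  which generate `L × L'` together with the diagonal of the intersection
  (`ZF.semidecidable_eq_inf`).
* For infinite generation of `J`: two elements of `K` that do not commute and one that has infinite
  order modulo `J π` (`ZF.semidecidable_not_fg_inf`).
* For generators of `J`: generators of `L ∩ L'`, and either representatives of the finitely many
  cosets of `J π` in `K` or a generator of `K` that has infinite order modulo `J π`, in which case
  `J π` is trivial (`ZF.semidecidable_eq_wordSubgroup_inf`).

Finally, a basis of `J` consists of a basis of its lattice and of lifts of a free basis of `J π`;
if the latter has a single element, `J` is abelian and the lift belongs to the abelian basis
(`ZF.IsBasisPair`).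
-/

/-! ### Prefixes of reduced words and Howson's theorem -/

namespace FreeGroup

variable {α : Type*}

/-- Reducing a word creates no new prefixes, up to equality in the free group. -/
theorem exists_prefix_of_red {L₁ L₂ : List (α × Bool)} (h : Red L₁ L₂) :
    ∀ p, p <+: L₂ → ∃ q, q <+: L₁ ∧ mk q = mk p := by
  induction h with
  | refl => exact fun p hp => ⟨p, hp, rfl⟩
  | tail _ hstep ih =>
    intro p hp
    obtain @⟨A, B, x, b⟩ := hstep
    suffices h : ∃ q, q <+: A ++ (x, b) :: (x, !b) :: B ∧ mk q = mk p by
      obtain ⟨q, hq, hqp⟩ := h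
      obtain ⟨q', hq', hq'q⟩ := ih q hq
      exact ⟨q', hq', hq'q.trans hqp⟩
    obtain ⟨r, hr⟩ := hp
    rcases List.append_eq_append_iff.1 hr with ⟨s, rfl, -⟩ | ⟨s, rfl, rfl⟩
    · exact ⟨p, by simp [List.append_assoc], rfl⟩
    · refine ⟨A ++ (x, b) :: (x, !b) :: s, ⟨r, by simp⟩, ?_⟩
      exact Quot.sound Red.Step.not

/-- The empty word, and the prefixes of the words of `S` and of their formal inverses. -/
def prefixWords (S : Set (List (α × Bool))) : Set (List (α × Bool)) :=
  {t | t = [] ∨ ∃ s ∈ S, t <+: s ∨ t <+: invRev s}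

theorem finite_prefixWords {S : Set (List (α × Bool))} (hS : S.Finite) :
    (prefixWords S).Finite := by
  have h : prefixWords S ⊆
      {[]} ∪ ⋃ s ∈ S, ({t | t ∈ s.inits} ∪ {t | t ∈ (invRev s).inits}) := by
    rintro t (rfl | ⟨s, hs, ht⟩)
    · simp
    · right
      simp only [Set.mem_iUnion]
      exact ⟨s, hs, by simpa using ht⟩
  refine Set.Finite.subset (Set.Finite.union (Set.finite_singleton _) ?_) h
  exact hS.biUnion fun s _ => (List.finite_toSet _).union (List.finite_toSet _)

/-- If `J` is generated by `S`, then the prefixes of the reduced words of the elements of `J`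
lie in the cosets of `J` given by the prefixes of the generators. -/
theorem exists_prefixWords_mul_inv_mem {S : Set (List (α × Bool))} [DecidableEq α]
    {h : FreeGroup α} (hh : h ∈ Subgroup.closure (mk '' S)) {p : List (α × Bool)}
    (hp : p <+: h.toWord) :
    ∃ t ∈ prefixWords S, mk p * (mk t)⁻¹ ∈ Subgroup.closure (mk '' S) := by
  suffices H : ∃ W, mk W = h ∧ ∀ q, q <+: W →
      ∃ t ∈ prefixWords S, mk q * (mk t)⁻¹ ∈ Subgroup.closure (mk '' S) by
    obtain ⟨W, rfl, hW⟩ := H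
    obtain ⟨q, hq, hqp⟩ := exists_prefix_of_red (reduce.red (L := W)) p hp
    rw [← hqp]
    exact hW q hq
  have key : ∀ s, mk s ∈ Subgroup.closure (mk '' S) →
      (∀ q, q <+: s → q ∈ prefixWords S) → ∀ W, (∀ q, q <+: W →
      ∃ t ∈ prefixWords S, mk q * (mk t)⁻¹ ∈ Subgroup.closure (mk '' S)) → ∀ q, q <+: s ++ W →
      ∃ t ∈ prefixWords S, mk q * (mk t)⁻¹ ∈ Subgroup.closure (mk '' S) := by
    rintro s hs hs' W hW q ⟨r, hr⟩
    rcases List.append_eq_append_iff.1 hr with ⟨u, rfl, -⟩ | ⟨u, rfl, rfl⟩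
    · exact ⟨q, hs' q (List.prefix_append _ _), by rw [mul_inv_cancel]; exact one_mem _⟩
    · obtain ⟨t, ht, htu⟩ := hW u (List.prefix_append _ _)
      refine ⟨t, ht, ?_⟩
      rw [← mul_mk, mul_assoc]
      exact mul_mem hs htu
  clear hp p
  induction hh using Subgroup.closure_induction_left with
  | one =>
    refine ⟨[], rfl, fun q hq => ⟨[], Or.inl rfl, ?_⟩⟩
    rw [List.prefix_nil.1 hq, mul_inv_cancel]
    exact one_mem _
  | mul_left x hx y hy ih =>
    obtain ⟨W, rfl, hW⟩ := ih
    obtain ⟨s, hs, rfl⟩ := hx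
    exact ⟨s ++ W, by rw [mul_mk], key s (Subgroup.subset_closure ⟨s, hs, rfl⟩)
      (fun q hq => Or.inr ⟨s, hs, Or.inl hq⟩) W hW⟩
  | inv_mul_cancel x hx y hy ih =>
    obtain ⟨W, rfl, hW⟩ := ih
    obtain ⟨s, hs, rfl⟩ := hx
    refine ⟨invRev s ++ W, by rw [← mul_mk, inv_mk], key (invRev s) ?_
      (fun q hq => Or.inr ⟨s, hs, Or.inr hq⟩) W hW⟩
    rw [← inv_mk]
    exact inv_mem (Subgroup.subset_closure ⟨s, hs, rfl⟩)

/-- Tracing the reduced word of `k` letter by letter through the cosets `D z` with `z ∈ Z`. -/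
theorem exists_mul_inv_mem_of_step [DecidableEq α] {D : Subgroup (FreeGroup α)}
    {Z : Set (FreeGroup α)} (h1 : 1 ∈ Z) {k : FreeGroup α}
    (step : ∀ p x, p ++ [x] <+: k.toWord → ∀ z ∈ Z, mk p * z⁻¹ ∈ D →
      ∃ z' ∈ Z, mk (p ++ [x]) * z'⁻¹ ∈ D) :
    ∃ z ∈ Z, k * z⁻¹ ∈ D := by
  suffices H : ∀ p, p <+: k.toWord → ∃ z ∈ Z, mk p * z⁻¹ ∈ D by
    simpa [mk_toWord] using H k.toWord List.prefix_rfl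
  intro p
  induction p using List.reverseRecOn with
  | nil => exact fun _ => ⟨1, h1, by rw [← one_eq_mk]; simp⟩
  | append_singleton p x ih =>
    intro hp
    obtain ⟨z, hz, hzD⟩ := ih ((List.prefix_append _ _).trans hp)
    exact step p x hp z hz hzD

/-- `J` has finitely many cosets that contain prefixes of reduced words of elements of `J`. -/
def HasFinitePrefixCosets [DecidableEq α] (J : Subgroup (FreeGroup α)) : Prop :=
  ∃ T : Set (FreeGroup α), T.Finite ∧
    ∀ h ∈ J, ∀ p, p <+: h.toWord → ∃ t ∈ T, mk p * t⁻¹ ∈ J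

theorem _root_.Subgroup.FG.hasFinitePrefixCosets [DecidableEq α] {J : Subgroup (FreeGroup α)}
    (hJ : J.FG) : HasFinitePrefixCosets J := by
  obtain ⟨S, rfl⟩ := hJ
  have hS : (S : Set (FreeGroup α)) = mk '' (toWord '' (S : Set (FreeGroup α))) := by
    simp [Set.image_image, mk_toWord]
  rw [hS]
  refine ⟨mk '' prefixWords (toWord '' (S : Set (FreeGroup α))),
    (finite_prefixWords (S.finite_toSet.image _)).image _, fun h hh p hp => ?_⟩
  obtain ⟨t, ht, h⟩ := exists_prefixWords_mul_inv_mem hh hp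
  exact ⟨_, ⟨t, ht, rfl⟩, h⟩

theorem HasFinitePrefixCosets.fg [Finite α] [DecidableEq α] {J : Subgroup (FreeGroup α)}
    (hJ : HasFinitePrefixCosets J) : J.FG := by
  obtain ⟨T₀, hT₀, hT⟩ := hJ
  set T := insert 1 T₀ with hTdef
  have hTf : T.Finite := hT₀.insert 1
  -- the Schreier generators, and the representatives that happen to lie in `J`
  set X : Set (FreeGroup α) := (T ∪ Set.image2 (fun (q : FreeGroup α × FreeGroup α)
    (x : α × Bool) => q.1 * mk [x] * q.2⁻¹) (T ×ˢ T) Set.univ) ∩ J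
  have hXf : X.Finite :=
    (hTf.union (Set.Finite.image2 _ (hTf.prod hTf) Set.finite_univ)).inter_of_left _
  have hXJ : Subgroup.closure X ≤ J := (Subgroup.closure_le _).2 Set.inter_subset_right
  rw [Subgroup.fg_iff]
  refine ⟨X, le_antisymm hXJ fun k hk => ?_, hXf⟩
  obtain ⟨z, hz, hzk⟩ := exists_mul_inv_mem_of_step (D := Subgroup.closure X) (Z := T)
    (Set.mem_insert _ _) (k := k) (fun p x hp z hz hpz => by
      obtain ⟨t, ht, hpt⟩ := hT k hk _ hp
      have ht' : t ∈ T := Set.mem_insert_of_mem _ ht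
      refine ⟨t, ht', ?_⟩
      have e : mk (p ++ [x]) * t⁻¹ = (mk p * z⁻¹) * (z * mk [x] * t⁻¹) := by
        rw [← mul_mk]; group
      rw [e] at hpt ⊢
      refine mul_mem hpz (Subgroup.subset_closure ⟨Or.inr ⟨(z, t), ⟨hz, ht'⟩, x, trivial, rfl⟩, ?_⟩)
      exact (Subgroup.mul_mem_cancel_left J (hXJ hpz)).1 hpt)
  have hzJ : z ∈ J := by
    have := mul_mem (inv_mem (hXJ hzk)) hk
    simpa using this
  simpa using mul_mem hzk (Subgroup.subset_closure ⟨Or.inl hz, hzJ⟩)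

/-- Howson's theorem. -/
theorem fg_inf [Finite α] {J J' : Subgroup (FreeGroup α)} (hJ : J.FG) (hJ' : J'.FG) :
    (J ⊓ J').FG := by
  classical
  obtain ⟨T, hTf, hT⟩ := hJ.hasFinitePrefixCosets
  obtain ⟨T', hTf', hT'⟩ := hJ'.hasFinitePrefixCosets
  -- a common representative of two cosets that meet
  let r : FreeGroup α × FreeGroup α → FreeGroup α := fun q =>
    if h : ∃ g, g * q.1⁻¹ ∈ J ∧ g * q.2⁻¹ ∈ J' then h.choose else 1
  refine HasFinitePrefixCosets.fg ⟨r '' (T ×ˢ T'), (hTf.prod hTf').image _, fun h hh p hp => ?_⟩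
  obtain ⟨t, ht, hpt⟩ := hT h hh.1 p hp
  obtain ⟨t', ht', hpt'⟩ := hT' h hh.2 p hp
  have H : ∃ g, g * t⁻¹ ∈ J ∧ g * t'⁻¹ ∈ J' := ⟨_, hpt, hpt'⟩
  refine ⟨_, ⟨(t, t'), ⟨ht, ht'⟩, rfl⟩, ?_⟩
  simp only [r, dif_pos H]
  have h1 := mul_mem hpt (inv_mem H.choose_spec.1)
  have h2 := mul_mem hpt' (inv_mem H.choose_spec.2)
  constructor
  · simpa [mul_assoc] using h1
  · simpa [mul_assoc] using h2

/-- A finitely generated normal subgroup that contains the commutators has finite index in a free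
group of rank at least two: each `k` is a prefix of the reduced form `k [z, y] k⁻¹` of some
conjugate of a commutator of letters. -/
theorem finite_quotient_of_fg [Nontrivial α] {N : Subgroup (FreeGroup α)} [N.Normal]
    (hN : N.FG) (hc : ∀ x y : FreeGroup α, x * y * x⁻¹ * y⁻¹ ∈ N) :
    Finite (FreeGroup α ⧸ N) := by
  classical
  obtain ⟨T, hTf, hT⟩ := hN.hasFinitePrefixCosets
  suffices H : ∀ k : FreeGroup α, ∃ t ∈ T, k * t⁻¹ ∈ N by
    have : Finite T := hTf
    refine Finite.of_surjective (fun t : T => ((t : FreeGroup α) : FreeGroup α ⧸ N)) fun q => ?_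
    obtain ⟨k, rfl⟩ := QuotientGroup.mk_surjective q
    obtain ⟨t, ht, hk⟩ := H k
    refine ⟨⟨t, ht⟩, ?_⟩
    exact QuotientGroup.eq.2 (Subgroup.Normal.mem_comm inferInstance hk)
  intro k
  obtain ⟨c, hcN, hred⟩ : ∃ c : List (α × Bool), mk c ∈ N ∧
      IsReduced (k.toWord ++ c ++ invRev k.toWord) := by
    have comm : ∀ z x : α × Bool, mk [z, x, (z.1, !z.2), (x.1, !x.2)] ∈ N := by
      intro z x
      have := hc (mk [z]) (mk [x])
      rwa [inv_mk, inv_mk, mul_mk, mul_mk, mul_mk] at this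
    have hk : IsReduced k.toWord := isReduced_toWord
    have hk' : IsReduced (invRev k.toWord) := by rw [← toWord_inv]; exact isReduced_toWord
    induction hw : k.toWord using List.reverseRecOn with
    | nil =>
      exact ⟨[], by rw [← one_eq_mk]; exact one_mem _, by simp [IsReduced.nil]⟩
    | append_singleton w x _ =>
      obtain ⟨z, hz⟩ := exists_ne x.1
      refine ⟨_, comm (z, true) x, ?_⟩
      rw [hw] at hk hk'
      have hi : invRev (w ++ [x]) = (x.1, !x.2) :: invRev w := by simp [invRev]
      rw [hi] at hk' ⊢
      rw [List.append_assoc]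
      refine IsReduced.append_overlap hk ?_ (List.cons_ne_nil _ _)
      simp only [List.cons_append, List.nil_append, isReduced_cons_cons]
      exact ⟨fun h => absurd h.symm hz, fun h => absurd h hz, fun h => absurd h.symm hz,
        fun h => absurd h hz, fun _ => trivial, hk'⟩
  have hmem : mk (k.toWord ++ c ++ invRev k.toWord) ∈ N := by
    rw [← mul_mk, ← mul_mk, ← inv_mk, mk_toWord]
    exact Subgroup.Normal.conj_mem inferInstance _ hcN _
  have := hT _ hmem k.toWord (by
    rw [toWord_mk, hred.reduce_eq, List.append_assoc]; exact List.prefix_append _ _)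
  simpa [mk_toWord] using this

end FreeGroup

/-! ### Bases of free groups -/

theorem Subgroup.FG.map {G G' : Type*} [Group G] [Group G'] {P : Subgroup G} (h : P.FG)
    (f : G →* G') : (P.map f).FG := by
  rw [← Group.fg_iff_subgroup_fg] at h ⊢
  exact Group.fg_of_surjective (f.subgroupMap_surjective P)

namespace FreeGroup

theorem subsingleton_of_commute {X : Type*} (h : ∀ x y : FreeGroup X, x * y = y * x) :
    Subsingleton X := by
  classical
  refine ⟨fun a b => ?_⟩
  by_contra hab
  have := congrArg toWord (h (of a) (of b))
  simp [of, mul_mk, toWord_mk, reduce, hab, Ne.symm hab] at this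

theorem commute_of_subsingleton {X : Type*} [Subsingleton X] (x y : FreeGroup X) :
    x * y = y * x := by
  have h : ∀ y, ∀ a : X, of a * y = y * of a := fun y a => by
    induction y using FreeGroup.induction_on with
    | C1 => simp
    | of b => rw [Subsingleton.elim b a]
    | inv_of b _ => rw [Subsingleton.elim b a]; simp
    | mul u v hu hv => rw [← mul_assoc, hu, mul_assoc, hv, mul_assoc]
  induction x using FreeGroup.induction_on with
  | C1 => simp
  | of a => exact h y a
  | inv_of a _ => rw [inv_mul_eq_iff_eq_mul, ← mul_assoc, h y a, mul_assoc, mul_inv_cancel, mul_one]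
  | mul u v hu hv => rw [mul_assoc, hv, ← mul_assoc, hu, mul_assoc]

theorem finite_of_fg (X : Type*) [Group.FG (FreeGroup X)] : Finite X := by
  let f : FreeGroup X →* Multiplicative (X →₀ ℤ) :=
    FreeGroup.lift fun x => Multiplicative.ofAdd (Finsupp.single x 1)
  have hf : Function.Surjective f := by
    intro c
    induction h : c.toAdd using Finsupp.induction_linear generalizing c with
    | zero => exact ⟨1, by rw [_root_.map_one]; exact h.symm⟩
    | add u v hu hv =>
      obtain ⟨x, hx⟩ := hu (Multiplicative.ofAdd u) rfl
      obtain ⟨y, hy⟩ := hv (Multiplicative.ofAdd v) rfl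
      exact ⟨x * y, by rw [_root_.map_mul, hx, hy]; exact h.symm⟩
    | single x k =>
      refine ⟨of x ^ k, ?_⟩
      rw [map_zpow, lift_apply_of, ← ofAdd_zsmul]
      apply Multiplicative.toAdd.injective
      simp [h]
  have : Group.FG (Multiplicative (X →₀ ℤ)) := Group.fg_of_surjective hf
  have : AddGroup.FG (X →₀ ℤ) := AddGroup.fg_iff_mul_fg.2 this
  have : Module.Finite ℤ (X →₀ ℤ) := Module.Finite.iff_addGroup_fg.2 this
  exact Module.Finite.finite_basis (Finsupp.basisSingleOne (R := ℤ) (ι := X))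

/-- A finitely generated subgroup of a free group has a finite basis. -/
theorem exists_finite_basis {α : Type} {J : Subgroup (FreeGroup α)} (hJ : J.FG) :
    ∃ k, Nonempty (FreeGroupBasis (Fin k) J) := by
  have : Group.FG J := (Group.fg_iff_subgroup_fg J).2 hJ
  obtain ⟨X, ⟨b⟩⟩ := IsFreeGroup.nonempty_basis (G := J)
  have : Group.FG (FreeGroup X) :=
    Group.fg_of_surjective (f := b.repr.toMonoidHom) b.repr.surjective
  have := finite_of_fg X
  obtain ⟨k, ⟨e⟩⟩ := Finite.exists_equiv_fin X
  exact ⟨k, ⟨b.reindex e⟩⟩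

theorem fg_of_commute {α : Type} {N : Subgroup (FreeGroup α)}
    (h : ∀ x ∈ N, ∀ y ∈ N, x * y = y * x) : N.FG := by
  obtain ⟨X, ⟨b⟩⟩ := IsFreeGroup.nonempty_basis (G := N)
  have : Subsingleton X := subsingleton_of_commute fun x y => b.repr.symm.injective <| by
    rw [_root_.map_mul, _root_.map_mul]
    exact Subtype.ext (h _ (Subtype.prop _) _ (Subtype.prop _))
  rw [← Group.fg_iff_subgroup_fg]
  exact Group.fg_of_surjective (f := b.repr.symm.toMonoidHom) b.repr.symm.surjective

end FreeGroup

/-! ### Finite generation of the intersection -/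

namespace ZF

variable {m n : ℕ}

theorem mem_freeProj {H : Subgroup (ZF m n)} {w : FreeGroup (Fin n)} :
    w ∈ freeProj H ↔ ∃ h ∈ H, h.2 = w := Iff.rfl

theorem mem_abelianPart {H : Subgroup (ZF m n)} {a : Fin m → ℤ} :
    a ∈ abelianPart H ↔ ((Multiplicative.ofAdd a, 1) : ZF m n) ∈ H := Iff.rfl

theorem toAdd_fst_mem_abelianPart {H : Subgroup (ZF m n)} {h : ZF m n} (hh : h ∈ H)
    (h2 : h.2 = 1) : h.1.toAdd ∈ abelianPart H := by
  rw [mem_abelianPart, ← h2]; exact hh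

theorem freeProj_mono {H H' : Subgroup (ZF m n)} (h : H ≤ H') :
    freeProj H ≤ freeProj H' := Subgroup.map_mono h

/-- A subgroup of `H` is `H` as soon as it has the same free and abelian parts. -/
theorem le_of_freeProj_le {E H : Subgroup (ZF m n)} (hE : E ≤ H)
    (hf : freeProj H ≤ freeProj E) (ha : abelianPart H ≤ abelianPart E) : H ≤ E := by
  intro h hh
  obtain ⟨e, he, he2⟩ := mem_freeProj.1 (hf (mem_freeProj.2 ⟨h, hh, rfl⟩))
  have h1 : h * e⁻¹ ∈ H := mul_mem hh (inv_mem (hE he))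
  have h2 : (h * e⁻¹).2 = 1 := by simp [he2]
  have h3 : (h * e⁻¹) ∈ E := by
    have := ha (toAdd_fst_mem_abelianPart h1 h2)
    rw [mem_abelianPart, ← h2] at this
    exact this
  simpa using mul_mem h3 he

theorem abelianPart_fg (H : Subgroup (ZF m n)) : (abelianPart H).FG := by
  have := IsNoetherian.noetherian (AddSubgroup.toIntSubmodule (abelianPart H))
  exact (Submodule.fg_iff_addSubgroup_fg _).1 this

theorem fg_iff_freeProj_fg {H : Subgroup (ZF m n)} : H.FG ↔ (freeProj H).FG := by
  refine ⟨fun h => Subgroup.FG.map h _, fun h => ?_⟩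
  obtain ⟨S, hS, hSf⟩ := (Subgroup.fg_iff _).1 h
  obtain ⟨T, hT, hTf⟩ := (AddSubgroup.fg_iff _).1 (abelianPart_fg H)
  have hSH : ∀ s ∈ S, ∃ x ∈ H, x.2 = s := fun s hs =>
    mem_freeProj.1 (by rw [← hS]; exact Subgroup.subset_closure hs)
  choose! σ hσ hσ2 using hSH
  let E := Subgroup.closure
    (σ '' S ∪ (fun a => ((Multiplicative.ofAdd a, 1) : ZF m n)) '' T)
  have hE : E ≤ H := by
    rw [Subgroup.closure_le]
    rintro _ (⟨s, hs, rfl⟩ | ⟨a, ha, rfl⟩)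
    · exact hσ s hs
    · exact mem_abelianPart.1 (by rw [← hT]; exact AddSubgroup.subset_closure ha)
  refine (Subgroup.fg_iff _).2 ⟨_, le_antisymm hE (le_of_freeProj_le hE ?_ ?_),
    (hSf.image _).union (hTf.image _)⟩
  · rw [← hS, Subgroup.closure_le]
    exact fun s hs => mem_freeProj.2
      ⟨_, Subgroup.subset_closure (Or.inl ⟨s, hs, rfl⟩), hσ2 s hs⟩
  · rw [← hT, AddSubgroup.closure_le]
    exact fun a ha => mem_abelianPart.2 (Subgroup.subset_closure (Or.inr ⟨a, ha, rfl⟩))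

/-- The elements of `H π ∩ H' π` differ in their lifts to `H` and to `H'` by vectors that are
torsion modulo `L + L'`. -/
def DiffTorsion (H H' : Subgroup (ZF m n)) : Prop :=
  ∀ h ∈ H, ∀ h' ∈ H', h.2 = h'.2 →
    ∃ N : ℕ, 0 < N ∧ N • (h.1.toAdd - h'.1.toAdd) ∈ abelianPart H ⊔ abelianPart H'

/-- An element of `H π ∩ H' π` lies in `(H ∩ H') π` if and only if its lifts differ by an element
of `L + L'`. -/
theorem mem_freeProj_inf_iff {H H' : Subgroup (ZF m n)} {h h' : ZF m n} (hh : h ∈ H)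
    (hh' : h' ∈ H') (e : h.2 = h'.2) :
    h.2 ∈ freeProj (H ⊓ H') ↔ h.1.toAdd - h'.1.toAdd ∈ abelianPart H ⊔ abelianPart H' := by
  rw [AddSubgroup.mem_sup]
  constructor
  · rintro ⟨g, ⟨hg, hg'⟩, hge⟩
    replace hge : g.2 = h.2 := hge
    replace hg : g ∈ H := hg
    replace hg' : g ∈ H' := hg'
    refine ⟨_, toAdd_fst_mem_abelianPart (mul_mem hh (inv_mem hg)) (by simp [hge]), _,
      toAdd_fst_mem_abelianPart (mul_mem hg' (inv_mem hh')) (by simp [hge, e]), ?_⟩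
    simp [sub_eq_add_neg]
  · rintro ⟨a, ha, a', ha', hs⟩
    refine mem_freeProj.2 ⟨h * (Multiplicative.ofAdd a, 1)⁻¹,
      Subgroup.mem_inf.2 ⟨mul_mem hh (inv_mem (mem_abelianPart.1 ha)), ?_⟩, by simp⟩
    have : h * (Multiplicative.ofAdd a, 1)⁻¹ = h' * (Multiplicative.ofAdd a', 1) := by
      refine Prod.ext ?_ (by simp [e])
      apply Multiplicative.toAdd.injective
      simp only [Prod.fst_mul, Prod.fst_inv, toAdd_mul, toAdd_inv, toAdd_ofAdd]
      rw [← sub_eq_add_neg, sub_eq_iff_eq_add, add_assoc, add_comm a', hs]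
      abel
    rw [this]
    exact mul_mem hh' (mem_abelianPart.1 ha')

theorem freeProj_inf_le (H H' : Subgroup (ZF m n)) :
    freeProj (H ⊓ H') ≤ freeProj H ⊓ freeProj H' :=
  le_inf (freeProj_mono inf_le_left) (freeProj_mono inf_le_right)

theorem commutator_mem_freeProj_inf {H H' : Subgroup (ZF m n)} {x y : FreeGroup (Fin n)}
    (hx : x ∈ freeProj H ⊓ freeProj H') (hy : y ∈ freeProj H ⊓ freeProj H') :
    x * y * x⁻¹ * y⁻¹ ∈ freeProj (H ⊓ H') := by
  obtain ⟨a, ha, rfl⟩ := mem_freeProj.1 hx.1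
  obtain ⟨a', ha', hae⟩ := mem_freeProj.1 hx.2
  obtain ⟨b, hb, rfl⟩ := mem_freeProj.1 hy.1
  obtain ⟨b', hb', hbe⟩ := mem_freeProj.1 hy.2
  have comm : ∀ c d : ZF m n, (c * d * c⁻¹ * d⁻¹).1 = 1 := fun c d => by
    simp [mul_comm c.1 d.1]
  refine mem_freeProj.2 ⟨a * b * a⁻¹ * b⁻¹, Subgroup.mem_inf.2
    ⟨mul_mem (mul_mem (mul_mem ha hb) (inv_mem ha)) (inv_mem hb), ?_⟩, rfl⟩
  have : a * b * a⁻¹ * b⁻¹ = a' * b' * a'⁻¹ * b'⁻¹ :=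
    Prod.ext (by rw [comm, comm]) (by simp [hae, hbe])
  rw [this]
  exact mul_mem (mul_mem (mul_mem ha' hb') (inv_mem ha')) (inv_mem hb')

theorem diffTorsion_of_finite_quotient {H H' : Subgroup (ZF m n)}
    (h : ∀ k ∈ freeProj H ⊓ freeProj H', ∃ N : ℕ, 0 < N ∧ k ^ N ∈ freeProj (H ⊓ H')) :
    DiffTorsion H H' := by
  intro x hx x' hx' e
  obtain ⟨N, hN, hk⟩ := h x.2 ⟨⟨x, hx, rfl⟩, ⟨x', hx', e.symm⟩⟩
  refine ⟨N, hN, ?_⟩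
  have := (mem_freeProj_inf_iff (pow_mem hx N) (pow_mem hx' N) (by simp [e])).1 (by simpa using hk)
  simpa [smul_sub] using this

theorem exists_pow_mem_of_diffTorsion {H H' : Subgroup (ZF m n)} (h : DiffTorsion H H')
    {k : FreeGroup (Fin n)} (hk : k ∈ freeProj H ⊓ freeProj H') :
    ∃ N : ℕ, 0 < N ∧ k ^ N ∈ freeProj (H ⊓ H') := by
  obtain ⟨x, hx, rfl⟩ := mem_freeProj.1 hk.1
  obtain ⟨x', hx', e⟩ := mem_freeProj.1 hk.2
  obtain ⟨N, hN, hk⟩ := h x hx x' hx' e.symm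
  refine ⟨N, hN, ?_⟩
  have := (mem_freeProj_inf_iff (pow_mem hx N) (pow_mem hx' N) (by simp [e])).2
    (by simpa [smul_sub] using hk)
  simpa using this

/-- `(H ∩ H') π` as a subgroup of `H π ∩ H' π`. -/
abbrev interProj (H H' : Subgroup (ZF m n)) :
    Subgroup (freeProj H ⊓ freeProj H' : Subgroup (FreeGroup (Fin n))) :=
  (freeProj (H ⊓ H')).subgroupOf _

instance (H H' : Subgroup (ZF m n)) : (interProj H H').Normal := by
  apply Subgroup.Normal.of_commutator_le
  rw [commutator_def, Subgroup.commutator_le]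
  intro x _ y _
  exact commutator_mem_freeProj_inf x.2 y.2

theorem finite_quotient_of_diffTorsion {H H' : Subgroup (ZF m n)} (hH : H.FG) (hH' : H'.FG)
    (h : DiffTorsion H H') : Finite (_ ⧸ interProj H H') := by
  have hK := FreeGroup.fg_inf (fg_iff_freeProj_fg.1 hH) (fg_iff_freeProj_fg.1 hH')
  have := (Group.fg_iff_subgroup_fg _).2 hK
  let _ : CommGroup (_ ⧸ interProj H H') :=
    { (inferInstance : Group (_ ⧸ interProj H H')) with
      mul_comm := by
        intro a b
        obtain ⟨x, rfl⟩ := QuotientGroup.mk_surjective a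
        obtain ⟨y, rfl⟩ := QuotientGroup.mk_surjective b
        refine QuotientGroup.eq.2 ?_
        have := commutator_mem_freeProj_inf (H := H) (H' := H') (inv_mem y.2) (inv_mem x.2)
        simpa [Subgroup.mem_subgroupOf, mul_assoc] using this }
  refine CommGroup.finite_of_fg_isMulTorsion _ fun a => ?_
  obtain ⟨x, rfl⟩ := QuotientGroup.mk_surjective a
  obtain ⟨N, hN, hx⟩ := exists_pow_mem_of_diffTorsion h x.2
  rw [isOfFinOrder_iff_pow_eq_one]
  exact ⟨N, hN, (QuotientGroup.eq_one_iff (x ^ N)).2 hx⟩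

/-- The intersection of two finitely generated subgroups is finitely generated if and only if
`H π ∩ H' π` is commutative or contains `(H ∩ H') π` with finite index. -/
theorem fg_inf_iff {H H' : Subgroup (ZF m n)} (hH : H.FG) (hH' : H'.FG) :
    (H ⊓ H').FG ↔ (∀ x ∈ freeProj H ⊓ freeProj H', ∀ y ∈ freeProj H ⊓ freeProj H',
      x * y = y * x) ∨ DiffTorsion H H' := by
  rw [fg_iff_freeProj_fg]
  have hNK : Group.FG (interProj H H') ↔ (freeProj (H ⊓ H')).FG := by
    rw [← Group.fg_iff_subgroup_fg]
    exact ⟨fun h => Group.fg_of_surjective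
        (f := (Subgroup.subgroupOfEquivOfLe (freeProj_inf_le H H')).toMonoidHom)
        (Subgroup.subgroupOfEquivOfLe (freeProj_inf_le H H')).surjective,
      fun h => Group.fg_of_surjective
        (f := (Subgroup.subgroupOfEquivOfLe (freeProj_inf_le H H')).symm.toMonoidHom)
        (Subgroup.subgroupOfEquivOfLe (freeProj_inf_le H H')).symm.surjective⟩
  constructor
  · intro hN
    rw [or_iff_not_imp_left]
    intro hcomm
    obtain ⟨X, ⟨b⟩⟩ := IsFreeGroup.nonempty_basis
      (G := (freeProj H ⊓ freeProj H' : Subgroup (FreeGroup (Fin n))))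
    have : Nontrivial X := by
      rw [← not_subsingleton_iff_nontrivial]
      intro hX
      refine hcomm fun x hx y hy => ?_
      have := b.repr.injective (a₁ := ⟨x, hx⟩ * ⟨y, hy⟩) (a₂ := ⟨y, hy⟩ * ⟨x, hx⟩) (by
        rw [map_mul, map_mul, FreeGroup.commute_of_subsingleton])
      exact congrArg Subtype.val this
    have hfg : ((interProj H H').map b.repr.toMonoidHom).FG :=
      Subgroup.FG.map ((Group.fg_iff_subgroup_fg _).1 (hNK.2 hN)) _
    have : ((interProj H H').map b.repr.toMonoidHom).Normal :=
      Subgroup.Normal.map inferInstance _ b.repr.surjective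
    have := FreeGroup.finite_quotient_of_fg hfg (fun x y => by
      obtain ⟨x, rfl⟩ := b.repr.surjective x
      obtain ⟨y, rfl⟩ := b.repr.surjective y
      exact ⟨x * y * x⁻¹ * y⁻¹, commutator_mem_freeProj_inf x.2 y.2, by simp⟩)
    refine diffTorsion_of_finite_quotient fun k hk => ?_
    refine ⟨Nat.card (_ ⧸ (interProj H H').map b.repr.toMonoidHom), Nat.card_pos, ?_⟩
    have h1 := pow_card_eq_one' (x := ((b.repr ⟨k, hk⟩ : FreeGroup X) :
      _ ⧸ (interProj H H').map b.repr.toMonoidHom))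
    rw [← QuotientGroup.mk_pow, QuotientGroup.eq_one_iff, ← map_pow] at h1
    obtain ⟨y, hy, hyk⟩ := h1
    have hy' : (y : FreeGroup (Fin n)) ∈ freeProj (H ⊓ H') := hy
    rw [b.repr.injective hyk] at hy'
    exact hy'
  · rintro (hc | ht)
    · exact FreeGroup.fg_of_commute fun x hx y hy =>
        hc x (freeProj_inf_le _ _ hx) y (freeProj_inf_le _ _ hy)
    · have := finite_quotient_of_diffTorsion hH hH' ht
      have : (interProj H H').FiniteIndex := Subgroup.finiteIndex_of_finite_quotient
      have hK := FreeGroup.fg_inf (fg_iff_freeProj_fg.1 hH) (fg_iff_freeProj_fg.1 hH')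
      have := (Group.fg_iff_subgroup_fg _).2 hK
      exact hNK.1 inferInstance

end ZF

/-! ### The criterion in coordinates -/

theorem FreeGroupBasis.mem_of_forall_mem {ι G : Type*} [Group G] (b : FreeGroupBasis ι G)
    {P : Subgroup G} (h : ∀ i, b i ∈ P) (x : G) : x ∈ P := by
  have hx : ∀ y : FreeGroup ι, b.repr.symm y ∈ P := fun y => by
    induction y using FreeGroup.induction_on with
    | C1 => simp
    | of a => exact h a
    | inv_of a _ => rw [_root_.map_inv]; exact inv_mem (h a)
    | mul u v hu hv => rw [_root_.map_mul]; exact mul_mem hu hv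
  simpa using hx (b.repr x)

namespace ZF

variable {m n : ℕ}

theorem abelianization_basis {K : Type} [Group K] {k : ℕ} (u : FreeGroupBasis (Fin k) K)
    (i : Fin k) : abelianization u (u i) = Multiplicative.ofAdd (Pi.single i 1) := by
  simp [abelianization]

theorem abelianization_surjective {K : Type} [Group K] {k : ℕ} (u : FreeGroupBasis (Fin k) K) :
    Function.Surjective (abelianization u) := by
  intro c
  have hc : c = ∏ i, (Multiplicative.ofAdd (Pi.single i 1 : Fin k → ℤ)) ^ (c.toAdd i) := by
    apply Multiplicative.toAdd.injective
    rw [toAdd_prod]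
    ext j
    simp [Finset.sum_apply, Pi.single_apply]
  have : c ∈ (abelianization u).range := by
    rw [hc]
    exact Subgroup.prod_mem _ fun i _ =>
      Subgroup.zpow_mem _ (MonoidHom.mem_range.2 ⟨u i, abelianization_basis u i⟩) _
  exact this

/-- The rows of `A` extend to lifts of all elements of `H π`. -/
theorem vecMul_abelianization_mem {H : Subgroup (ZF m n)} {k : ℕ}
    (u : FreeGroupBasis (Fin k) (freeProj H)) (A : Matrix (Fin k) (Fin m) ℤ)
    (hA : ∀ i, ((Multiplicative.ofAdd (A i), (u i : FreeGroup (Fin n))) : ZF m n) ∈ H)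
    (x : freeProj H) :
    ((Multiplicative.ofAdd (Matrix.vecMul (abelianization u x).toAdd A),
      (x : FreeGroup (Fin n))) : ZF m n) ∈ H := by
  let φ : freeProj H →* ZF m n := MonoidHom.prod
    ((AddMonoidHom.toMultiplicative (Matrix.vecMulLinear A).toAddMonoidHom).comp
      (abelianization u)) (freeProj H).subtype
  refine u.mem_of_forall_mem (P := H.comap φ) (fun i => ?_) x
  have : φ (u i) = (Multiplicative.ofAdd (A i), (u i : FreeGroup (Fin n))) := by
    refine Prod.ext (Multiplicative.toAdd.injective ?_) rfl
    simp [φ, abelianization_basis, Matrix.row]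
  rw [Subgroup.mem_comap, this]
  exact hA i

theorem nonempty_coordinates {H H' : Subgroup (ZF m n)} (hH : H.FG) (hH' : H'.FG) :
    Nonempty (Coordinates H H') := by
  obtain ⟨n₁, ⟨u⟩⟩ := FreeGroup.exists_finite_basis (fg_iff_freeProj_fg.1 hH)
  obtain ⟨n₂, ⟨u'⟩⟩ := FreeGroup.exists_finite_basis (fg_iff_freeProj_fg.1 hH')
  obtain ⟨n₃, ⟨v⟩⟩ := FreeGroup.exists_finite_basis
    (FreeGroup.fg_inf (fg_iff_freeProj_fg.1 hH) (fg_iff_freeProj_fg.1 hH'))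
  have lift : ∀ {H : Subgroup (ZF m n)} (x : freeProj H), ∃ a : Fin m → ℤ,
      ((Multiplicative.ofAdd a, (x : FreeGroup (Fin n))) : ZF m n) ∈ H := fun {H} x => by
    obtain ⟨h, hh, e⟩ := mem_freeProj.1 x.2
    exact ⟨h.1.toAdd, by rw [← e]; exact hh⟩
  choose A hA using fun i => lift (u i)
  choose A' hA' using fun i => lift (u' i)
  exact ⟨⟨n₁, n₂, n₃, u, u', v, A, A', hA, hA'⟩⟩

namespace Coordinates

variable {H H' : Subgroup (ZF m n)} (D : Coordinates H H')

theorem abelianization_inclusion_left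
    (x : (freeProj H ⊓ freeProj H' : Subgroup (FreeGroup (Fin n)))) :
    (abelianization D.u (Subgroup.inclusion inf_le_left x)).toAdd =
      Matrix.vecMul (abelianization D.v x).toAdd D.P := by
  have := D.v.mem_of_forall_mem (P := ((abelianization D.u).comp
    (Subgroup.inclusion inf_le_left)).eqLocus ((AddMonoidHom.toMultiplicative
      (Matrix.vecMulLinear D.P).toAddMonoidHom).comp (abelianization D.v))) (fun i => by
    apply Multiplicative.toAdd.injective
    simp [abelianization_basis, P, Matrix.row]) x
  exact congrArg Multiplicative.toAdd this

theorem abelianization_inclusion_right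
    (x : (freeProj H ⊓ freeProj H' : Subgroup (FreeGroup (Fin n)))) :
    (abelianization D.u' (Subgroup.inclusion inf_le_right x)).toAdd =
      Matrix.vecMul (abelianization D.v x).toAdd D.P' := by
  have := D.v.mem_of_forall_mem (P := ((abelianization D.u').comp
    (Subgroup.inclusion inf_le_right)).eqLocus ((AddMonoidHom.toMultiplicative
      (Matrix.vecMulLinear D.P').toAddMonoidHom).comp (abelianization D.v))) (fun i => by
    apply Multiplicative.toAdd.injective
    simp [abelianization_basis, P', Matrix.row]) x
  exact congrArg Multiplicative.toAdd this

/-- `M` is the image of `(H ∩ H') π` in the abelianization of `H π ∩ H' π`. -/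
theorem abelianization_mem_M
    (x : (freeProj H ⊓ freeProj H' : Subgroup (FreeGroup (Fin n)))) :
    (abelianization D.v x).toAdd ∈ D.M ↔ (x : FreeGroup (Fin n)) ∈ freeProj (H ⊓ H') := by
  have h := vecMul_abelianization_mem D.u D.A D.lift_mem (Subgroup.inclusion inf_le_left x)
  have h' := vecMul_abelianization_mem D.u' D.A' D.lift_mem' (Subgroup.inclusion inf_le_right x)
  have := mem_freeProj_inf_iff h h' rfl
  rw [abelianization_inclusion_left, abelianization_inclusion_right] at this
  refine Iff.trans ?_ this.symm
  simp [M, Matrix.vecMul_vecMul]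

theorem diffTorsion_iff :
    DiffTorsion H H' ↔ ∀ c : Fin D.n₃ → ℤ, ∃ N : ℕ, 0 < N ∧ N • c ∈ D.M := by
  constructor
  · intro h c
    obtain ⟨x, hx⟩ := abelianization_surjective D.v (Multiplicative.ofAdd c)
    obtain ⟨N, hN, hk⟩ := exists_pow_mem_of_diffTorsion h x.2
    refine ⟨N, hN, ?_⟩
    have := (D.abelianization_mem_M (x ^ N)).2 hk
    simpa [hx] using this
  · refine fun h => diffTorsion_of_finite_quotient fun k hk => ?_
    obtain ⟨N, hN, hM⟩ := h (abelianization D.v ⟨k, hk⟩).toAdd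
    refine ⟨N, hN, (D.abelianization_mem_M (⟨k, hk⟩ ^ N)).1 ?_⟩
    rw [map_pow, toAdd_pow]
    exact hM

theorem commute_iff : (∀ x ∈ freeProj H ⊓ freeProj H', ∀ y ∈ freeProj H ⊓ freeProj H',
    x * y = y * x) ↔ D.n₃ ≤ 1 := by
  rw [← Fin.subsingleton_iff_le_one]
  constructor
  · refine fun h => FreeGroup.subsingleton_of_commute fun x y => D.v.repr.symm.injective ?_
    rw [_root_.map_mul, _root_.map_mul]
    exact Subtype.ext (h _ (Subtype.prop _) _ (Subtype.prop _))
  · intro _ x hx y hy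
    have := D.v.repr.injective (a₁ := ⟨x, hx⟩ * ⟨y, hy⟩) (a₂ := ⟨y, hy⟩ * ⟨x, hx⟩) (by
      rw [_root_.map_mul, _root_.map_mul, FreeGroup.commute_of_subsingleton])
    exact congrArg Subtype.val this

end Coordinates

theorem finrank_eq_iff {k : ℕ} (M : AddSubgroup (Fin k → ℤ)) :
    Module.finrank ℤ M = k ↔ ∀ c : Fin k → ℤ, ∃ N : ℕ, 0 < N ∧ N • c ∈ M := by
  have h := Submodule.finrank_quotient_add_finrank (AddSubgroup.toIntSubmodule M)
  rw [Module.finrank_fin_fun] at h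
  have h0 : Module.finrank ℤ M = k ↔
      Module.finrank ℤ ((Fin k → ℤ) ⧸ AddSubgroup.toIntSubmodule M) = 0 := by
    change Module.finrank ℤ (AddSubgroup.toIntSubmodule M) = k ↔ _
    omega
  rw [h0, Module.finrank_eq_zero_iff]
  constructor
  · intro hq c
    obtain ⟨a, ha, hc⟩ := hq (Submodule.Quotient.mk c)
    rw [← Submodule.Quotient.mk_smul, Submodule.Quotient.mk_eq_zero] at hc
    refine ⟨a.natAbs, Int.natAbs_pos.2 ha, ?_⟩
    rcases Int.natAbs_eq a with e | e
    · rw [e, natCast_zsmul] at hc; exact hc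
    · rw [e, neg_smul, natCast_zsmul, neg_mem_iff] at hc; exact hc
  · intro hq x
    obtain ⟨c, rfl⟩ := Submodule.Quotient.mk_surjective _ x
    obtain ⟨N, hN, hc⟩ := hq c
    refine ⟨N, by exact_mod_cast hN.ne', ?_⟩
    rw [← Submodule.Quotient.mk_smul, Submodule.Quotient.mk_eq_zero, natCast_zsmul]
    exact hc

theorem Coordinates.fg_inf_iff {H H' : Subgroup (ZF m n)} (hH : H.FG) (hH' : H'.FG)
    (D : Coordinates H H') :
    (H ⊓ H').FG ↔ (D.n₃ = 1 ∧ D.M = ⊥) ∨ Module.finrank ℤ D.M = D.n₃ := by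
  rw [ZF.fg_inf_iff hH hH', D.commute_iff, D.diffTorsion_iff, ← finrank_eq_iff]
  constructor
  · rintro (h | h)
    · rcases Nat.le_one_iff_eq_zero_or_eq_one.1 h with h | h
      · right
        have := Submodule.finrank_le (AddSubgroup.toIntSubmodule D.M)
        rw [Module.finrank_fin_fun] at this
        change Module.finrank ℤ D.M ≤ _ at this
        omega
      · by_cases hM : D.M = ⊥
        · exact Or.inl ⟨h, hM⟩
        · right
          have := Submodule.finrank_le (AddSubgroup.toIntSubmodule D.M)
          rw [Module.finrank_fin_fun] at this
          change Module.finrank ℤ D.M ≤ _ at this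
          have h0 : Module.finrank ℤ D.M ≠ 0 := fun h0 => hM <| by
            have : AddSubgroup.toIntSubmodule D.M = ⊥ := Submodule.finrank_eq_zero.1 h0
            simpa using this
          omega
    · exact Or.inr h
  · rintro (h | h)
    · exact Or.inl h.1.le
    · exact Or.inr h

end ZF

/-! ### Semidecidable predicates -/

/-- A predicate that holds at `a` if and only if some natural number is a certificate for it, where
certificates are checked by a primitive recursive procedure. -/
def Semidecidable {α : Type*} [Primcodable α] (p : α → Prop) : Prop :=
  ∃ q : α → ℕ → Bool, Primrec₂ q ∧ ∀ a, p a ↔ ∃ k, q a k = true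

namespace Semidecidable

variable {α β γ : Type*} [Primcodable α] [Primcodable β] [Primcodable γ]

theorem of_iff {p p' : α → Prop} (hp : Semidecidable p) (h : ∀ a, p' a ↔ p a) :
    Semidecidable p' := by
  rwa [show p' = p from funext fun a => propext (h a)]

theorem of_primrecRel {p : α → Prop} {q : α → ℕ → Prop} (hq : PrimrecRel q)
    (h : ∀ a, p a ↔ ∃ k, q a k) : Semidecidable p := by
  obtain ⟨hdec, hq⟩ := hq
  let _ : ∀ a k, Decidable (q a k) := fun a k => hdec (a, k)
  exact ⟨fun a k => decide (q a k), hq, fun a => by simp [h]⟩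

theorem of_primrec {p : α → Prop} (hp : PrimrecPred p) : Semidecidable p :=
  of_primrecRel (q := fun a _ => p a) (hp.comp Primrec.fst) fun _ => by simp

theorem comp {p : α → Prop} (hp : Semidecidable p) {f : β → α} (hf : Primrec f) :
    Semidecidable fun b => p (f b) := by
  obtain ⟨q, hq, h⟩ := hp
  exact ⟨fun b k => q (f b) k, hq.comp (hf.comp Primrec.fst) Primrec.snd, fun b => h (f b)⟩

theorem and {p p' : α → Prop} (hp : Semidecidable p) (hp' : Semidecidable p') :
    Semidecidable fun a => p a ∧ p' a := by
  obtain ⟨q, hq, h⟩ := hp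
  obtain ⟨q', hq', h'⟩ := hp'
  refine ⟨fun a k => q a k.unpair.1 && q' a k.unpair.2, Primrec.and.comp
    (hq.comp Primrec.fst (Primrec.fst.comp (Primrec.unpair.comp Primrec.snd)))
    (hq'.comp Primrec.fst (Primrec.snd.comp (Primrec.unpair.comp Primrec.snd))), fun a => ?_⟩
  simp only [h, h', Bool.and_eq_true]
  exact ⟨fun ⟨⟨k, hk⟩, ⟨l, hl⟩⟩ => ⟨Nat.pair k l, by simpa using ⟨hk, hl⟩⟩,
    fun ⟨k, hk, hl⟩ => ⟨⟨_, hk⟩, ⟨_, hl⟩⟩⟩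

theorem or {p p' : α → Prop} (hp : Semidecidable p) (hp' : Semidecidable p') :
    Semidecidable fun a => p a ∨ p' a := by
  obtain ⟨q, hq, h⟩ := hp
  obtain ⟨q', hq', h'⟩ := hp'
  refine ⟨fun a k => q a k || q' a k, Primrec.or.comp hq hq', fun a => ?_⟩
  simp only [h, h', Bool.or_eq_true, exists_or]

/-- Checks that `k` encodes an output `b` together with a certificate for `(a, b)`. -/
def checkPair (q : α × β → ℕ → Bool) (a : α) (k : ℕ) : Bool :=
  Option.casesOn (Encodable.decode (α := β) k.unpair.1) false fun b => q (a, b) k.unpair.2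

theorem primrec_checkPair {q : α × β → ℕ → Bool} (hq : Primrec₂ q) : Primrec₂ (checkPair q) := by
  refine Primrec.option_casesOn (Primrec.decode.comp (Primrec.fst.comp
    (Primrec.unpair.comp Primrec.snd))) (Primrec.const false) ?_
  exact hq.comp (Primrec.pair (Primrec.fst.comp Primrec.fst) Primrec.snd)
    (Primrec.snd.comp (Primrec.unpair.comp (Primrec.snd.comp Primrec.fst)))

omit [Primcodable α] in
theorem checkPair_pair {q : α × β → ℕ → Bool} {a : α} {b : β} {k : ℕ} (h : q (a, b) k = true) :
    checkPair q a (Nat.pair (Encodable.encode b) k) = true := by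
  simpa [checkPair] using h

omit [Primcodable α] in
theorem of_checkPair {q : α × β → ℕ → Bool} {a : α} {k : ℕ} (h : checkPair q a k = true) :
    ∃ b, Encodable.decode k.unpair.1 = some b ∧ q (a, b) k.unpair.2 = true := by
  rcases hd : Encodable.decode (α := β) k.unpair.1 with _ | b
  · simp [checkPair, hd] at h
  · exact ⟨b, rfl, by simpa [checkPair, hd] using h⟩

theorem exists_snd {p : α → β → Prop} (hp : Semidecidable fun x : α × β => p x.1 x.2) :
    Semidecidable fun a => ∃ b, p a b := by
  obtain ⟨q, hq, h⟩ := hp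
  refine ⟨checkPair q, primrec_checkPair hq, fun a => ⟨?_, ?_⟩⟩
  · rintro ⟨b, hb⟩
    obtain ⟨k, hk⟩ := (h (a, b)).1 hb
    exact ⟨_, checkPair_pair hk⟩
  · rintro ⟨k, hk⟩
    obtain ⟨b, -, hb⟩ := of_checkPair hk
    exact ⟨b, (h (a, b)).2 ⟨_, hb⟩⟩

theorem forall_mem {p : α → β → Prop} (hp : Semidecidable fun x : α × β => p x.1 x.2)
    {l : α → List β} (hl : Primrec l) : Semidecidable fun a => ∀ b ∈ l a, p a b := by
  obtain ⟨q, hq, h⟩ := hp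
  have h1 : PrimrecRel fun (K : ℕ) (x : α × β) => ∃ k < K, q x k = true :=
    (PrimrecRel.exists_mem_list (R := fun k (x : α × β) => q x k = true)
      (Primrec.eq.comp (hq.comp Primrec.snd Primrec.fst) (Primrec.const true))).comp
        (Primrec.list_range.comp Primrec.fst) Primrec.snd |>.of_eq fun x => by simp
  have h2 : PrimrecRel fun (L : List β) (y : α × ℕ) => ∀ b ∈ L, ∃ k < y.2, q (y.1, b) k = true :=
    PrimrecRel.forall_mem_list (R := fun b (y : α × ℕ) => ∃ k < y.2, q (y.1, b) k = true)
      (h1.comp (Primrec.snd.comp Primrec.snd)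
        (Primrec.pair (Primrec.fst.comp Primrec.snd) Primrec.fst))
  refine of_primrecRel (q := fun a K => ∀ b ∈ l a, ∃ k < K, q (a, b) k = true)
    (h2.comp (hl.comp Primrec.fst) Primrec.id) fun a => ?_
  constructor
  · intro H
    have : ∀ L : List β, (∀ b ∈ L, p a b) → ∃ K, ∀ b ∈ L, ∃ k < K, q (a, b) k = true := by
      intro L
      induction L with
      | nil => exact fun _ => ⟨0, by simp⟩
      | cons b L ih =>
        intro hL
        obtain ⟨K, hK⟩ := ih fun b hb => hL b (List.mem_cons_of_mem _ hb)
        obtain ⟨k, hk⟩ := (h (a, b)).1 (hL b List.mem_cons_self)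
        refine ⟨max K (k + 1), fun c hc => ?_⟩
        rcases List.mem_cons.1 hc with rfl | hc
        · exact ⟨k, by omega, hk⟩
        · obtain ⟨j, hj, hq⟩ := hK c hc
          exact ⟨j, by omega, hq⟩
    exact this _ H
  · rintro ⟨K, hK⟩ b hb
    obtain ⟨k, -, hk⟩ := hK b hb
    exact (h (a, b)).2 ⟨k, hk⟩

theorem exists_mem {p : α → β → Prop} (hp : Semidecidable fun x : α × β => p x.1 x.2)
    {l : α → List β} (hl : Primrec l) : Semidecidable fun a => ∃ b ∈ l a, p a b := by
  classical
  refine exists_snd (p := fun a b => b ∈ l a ∧ p a b) (and (of_primrec ?_) hp)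
  have : PrimrecRel fun (L : List β) (b : β) => ∃ c ∈ L, c = b :=
    PrimrecRel.exists_mem_list (R := fun c b : β => c = b) Primrec.eq
  exact (this.comp (hl.comp Primrec.fst) Primrec.snd).of_eq fun x => by simp

/-- A semidecidable relation that relates every input to some output contains the graph of a
computable function: search for an output together with a certificate. -/
theorem exists_computable {R : α → β → Prop} [Inhabited β]
    (hR : Semidecidable fun x : α × β => R x.1 x.2) (htot : ∀ a, ∃ b, R a b) :
    ∃ f : α → β, Computable f ∧ ∀ a, R a (f a) := by
  obtain ⟨q, hq, h⟩ := hR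
  have hex : ∀ a, ∃ k, checkPair q a k = true := fun a => by
    obtain ⟨b, hb⟩ := htot a
    obtain ⟨k, hk⟩ := (h (a, b)).1 hb
    exact ⟨_, checkPair_pair hk⟩
  have hc : ComputablePred fun x : α × ℕ => checkPair q x.1 x.2 = true := by
    refine Computable.computablePred (p := fun x : α × ℕ => checkPair q x.1 x.2 = true) ?_
    exact (primrec_checkPair hq).to_comp.of_eq fun x => by simp
  refine ⟨fun a => (Encodable.decode (Nat.find (hex a)).unpair.1).getD default, ?_, fun a => ?_⟩
  · exact Computable.option_getD ((Primrec.decode.comp (Primrec.fst.comp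
      Primrec.unpair)).to_comp.comp (Computable.find hc hex)) (Computable.const _)
  · obtain ⟨b, hb, hq⟩ := of_checkPair (Nat.find_spec (hex a))
    simp only [hb]
    exact (h (a, b)).2 ⟨_, hq⟩

end Semidecidable

/-! ### Primitive recursive operations on words -/

namespace FreeGroup

variable {α β γ : Type}

/-- Substitution of words for letters. -/
def subst (φ : α → GroupWord β) (w : GroupWord α) : GroupWord β :=
  w.flatMap fun x => if x.2 then φ x.1 else invRev (φ x.1)

theorem mk_subst (φ : α → GroupWord β) (w : GroupWord α) :
    mk (subst φ w) = lift (fun a => mk (φ a)) (mk w) := by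
  induction w with
  | nil => rfl
  | cons x w ih =>
    rw [subst, List.flatMap_cons, ← mul_mk, ← subst, ih, ← List.singleton_append, ← mul_mk,
      _root_.map_mul]
    congr 1
    rcases x with ⟨a, _ | _⟩ <;> simp [inv_mk]

variable [Primcodable α] [Primcodable β] [Primcodable γ]

theorem primrec_invRev : Primrec (invRev : GroupWord α → GroupWord α) := by
  refine Primrec.list_reverse.comp (Primrec.list_map Primrec.id
    (g := fun _ (x : α × Bool) => (x.1, !x.2)) ?_)
  exact Primrec.pair (Primrec.fst.comp Primrec.snd)
    (Primrec.not.comp (Primrec.snd.comp Primrec.snd))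

theorem primrec_reduce [DecidableEq α] : Primrec (reduce : GroupWord α → GroupWord α) := by
  let g : α × Bool → GroupWord α → GroupWord α := fun x L =>
    List.casesOn L [x] fun y tl => if x.1 = y.1 ∧ x.2 = !y.2 then tl else x :: y :: tl
  have hg : Primrec fun z : (α × Bool) × GroupWord α => g z.1 z.2 := by
    refine Primrec.list_casesOn (f := fun z : (α × Bool) × GroupWord α => z.2)
      (g := fun z => [z.1])
      (h := fun z p => if z.1.1 = p.1.1 ∧ z.1.2 = !p.1.2 then p.2 else z.1 :: p.1 :: p.2)
      Primrec.snd (Primrec.list_cons.comp Primrec.fst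
      (Primrec.const ([] : GroupWord α))) ?_
    refine Primrec.ite (PrimrecPred.and ?_ ?_) ?_ ?_
    · exact Primrec.eq.comp (Primrec.fst.comp (Primrec.fst.comp Primrec.fst))
        (Primrec.fst.comp (Primrec.fst.comp Primrec.snd))
    · exact Primrec.eq.comp (Primrec.snd.comp (Primrec.fst.comp Primrec.fst))
        (Primrec.not.comp (Primrec.snd.comp (Primrec.fst.comp Primrec.snd)))
    · exact Primrec.snd.comp Primrec.snd
    · exact Primrec.list_cons.comp (Primrec.fst.comp Primrec.fst)
        (Primrec.list_cons.comp (Primrec.fst.comp Primrec.snd) (Primrec.snd.comp Primrec.snd))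
  have hg' : Primrec₂ fun (_ : GroupWord α) (z : (α × Bool) × GroupWord α) => g z.1 z.2 :=
    hg.comp Primrec.snd
  refine (Primrec.list_foldr (f := fun L : GroupWord α => L)
    (g := fun _ => ([] : GroupWord α)) Primrec.id (Primrec.const []) hg').of_eq fun L => ?_
  induction L with
  | nil => rfl
  | cons x L ih =>
    rw [reduce.cons, List.foldr_cons, ih]

theorem primrecRel_mk_eq [DecidableEq α] :
    PrimrecRel fun v w : GroupWord α => mk v = mk w :=
  (Primrec.eq.comp (primrec_reduce.comp Primrec.fst) (primrec_reduce.comp Primrec.snd)).of_eq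
    fun _ => ⟨reduce.exact, reduce.sound⟩

theorem primrec_subst {φ : γ → α → GroupWord β} (hφ : Primrec₂ φ) {w : γ → GroupWord α}
    (hw : Primrec w) : Primrec fun c => subst (φ c) (w c) := by
  refine Primrec.list_flatMap hw (g := fun c x => if x.2 then φ c x.1 else invRev (φ c x.1)) ?_
  have h1 : Primrec fun z : γ × α × Bool => φ z.1 z.2.1 :=
    hφ.comp Primrec.fst (Primrec.fst.comp Primrec.snd)
  exact Primrec.ite (Primrec.eq.comp (Primrec.snd.comp (Primrec.snd (α := γ) (β := α × Bool)))
    (Primrec.const true)) h1 (primrec_invRev.comp h1)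

end FreeGroup

/-! ### Actions of free groups by automorphisms of a free group -/

namespace FreeGroup

variable {n : ℕ}

/-- The image of the letter `i` under the endomorphism with table `l`: letters beyond the table are
fixed. -/
def tableWord (l : List (GroupWord ℕ)) (i : ℕ) : GroupWord ℕ := l.getD i [(i, true)]

/-- The endomorphism of the free group on `ℕ` that is given by a finite table. -/
def tableHom (l : List (GroupWord ℕ)) : FreeGroup ℕ →* FreeGroup ℕ :=
  lift fun i => mk (tableWord l i)

theorem tableHom_of (l : List (GroupWord ℕ)) (i : ℕ) : tableHom l (of i) = mk (tableWord l i) :=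
  lift_apply_of

theorem tableHom_of_length_le {l : List (GroupWord ℕ)} {i : ℕ} (h : l.length ≤ i) :
    tableHom l (of i) = of i := by
  rw [tableHom_of, tableWord, List.getD_eq_default _ _ h]
  rfl

/-- A finite description of an action of the free group on `Fin n` by automorphisms of the free
group on `ℕ`: tables for each generator and its inverse. -/
abbrev ActionTable (n : ℕ) : Type := Fin n → List (GroupWord ℕ) × List (GroupWord ℕ)

namespace ActionTable

/-- The tables of each generator and of its inverse describe mutually inverse endomorphisms. -/
def Valid (c : ActionTable n) : Prop :=
  ∀ y, ∀ i < max (c y).1.length (c y).2.length,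
    tableHom (c y).1 (tableHom (c y).2 (of i)) = of i ∧
      tableHom (c y).2 (tableHom (c y).1 (of i)) = of i

theorem Valid.comp_eq {c : ActionTable n} (h : c.Valid) (y : Fin n) :
    (tableHom (c y).1).comp (tableHom (c y).2) = MonoidHom.id _ ∧
      (tableHom (c y).2).comp (tableHom (c y).1) = MonoidHom.id _ := by
  constructor <;> ext i <;> by_cases hi : i < max (c y).1.length (c y).2.length
  · exact (h y i hi).1
  · rw [not_lt, max_le_iff] at hi
    simp [tableHom_of_length_le hi.1, tableHom_of_length_le hi.2]
  · exact (h y i hi).2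
  · rw [not_lt, max_le_iff] at hi
    simp [tableHom_of_length_le hi.1, tableHom_of_length_le hi.2]

/-- The action that the tables describe. -/
def action {c : ActionTable n} (h : c.Valid) : FreeGroup (Fin n) →* MulAut (FreeGroup ℕ) :=
  lift fun y => (MonoidHom.toMulEquiv (tableHom (c y).1) (tableHom (c y).2) (h.comp_eq y).2
    (h.comp_eq y).1 : FreeGroup ℕ ≃* FreeGroup ℕ)

/-- The table by which a letter or its inverse acts. -/
def letter (c : ActionTable n) (x : Fin n × Bool) : List (GroupWord ℕ) :=
  if x.2 then (c x.1).1 else (c x.1).2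

theorem action_mk_cons {c : ActionTable n} (h : c.Valid) (x : Fin n × Bool)
    (w : GroupWord (Fin n)) (g : FreeGroup ℕ) :
    action h (mk (x :: w)) g = tableHom (letter c x) (action h (mk w) g) := by
  have : mk (x :: w) = mk [x] * mk w := by rw [mul_mk]; rfl
  rw [this, _root_.map_mul, MulAut.mul_apply]
  rcases x with ⟨y, _ | _⟩ <;> simp [action, letter]

/-- A word for the image of the letter `b` under the action of the word `w`. -/
def actWord (c : ActionTable n) (b : ℕ) (w : GroupWord (Fin n)) : GroupWord ℕ :=
  w.foldr (fun x acc => subst (tableWord (letter c x)) acc) [(b, true)]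

theorem mk_actWord {c : ActionTable n} (h : c.Valid) (b : ℕ) (w : GroupWord (Fin n)) :
    mk (actWord c b w) = action h (mk w) (of b) := by
  induction w with
  | nil =>
    rw [← one_eq_mk, _root_.map_one]
    rfl
  | cons x w ih =>
    rw [action_mk_cons, ← ih, actWord, List.foldr_cons, mk_subst]
    rfl

theorem action_of_fixed {c : ActionTable n} (h : c.Valid) {N : ℕ}
    (hN : ∀ y, (c y).1.length ≤ N ∧ (c y).2.length ≤ N) (g : FreeGroup (Fin n))
    {i : ℕ} (hi : N ≤ i) : action h g (of i) = of i := by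
  rw [← mk_toWord (x := g)]
  induction g.toWord with
  | nil => rw [← one_eq_mk, _root_.map_one]; rfl
  | cons x w ih =>
    rw [action_mk_cons, ih, tableHom_of_length_le]
    rw [letter]
    split
    · exact (hN x.1).1.trans hi
    · exact (hN x.1).2.trans hi

/-- If the letters `N + i` are fixed and `u i` acts by `b ↦ b * (N + i)`, then each word in the
`u i` acts on `b` as right multiplication by the same word in the letters `N + i`. -/
theorem action_lift {c : ActionTable n} (h : c.Valid) {N b : ℕ}
    (hN : ∀ y, (c y).1.length ≤ N ∧ (c y).2.length ≤ N) {k : ℕ} (u : Fin k → FreeGroup (Fin n))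
    (hu : ∀ i, action h (u i) (of b) = of b * of (N + i)) (w : FreeGroup (Fin k)) :
    action h (lift u w) (of b) = of b * map (fun i : Fin k => N + (i : ℕ)) w := by
  have fixed : ∀ g w, action h g (map (fun i : Fin k => N + (i : ℕ)) w) =
      map (fun i : Fin k => N + (i : ℕ)) w := by
    intro g w
    have : ((action h g : FreeGroup ℕ ≃* FreeGroup ℕ).toMonoidHom.comp
        (map fun i : Fin k => N + (i : ℕ))) = map (fun i : Fin k => N + (i : ℕ)) := by
      ext i
      simp [action_of_fixed h hN g (Nat.le_add_right N i)]
    exact DFunLike.congr_fun this w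
  induction w using FreeGroup.induction_on with
  | C1 => simp
  | of i => simpa using hu i
  | inv_of i hi =>
    rw [_root_.map_inv, _root_.map_inv, MulAut.inv_apply, MulEquiv.symm_apply_eq,
      _root_.map_mul, hi, fixed, mul_assoc, _root_.map_inv, mul_inv_cancel, mul_one]
  | mul v w hv hw =>
    rw [_root_.map_mul, _root_.map_mul, MulAut.mul_apply, hw, _root_.map_mul, hv, fixed,
      _root_.map_mul, mul_assoc]

end ActionTable

/-! ### Marshall Hall's theorem -/

section Hall

variable {J : Subgroup (FreeGroup (Fin n))}

open Classical in
/-- A transversal of the left cosets of `J` that contains `1`. -/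
noncomputable def transversal (J : Subgroup (FreeGroup (Fin n))) (q : FreeGroup (Fin n) ⧸ J) :
    FreeGroup (Fin n) :=
  if q = ((1 : FreeGroup (Fin n)) : FreeGroup (Fin n) ⧸ J) then 1 else q.out

theorem mk_transversal (q : FreeGroup (Fin n) ⧸ J) :
    ((transversal J q : FreeGroup (Fin n)) : FreeGroup (Fin n) ⧸ J) = q := by
  rw [transversal]
  split
  · next h => exact h.symm
  · exact Quotient.out_eq' q

theorem transversal_one :
    transversal J ((1 : FreeGroup (Fin n)) : FreeGroup (Fin n) ⧸ J) = 1 := if_pos rfl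

theorem transversal_inv_mul_mem (g : FreeGroup (Fin n)) (q : FreeGroup (Fin n) ⧸ J) :
    (transversal J (g • q))⁻¹ * (g * transversal J q) ∈ J := by
  rw [← QuotientGroup.eq, mk_transversal, ← smul_eq_mul, ← MulAction.Quotient.smul_coe,
    mk_transversal]

/-- The element of `J` by which the transversal fails to be equivariant under `g` at `q`. -/
noncomputable def cocycle (J : Subgroup (FreeGroup (Fin n))) (g : FreeGroup (Fin n))
    (q : FreeGroup (Fin n) ⧸ J) : J :=
  ⟨_, transversal_inv_mul_mem g q⟩

theorem cocycle_mul (g h : FreeGroup (Fin n)) (q : FreeGroup (Fin n) ⧸ J) :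
    cocycle J (g * h) q = cocycle J g (h • q) * cocycle J h q := by
  apply Subtype.ext
  simp [cocycle, mul_smul, mul_assoc]

theorem cocycle_inv (g : FreeGroup (Fin n)) (q : FreeGroup (Fin n) ⧸ J) :
    cocycle J g⁻¹ q = (cocycle J g (g⁻¹ • q))⁻¹ := by
  apply Subtype.ext
  simp [cocycle, mul_assoc]

theorem cocycle_one_left (q : FreeGroup (Fin n) ⧸ J) : cocycle J 1 q = 1 := by
  apply Subtype.ext
  simp [cocycle]

theorem cocycle_base {g : FreeGroup (Fin n)} (hg : g ∈ J) :
    cocycle J g ((1 : FreeGroup (Fin n)) : FreeGroup (Fin n) ⧸ J) = ⟨g, hg⟩ := by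
  have : g • ((1 : FreeGroup (Fin n)) : FreeGroup (Fin n) ⧸ J) =
      ((1 : FreeGroup (Fin n)) : FreeGroup (Fin n) ⧸ J) := by
    rw [MulAction.Quotient.smul_coe, smul_eq_mul, mul_one, QuotientGroup.eq]
    simpa using hg
  apply Subtype.ext
  simp [cocycle, this, transversal_one]

theorem tableHom_ofFn {N : ℕ} (f : Fin N → FreeGroup ℕ) (i : Fin N) :
    tableHom (List.ofFn fun i => (f i).toWord) (of (i : ℕ)) = f i := by
  rw [tableHom_of, tableWord, List.getD_eq_getElem _ _ (by simp)]
  simp [mk_toWord]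

theorem tableHom_map_add {l : List (GroupWord ℕ)} {N : ℕ} (hl : l.length ≤ N) (g : FreeGroup ℕ) :
    tableHom l (map (fun j => N + j) g) = map (fun j => N + j) g := by
  have : (tableHom l).comp (map fun j => N + j) = map fun j => N + j := by
    ext j
    simp [tableHom_of_length_le (hl.trans (Nat.le_add_right N j))]
  exact DFunLike.congr_fun this g

/-- A weighted form of Marshall Hall's theorem. Given a homomorphism `ρ` from `J` to a free group
and finitely many words, the free group acts partially, by injections, on the finitely many cosets
of `J` that the words visit. This partial action extends to an action by permutations; the letters
that number the cosets carry it, with weights given by `ρ`. -/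
theorem exists_actionTable (ρ : J →* FreeGroup ℕ) (ws : List (GroupWord (Fin n))) :
    ∃ (c : ActionTable n) (h : c.Valid) (N b : ℕ),
      (∀ y, (c y).1.length ≤ N ∧ (c y).2.length ≤ N) ∧ b < N ∧
      ∀ w ∈ ws, ∃ i, i < N ∧ (i = b ↔ mk w ∈ J) ∧
        ActionTable.action h (mk w) (of b) = of i * map (fun j => N + j)
          (ρ (cocycle J (mk w) ((1 : FreeGroup (Fin n)) : FreeGroup (Fin n) ⧸ J))) := by
  classical
  set q₀ : FreeGroup (Fin n) ⧸ J := ((1 : FreeGroup (Fin n)) : FreeGroup (Fin n) ⧸ J) with hq₀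
  let Xs : Finset (FreeGroup (Fin n) ⧸ J) :=
    insert q₀ ((ws.flatMap List.tails).map fun t => (mk t : FreeGroup (Fin n)) • q₀).toFinset
  let X := {q // q ∈ Xs}
  have hX : ∀ w ∈ ws, ∀ t, t <:+ w → (mk t : FreeGroup (Fin n)) • q₀ ∈ Xs := by
    intro w hw t ht
    refine Finset.mem_insert_of_mem (List.mem_toFinset.2 (List.mem_map.2 ⟨t, ?_, rfl⟩))
    exact List.mem_flatMap.2 ⟨w, hw, (List.mem_tails _ _).2 ht⟩
  let N := Fintype.card X
  let e : X ≃ Fin N := Fintype.equivFin X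
  -- the partial injection given by the generator `y`, and its extension to a permutation
  let φ : ∀ y : Fin n, {x : X // of y • x.1 ∈ Xs} ≃ {x : X // (of y)⁻¹ • x.1 ∈ Xs} := fun y =>
    { toFun := fun x => ⟨⟨of y • x.1.1, x.2⟩, by simp⟩
      invFun := fun x => ⟨⟨(of y)⁻¹ • x.1.1, x.2⟩, by simp⟩
      left_inv := fun x => by simp
      right_inv := fun x => by simp }
  let σ : Fin n → Equiv.Perm X := fun y => (φ y).extendSubtype
  have hσ : ∀ y (x : X) (hx : of y • x.1 ∈ Xs), σ y x = ⟨of y • x.1, hx⟩ := fun y x hx =>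
    Equiv.extendSubtype_apply_of_mem (φ y) x hx
  let sh : FreeGroup ℕ →* FreeGroup ℕ := map fun j => N + j
  let wt : Fin n → X → FreeGroup ℕ := fun y x => sh (ρ (cocycle J (of y) x.1))
  let F : Fin n → Fin N → FreeGroup ℕ := fun y i =>
    of (e (σ y (e.symm i)) : ℕ) * wt y (e.symm i)
  let B : Fin n → Fin N → FreeGroup ℕ := fun y i =>
    of (e ((σ y).symm (e.symm i)) : ℕ) * (wt y ((σ y).symm (e.symm i)))⁻¹
  let c : ActionTable n := fun y =>
    (List.ofFn fun i => (F y i).toWord, List.ofFn fun i => (B y i).toWord)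
  have hlen : ∀ y, (c y).1.length ≤ N ∧ (c y).2.length ≤ N := fun y => by simp [c]
  have hF : ∀ y (x : X), tableHom (c y).1 (of (e x : ℕ)) = of (e (σ y x) : ℕ) * wt y x :=
    fun y x => by simpa [F] using tableHom_ofFn (F y) (e x)
  have hB : ∀ y (x : X), tableHom (c y).2 (of (e x : ℕ)) =
      of (e ((σ y).symm x) : ℕ) * (wt y ((σ y).symm x))⁻¹ :=
    fun y x => by simpa [B] using tableHom_ofFn (B y) (e x)
  have hFs : ∀ y g, tableHom (c y).1 (sh g) = sh g := fun y g => tableHom_map_add (hlen y).1 g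
  have hBs : ∀ y g, tableHom (c y).2 (sh g) = sh g := fun y g => tableHom_map_add (hlen y).2 g
  have hval : c.Valid := by
    intro y i hi
    have hi' : i < N := hi.trans_le (max_le (hlen y).1 (hlen y).2)
    obtain ⟨x, hx⟩ := e.surjective ⟨i, hi'⟩
    have hx' : (e x : ℕ) = i := by rw [hx]
    rw [← hx']
    constructor
    · rw [hB, _root_.map_mul, _root_.map_inv, hF, hFs, Equiv.apply_symm_apply, mul_inv_cancel_right]
    · rw [hF, _root_.map_mul, hB, hBs, Equiv.symm_apply_apply, inv_mul_cancel_right]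
  have hq₀X : q₀ ∈ Xs := Finset.mem_insert_self _ _
  refine ⟨c, hval, N, e ⟨q₀, hq₀X⟩, hlen, (e _).2, ?_⟩
  have key : ∀ w : GroupWord (Fin n), (∀ t, t <:+ w → (mk t : FreeGroup (Fin n)) • q₀ ∈ Xs) →
      ∀ hw : (mk w : FreeGroup (Fin n)) • q₀ ∈ Xs,
      ActionTable.action hval (mk w) (of (e ⟨q₀, hq₀X⟩ : ℕ)) =
        of (e ⟨(mk w : FreeGroup (Fin n)) • q₀, hw⟩ : ℕ) * sh (ρ (cocycle J (mk w) q₀)) := by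
    intro w
    induction w with
    | nil =>
      intro _ hw
      simp [← one_eq_mk, cocycle_one_left]
    | cons x w ih =>
      intro hsuf hw
      have hsuf' := hsuf w (List.suffix_cons _ _)
      rw [ActionTable.action_mk_cons, ih (fun t ht => hsuf t (ht.trans (List.suffix_cons _ _)))
        hsuf']
      obtain ⟨y, _ | _⟩ := x
      · have e1 : mk ((y, false) :: w) = (of y)⁻¹ * mk w := by
          rw [of, inv_mk, mul_mk]; rfl
        have e3 : of y • mk ((y, false) :: w) • q₀ = mk w • q₀ := by simp [e1, mul_smul]
        have hs : (σ y).symm ⟨mk w • q₀, hsuf'⟩ = ⟨mk ((y, false) :: w) • q₀, hw⟩ := by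
          rw [Equiv.symm_apply_eq, hσ y ⟨_, hw⟩ (e3 ▸ hsuf')]
          apply Subtype.ext
          simp [e1, mul_smul]
        have e2 : mk ((y, false) :: w) • q₀ = (of y)⁻¹ • mk w • q₀ := by rw [e1, mul_smul]
        simp only [ActionTable.letter, Bool.false_eq_true, if_false]
        rw [_root_.map_mul, hB, hBs, hs, mul_assoc]
        congr 1
        simp only [wt]
        rw [e2, ← _root_.map_inv, ← _root_.map_inv, ← _root_.map_mul, ← _root_.map_mul,
          ← cocycle_inv, ← cocycle_mul, e1]
      · have e1 : mk ((y, true) :: w) = of y * mk w := by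
          rw [of, mul_mk]; rfl
        have hs : σ y ⟨mk w • q₀, hsuf'⟩ = ⟨mk ((y, true) :: w) • q₀, hw⟩ := by
          rw [hσ y _ (by rw [e1] at hw; simpa [mul_smul] using hw)]
          apply Subtype.ext
          simp [e1, mul_smul]
        simp only [ActionTable.letter, if_true]
        rw [_root_.map_mul, hF, hFs, hs, mul_assoc]
        congr 1
        simp only [wt]
        rw [← _root_.map_mul, ← _root_.map_mul, ← cocycle_mul, e1]
  intro w hw
  refine ⟨_, (e ⟨_, hX w hw w List.suffix_rfl⟩).2, ?_, key w (hX w hw) _⟩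
  rw [Fin.val_inj, e.apply_eq_iff_eq, Subtype.mk_eq_mk, hq₀, MulAction.Quotient.smul_coe,
    QuotientGroup.eq, smul_eq_mul, mul_one, mul_one]
  exact J.inv_mem_iff

end Hall

end FreeGroup

/-! ### Semidecidable properties of lists of words in a free group -/

namespace FreeGroup

section

variable {α γ : Type} [Primcodable α] [Primcodable γ] [DecidableEq α]

theorem semidecidable_mk_eq {v w : γ → GroupWord α} (hv : Primrec v) (hw : Primrec w) :
    Semidecidable fun c => mk (v c) = mk (w c) :=
  .of_primrec (primrecRel_mk_eq.comp hv hw)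

theorem semidecidable_mk_ne {v w : γ → GroupWord α} (hv : Primrec v) (hw : Primrec w) :
    Semidecidable fun c => mk (v c) ≠ mk (w c) :=
  .of_primrec (primrecRel_mk_eq.comp hv hw).not

end

variable {n : ℕ}

theorem primrec_tableWord : Primrec₂ tableWord := by
  refine (Primrec.option_getD.comp (Primrec.list_getElem?.comp Primrec.fst Primrec.snd)
    (Primrec.list_cons.comp (Primrec.pair Primrec.snd (Primrec.const true))
      (Primrec.const ([] : GroupWord ℕ)))).of_eq fun x => ?_
  rw [tableWord, List.getD_eq_getElem?_getD]

namespace ActionTable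

theorem primrec_letter : Primrec₂ (letter : ActionTable n → _ → _) := by
  have h : Primrec fun z : ActionTable n × Fin n × Bool => z.1 z.2.1 :=
    Primrec.fin_app.comp Primrec.fst (Primrec.fst.comp Primrec.snd)
  exact Primrec.ite (Primrec.eq.comp (Primrec.snd.comp Primrec.snd) (Primrec.const true))
    (Primrec.fst.comp h) (Primrec.snd.comp h)

theorem primrec_actWord : Primrec fun z : (ActionTable n × ℕ) × GroupWord (Fin n) =>
    actWord z.1.1 z.1.2 z.2 := by
  refine Primrec.list_foldr (f := fun z : (ActionTable n × ℕ) × GroupWord (Fin n) => z.2)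
    (g := fun z => ([(z.1.2, true)] : GroupWord ℕ))
    (h := fun z p => subst (tableWord (letter z.1.1 p.1)) p.2) Primrec.snd
    (Primrec.list_cons.comp (Primrec.pair (Primrec.snd.comp Primrec.fst) (Primrec.const true))
      (Primrec.const ([] : GroupWord ℕ))) ?_
  refine primrec_subst (γ := ((ActionTable n × ℕ) × GroupWord (Fin n)) ×
    (Fin n × Bool) × GroupWord ℕ) (φ := fun y => tableWord (letter y.1.1.1 y.2.1)) ?_
    (Primrec.snd.comp Primrec.snd)
  exact primrec_tableWord.comp (primrec_letter.comp
    (Primrec.fst.comp (Primrec.fst.comp (Primrec.fst.comp Primrec.fst)))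
    (Primrec.fst.comp (Primrec.snd.comp Primrec.fst))) Primrec.snd

theorem semidecidable_valid : Semidecidable (Valid : ActionTable n → Prop) := by
  have happ : Primrec fun z : (ActionTable n × Fin n) × ℕ => z.1.1 z.1.2 :=
    Primrec.fin_app.comp (Primrec.fst.comp Primrec.fst) (Primrec.snd.comp Primrec.fst)
  have happ' : Primrec fun z : ActionTable n × Fin n => z.1 z.2 :=
    Primrec.fin_app.comp Primrec.fst Primrec.snd
  have hletter : Primrec fun z : (ActionTable n × Fin n) × ℕ => ([(z.2, true)] : GroupWord ℕ) :=
    Primrec.list_cons.comp (Primrec.pair Primrec.snd (Primrec.const true))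
      (Primrec.const ([] : GroupWord ℕ))
  have key : ∀ {l l' : (ActionTable n × Fin n) × ℕ → List (GroupWord ℕ)}, Primrec l → Primrec l' →
      Semidecidable fun z => tableHom (l z) (tableHom (l' z) (of z.2)) = of z.2 := by
    intro l l' hl hl'
    refine (semidecidable_mk_eq (primrec_subst (γ := (ActionTable n × Fin n) × ℕ)
      (φ := fun z => tableWord (l z)) (w := fun z => tableWord (l' z) z.2)
      (primrec_tableWord.comp (hl.comp Primrec.fst) Primrec.snd)
      (primrec_tableWord.comp hl' Primrec.snd)) hletter).of_iff fun z => ?_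
    rw [tableHom_of, mk_subst]
    rfl
  have h := (key (Primrec.fst.comp happ) (Primrec.snd.comp happ)).and
    (key (Primrec.snd.comp happ) (Primrec.fst.comp happ))
  have h2 := Semidecidable.forall_mem (p := fun (z : ActionTable n × Fin n) (i : ℕ) =>
    tableHom (z.1 z.2).1 (tableHom (z.1 z.2).2 (of i)) = of i ∧
      tableHom (z.1 z.2).2 (tableHom (z.1 z.2).1 (of i)) = of i) h
    (l := fun z => List.range (max (z.1 z.2).1.length (z.1 z.2).2.length))
    (Primrec.list_range.comp (Primrec.nat_max.comp
      (Primrec.list_length.comp (Primrec.fst.comp happ'))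
      (Primrec.list_length.comp (Primrec.snd.comp happ'))))
  refine (Semidecidable.forall_mem (p := fun (c : ActionTable n) (y : Fin n) =>
    ∀ i ∈ List.range (max (c y).1.length (c y).2.length),
      tableHom (c y).1 (tableHom (c y).2 (of i)) = of i ∧
        tableHom (c y).2 (tableHom (c y).1 (of i)) = of i) h2
    (l := fun _ => List.finRange n) (Primrec.const _)).of_iff fun c => ?_
  simp [Valid]

end ActionTable

/-- Nonmembership in a subgroup given by generators: the certificate is an action in which the
generators fix a letter that the word moves. -/
theorem semidecidable_mk_notMem_closure :
    Semidecidable fun x : GroupWord (Fin n) × List (GroupWord (Fin n)) =>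
      mk x.1 ∉ Subgroup.closure {g | ∃ v ∈ x.2, mk v = g} := by
  have hb : Primrec fun b : ℕ => ([(b, true)] : GroupWord ℕ) :=
    Primrec.list_cons.comp (Primrec.pair Primrec.id (Primrec.const true))
      (Primrec.const ([] : GroupWord ℕ))
  have h1 : Semidecidable fun z : (GroupWord (Fin n) × List (GroupWord (Fin n))) ×
      (ActionTable n × ℕ) => ∀ v ∈ z.1.2, mk (ActionTable.actWord z.2.1 z.2.2 v) =
        mk [(z.2.2, true)] :=
    Semidecidable.forall_mem (semidecidable_mk_eq
      (ActionTable.primrec_actWord.comp (Primrec.pair (Primrec.snd.comp Primrec.fst) Primrec.snd))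
      (hb.comp (Primrec.snd.comp (Primrec.snd.comp Primrec.fst))))
      (Primrec.snd.comp Primrec.fst)
  have h2 : Semidecidable fun z : (GroupWord (Fin n) × List (GroupWord (Fin n))) ×
      (ActionTable n × ℕ) => mk (ActionTable.actWord z.2.1 z.2.2 z.1.1) ≠ mk [(z.2.2, true)] :=
    semidecidable_mk_ne (ActionTable.primrec_actWord.comp (Primrec.pair Primrec.snd
      (Primrec.fst.comp Primrec.fst))) (hb.comp (Primrec.snd.comp Primrec.snd))
  refine (Semidecidable.exists_snd (p := fun (x : GroupWord (Fin n) × List (GroupWord (Fin n)))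
    (z : ActionTable n × ℕ) => z.1.Valid ∧ (∀ v ∈ x.2, mk (ActionTable.actWord z.1 z.2 v) =
      mk [(z.2, true)]) ∧ mk (ActionTable.actWord z.1 z.2 x.1) ≠ mk [(z.2, true)])
    ((ActionTable.semidecidable_valid.comp (Primrec.fst.comp Primrec.snd)).and
      (h1.and h2))).of_iff ?_
  rintro ⟨w, S⟩
  constructor
  · intro hw
    obtain ⟨c, hc, N, b, hN, hbN, H⟩ := exists_actionTable
      (J := Subgroup.closure {g | ∃ v ∈ S, mk v = g}) 1 (w :: S)
    simp only [MonoidHom.one_apply, _root_.map_one, mul_one] at H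
    refine ⟨(c, b), hc, fun v hv => ?_, ?_⟩
    · obtain ⟨i, -, hi, hact⟩ := H v (List.mem_cons_of_mem _ hv)
      rw [ActionTable.mk_actWord hc, hact, hi.2 (Subgroup.subset_closure ⟨v, hv, rfl⟩)]
      rfl
    · obtain ⟨i, -, hi, hact⟩ := H w List.mem_cons_self
      rw [ActionTable.mk_actWord hc, hact]
      exact fun e => hw (hi.1 (of_injective e))
  · rintro ⟨⟨c, b⟩, hc, hS, hw⟩ hmem
    refine hw ?_
    rw [ActionTable.mk_actWord hc]
    let P : Subgroup (FreeGroup (Fin n)) :=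
      (MulAction.stabilizer (MulAut (FreeGroup ℕ)) (of b)).comap (ActionTable.action hc)
    have hP : Subgroup.closure {g | ∃ v ∈ S, mk v = g} ≤ P := by
      rw [Subgroup.closure_le]
      rintro _ ⟨v, hv, rfl⟩
      have := hS v hv
      rw [ActionTable.mk_actWord hc] at this
      exact this
    exact hP hmem

/-- The words of `U` represent a free basis of the subgroup that they generate. -/
def FreelyIndependent {α : Type} (U : List (GroupWord α)) : Prop :=
  Function.Injective (lift fun i : Fin U.length => (mk (U.get i) : FreeGroup α))

/-- Free independence: the certificate is an action in which the words multiply a letter by distinct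
letters that are fixed under the action. -/
theorem semidecidable_freelyIndependent :
    Semidecidable (FreelyIndependent : List (GroupWord (Fin n)) → Prop) := by
  let Γ := List (GroupWord (Fin n)) × (ActionTable n × ℕ × ℕ)
  have happ : Primrec fun z : Γ × Fin n => z.1.2.1 z.2 :=
    Primrec.fin_app.comp (Primrec.fst.comp (Primrec.snd.comp Primrec.fst)) Primrec.snd
  have hNN : Primrec fun z : Γ × Fin n => z.1.2.2.1 :=
    Primrec.fst.comp (Primrec.snd.comp (Primrec.snd.comp Primrec.fst))
  have h1 : Semidecidable fun z : Γ => ∀ y ∈ List.finRange n,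
      (z.2.1 y).1.length ≤ z.2.2.1 ∧ (z.2.1 y).2.length ≤ z.2.2.1 :=
    Semidecidable.forall_mem (p := fun (z : Γ) (y : Fin n) =>
      (z.2.1 y).1.length ≤ z.2.2.1 ∧ (z.2.1 y).2.length ≤ z.2.2.1)
      (.and (.of_primrec (Primrec.nat_le.comp
          (Primrec.list_length.comp (Primrec.fst.comp happ)) hNN))
        (.of_primrec (Primrec.nat_le.comp
          (Primrec.list_length.comp (Primrec.snd.comp happ)) hNN))) (Primrec.const _)
  have hN : Primrec fun z : Γ × ℕ => z.1.2.2.1 :=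
    Primrec.fst.comp (Primrec.snd.comp (Primrec.snd.comp Primrec.fst))
  have hb : Primrec fun z : Γ × ℕ => z.1.2.2.2 :=
    Primrec.snd.comp (Primrec.snd.comp (Primrec.snd.comp Primrec.fst))
  have h2 : Semidecidable fun z : Γ => ∀ i ∈ List.range z.1.length,
      mk (ActionTable.actWord z.2.1 z.2.2.2 (z.1.getD i [])) =
        mk [(z.2.2.2, true), (z.2.2.1 + i, true)] :=
    Semidecidable.forall_mem (p := fun (z : Γ) (i : ℕ) =>
      mk (ActionTable.actWord z.2.1 z.2.2.2 (z.1.getD i [])) =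
        mk [(z.2.2.2, true), (z.2.2.1 + i, true)])
      (semidecidable_mk_eq
        (ActionTable.primrec_actWord.comp (Primrec.pair (Primrec.pair
          (Primrec.fst.comp (Primrec.snd.comp Primrec.fst)) hb)
          ((Primrec.list_getD []).comp (Primrec.fst.comp Primrec.fst) Primrec.snd)))
        (Primrec.list_cons.comp (Primrec.pair hb (Primrec.const true))
          (Primrec.list_cons.comp (Primrec.pair (Primrec.nat_add.comp hN Primrec.snd)
            (Primrec.const true)) (Primrec.const ([] : GroupWord ℕ)))))
      (Primrec.list_range.comp (Primrec.list_length.comp Primrec.fst))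
  refine (Semidecidable.exists_snd (p := fun (U : List (GroupWord (Fin n)))
    (z : ActionTable n × ℕ × ℕ) => z.1.Valid ∧ (∀ y ∈ List.finRange n,
      (z.1 y).1.length ≤ z.2.1 ∧ (z.1 y).2.length ≤ z.2.1) ∧ ∀ i ∈ List.range U.length,
      mk (ActionTable.actWord z.1 z.2.2 (U.getD i [])) =
        mk [(z.2.2, true), (z.2.1 + i, true)])
    ((ActionTable.semidecidable_valid.comp (Primrec.fst.comp Primrec.snd)).and
      (h1.and h2))).of_iff fun U => ?_
  have hletters : ∀ b i : ℕ, mk [(b, true), (i, true)] = of b * of i := fun b i => by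
    rw [of, of, mul_mk]; rfl
  constructor
  · intro hU
    let f := lift fun i : Fin U.length => (mk (U.get i) : FreeGroup (Fin n))
    let e : FreeGroup (Fin U.length) ≃* f.range := MonoidHom.ofInjective hU
    let ρ : f.range →* FreeGroup ℕ := (map fun i : Fin U.length => (i : ℕ)).comp e.symm.toMonoidHom
    obtain ⟨c, hc, N, b, hN, hbN, H⟩ := exists_actionTable ρ U
    refine ⟨(c, N, b), hc, fun y _ => hN y, fun i hi => ?_⟩
    rw [List.mem_range] at hi
    simp only [List.getD_eq_getElem _ _ hi]
    obtain ⟨j, -, hj, hact⟩ := H U[i] (List.getElem_mem hi)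
    have hfi : f (of ⟨i, hi⟩) = mk U[i] := by simp [f]
    have hmem : mk U[i] ∈ f.range := ⟨of ⟨i, hi⟩, hfi⟩
    have hρ : ρ ⟨mk U[i], hmem⟩ = of i := by
      have : e (of ⟨i, hi⟩) = ⟨mk U[i], hmem⟩ := Subtype.ext hfi
      simp [ρ, ← this]
    rw [ActionTable.mk_actWord hc, hact, hj.2 hmem, cocycle_base hmem, hρ, hletters, map.of]
  · rintro ⟨⟨c, N, b⟩, hc, hN, hU⟩
    have := ActionTable.action_lift hc (b := b) (fun y => hN y (List.mem_finRange y))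
      (fun i : Fin U.length => mk (U.get i)) (fun i => by
        have := hU i (List.mem_range.2 i.2)
        rw [ActionTable.mk_actWord hc, List.getD_eq_getElem _ _ i.2, hletters] at this
        exact this)
    refine (injective_iff_map_eq_one _).2 fun w hw => ?_
    have hw' := this w
    rw [hw, _root_.map_one, MulAut.one_apply, left_eq_mul] at hw'
    refine map_injective (f := fun i : Fin U.length => N + (i : ℕ)) (fun i j h => ?_)
      (hw'.trans (_root_.map_one _).symm)
    exact Fin.ext (Nat.add_left_cancel h)

end FreeGroup

/-! ### Words in a group with semidecidable word problem -/

section Words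

variable {α β G : Type} [Group G] {gen : α → G}

open FreeGroup

theorem wordEval_nil : wordEval gen [] = 1 := rfl

theorem wordEval_append (v w : GroupWord α) :
    wordEval gen (v ++ w) = wordEval gen v * wordEval gen w := by
  rw [wordEval, ← mul_mk, _root_.map_mul]; rfl

theorem wordEval_invRev (w : GroupWord α) : wordEval gen (invRev w) = (wordEval gen w)⁻¹ := by
  rw [wordEval, ← inv_mk, _root_.map_inv]; rfl

theorem wordEval_subst (φ : β → GroupWord α) (w : GroupWord β) :
    wordEval gen (subst φ w) = wordEval (fun b => wordEval gen (φ b)) w := by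
  rw [wordEval, mk_subst, wordEval, ← MonoidHom.comp_apply]
  congr 1
  ext b
  simp [wordEval]

theorem map_wordEval {G' : Type} [Group G'] (f : G →* G') (w : GroupWord α) :
    f (wordEval gen w) = wordEval (fun a => f (gen a)) w := by
  rw [wordEval, wordEval, ← MonoidHom.comp_apply]
  congr 1
  ext a
  simp

theorem wordEval_of (w : GroupWord α) : wordEval (FreeGroup.of : α → FreeGroup α) w = mk w := by
  rw [wordEval, lift_of_eq_id]; rfl

theorem wordEval_mem {P : Subgroup G} (h : ∀ a, gen a ∈ P) (w : GroupWord α) :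
    wordEval gen w ∈ P := by
  have : (lift gen).range ≤ P := by
    refine range_lift_le ?_
    rintro _ ⟨a, rfl⟩
    exact h a
  exact this ⟨_, rfl⟩

theorem wordEval_mem_wordSubgroup {S : List (GroupWord α)} {w : GroupWord α} (hw : w ∈ S) :
    wordEval gen w ∈ wordSubgroup gen S :=
  Subgroup.subset_closure ⟨w, hw, rfl⟩

theorem wordSubgroup_le {S : List (GroupWord α)} {P : Subgroup G} :
    wordSubgroup gen S ≤ P ↔ ∀ w ∈ S, wordEval gen w ∈ P := by
  rw [wordSubgroup, Subgroup.closure_le]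
  exact ⟨fun h w hw => h ⟨w, hw, rfl⟩, by rintro h _ ⟨w, hw, rfl⟩; exact h w hw⟩

theorem wordSubgroup_append (S S' : List (GroupWord α)) :
    wordSubgroup gen (S ++ S') = wordSubgroup gen S ⊔ wordSubgroup gen S' := by
  refine le_antisymm (wordSubgroup_le.2 fun w hw => ?_) (sup_le ?_ ?_)
  · rcases List.mem_append.1 hw with h | h
    · exact Subgroup.mem_sup_left (wordEval_mem_wordSubgroup h)
    · exact Subgroup.mem_sup_right (wordEval_mem_wordSubgroup h)
  · exact wordSubgroup_le.2 fun w hw => wordEval_mem_wordSubgroup (List.mem_append_left _ hw)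
  · exact wordSubgroup_le.2 fun w hw => wordEval_mem_wordSubgroup (List.mem_append_right _ hw)

theorem map_wordSubgroup {G' : Type} [Group G'] (f : G →* G') (S : List (GroupWord α)) :
    (wordSubgroup gen S).map f = wordSubgroup (fun a => f (gen a)) S := by
  rw [wordSubgroup, wordSubgroup, MonoidHom.map_closure]
  congr 1
  ext g
  constructor
  · rintro ⟨_, ⟨w, hw, rfl⟩, rfl⟩
    exact ⟨w, hw, (map_wordEval f w).symm⟩
  · rintro ⟨w, hw, rfl⟩
    exact ⟨_, ⟨w, hw, rfl⟩, map_wordEval f w⟩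

theorem wordSubgroup_fg (S : List (GroupWord α)) : (wordSubgroup gen S).FG :=
  (Subgroup.fg_iff _).2 ⟨_, rfl, by
    refine ((List.finite_toSet S).image (wordEval gen)).subset ?_
    rintro _ ⟨w, hw, rfl⟩
    exact ⟨w, hw, rfl⟩⟩

/-- The elements of a finitely generated subgroup are the words in its generators, the letter `i`
standing for the generator number `i`. -/
theorem mem_wordSubgroup_iff {S : List (GroupWord α)} {g : G} :
    g ∈ wordSubgroup gen S ↔
      ∃ z : GroupWord ℕ, g = wordEval gen (subst (fun i => S.getD i []) z) := by
  constructor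
  · intro hg
    have : wordSubgroup gen S ≤ (lift fun i => wordEval gen (S.getD i [])).range := by
      rw [wordSubgroup_le]
      intro w hw
      obtain ⟨i, hi, rfl⟩ := List.getElem_of_mem hw
      exact ⟨of i, by rw [lift_apply_of, List.getD_eq_getElem _ _ hi]⟩
    obtain ⟨x, rfl⟩ := this hg
    refine ⟨x.toWord, ?_⟩
    rw [wordEval_subst, wordEval, mk_toWord]
  · rintro ⟨z, rfl⟩
    rw [wordEval_subst]
    refine wordEval_mem (fun i => ?_) z
    rcases lt_or_ge i S.length with hi | hi
    · rw [List.getD_eq_getElem _ _ hi]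
      exact wordEval_mem_wordSubgroup (List.getElem_mem hi)
    · rw [List.getD_eq_default _ _ hi]
      exact one_mem _

/-- Every element is represented by a word. -/
theorem exists_wordEval (hgen : Subgroup.closure (Set.range gen) = ⊤) (g : G) :
    ∃ w, wordEval gen w = g := by
  obtain ⟨x, rfl⟩ := (lift_surjective_iff_closure_range_eq_top).2 hgen g
  classical exact ⟨x.toWord, by rw [wordEval, mk_toWord]⟩

/-- Every finite family of elements is represented by a list of words. -/
theorem exists_map_wordEval (hgen : Subgroup.closure (Set.range gen) = ⊤) (l : List G) :
    ∃ L : List (GroupWord α), L.map (wordEval gen) = l := by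
  choose f hf using exists_wordEval hgen
  exact ⟨l.map f, by simp [Function.comp_def, hf]⟩

theorem wordSubgroup_eq_closure (S : List (GroupWord α)) :
    wordSubgroup gen S = Subgroup.closure {g | g ∈ S.map (wordEval gen)} := by
  rw [wordSubgroup]
  congr 1
  ext g
  simp

theorem exists_wordSubgroup_eq (hgen : Subgroup.closure (Set.range gen) = ⊤) {P : Subgroup G}
    (hP : P.FG) : ∃ S, wordSubgroup gen S = P := by
  obtain ⟨T, rfl⟩ := hP
  obtain ⟨L, hL⟩ := exists_map_wordEval hgen T.toList
  refine ⟨L, ?_⟩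
  rw [wordSubgroup_eq_closure, hL]
  congr 1
  ext g
  simp

/-- Equality of the elements that two words represent is semidecidable. -/
def SemidecidableWordProblem [Primcodable α] (gen : α → G) : Prop :=
  Semidecidable fun x : GroupWord α × GroupWord α => wordEval gen x.1 = wordEval gen x.2

namespace SemidecidableWordProblem

variable [Primcodable α] [Primcodable β] {γ : Type} [Primcodable γ]
  (hG : SemidecidableWordProblem gen)

include hG

theorem eq {v w : γ → GroupWord α} (hv : Primrec v) (hw : Primrec w) :
    Semidecidable fun c => wordEval gen (v c) = wordEval gen (w c) :=
  Semidecidable.comp hG (Primrec.pair hv hw)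

theorem mem {w : γ → GroupWord α} {S : γ → List (GroupWord α)} (hw : Primrec w) (hS : Primrec S) :
    Semidecidable fun c => wordEval gen (w c) ∈ wordSubgroup gen (S c) := by
  refine (Semidecidable.exists_snd (p := fun c z =>
    wordEval gen (w c) = wordEval gen (subst (fun i => (S c).getD i []) z))
    (hG.eq (hw.comp Primrec.fst) (primrec_subst (γ := γ × GroupWord ℕ)
      (φ := fun x i => (S x.1).getD i []) ?_ Primrec.snd))).of_iff fun c => mem_wordSubgroup_iff
  exact (Primrec.list_getD []).comp (hS.comp (Primrec.fst.comp Primrec.fst)) Primrec.snd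

theorem le {S S' : γ → List (GroupWord α)} (hS : Primrec S) (hS' : Primrec S') :
    Semidecidable fun c => wordSubgroup gen (S c) ≤ wordSubgroup gen (S' c) :=
  (Semidecidable.forall_mem (p := fun c w => wordEval gen w ∈ wordSubgroup gen (S' c))
    (hG.mem Primrec.snd (hS'.comp Primrec.fst)) hS).of_iff fun _ => wordSubgroup_le

theorem wordSubgroup_eq {S S' : γ → List (GroupWord α)} (hS : Primrec S) (hS' : Primrec S') :
    Semidecidable fun c => wordSubgroup gen (S c) = wordSubgroup gen (S' c) :=
  ((hG.le hS hS').and (hG.le hS' hS)).of_iff fun _ => le_antisymm_iff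

end SemidecidableWordProblem

end Words

/-! ### Intersections in free groups -/

namespace FreeGroup

variable {n : ℕ} {γ : Type} [Primcodable γ]

theorem semidecidableWordProblem :
    SemidecidableWordProblem (of : Fin n → FreeGroup (Fin n)) :=
  (semidecidable_mk_eq Primrec.fst Primrec.snd).of_iff fun x => by simp [wordEval_of]

theorem semidecidable_notMem {w : γ → GroupWord (Fin n)} {S : γ → List (GroupWord (Fin n))}
    (hw : Primrec w) (hS : Primrec S) :
    Semidecidable fun c => mk (w c) ∉ wordSubgroup of (S c) :=
  (semidecidable_mk_notMem_closure.comp (Primrec.pair hw hS)).of_iff fun c => by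
    simp [wordSubgroup, wordEval_of]

theorem semidecidable_mem {w : γ → GroupWord (Fin n)} {S : γ → List (GroupWord (Fin n))}
    (hw : Primrec w) (hS : Primrec S) :
    Semidecidable fun c => mk (w c) ∈ wordSubgroup of (S c) :=
  (semidecidableWordProblem.mem hw hS).of_iff fun c => by rw [wordEval_of]

/-- The list of the prefixes of a word. -/
def prefixes (w : GroupWord (Fin n)) : List (GroupWord (Fin n)) :=
  (List.range (w.length + 1)).map fun i => w.take i

theorem mem_prefixes {w p : GroupWord (Fin n)} : p ∈ prefixes w ↔ p <+: w := by
  simp only [prefixes, List.mem_map, List.mem_range]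
  constructor
  · rintro ⟨i, -, rfl⟩
    exact List.take_prefix _ _
  · intro h
    exact ⟨p.length, Nat.lt_succ_of_le h.length_le, (List.prefix_iff_eq_take.1 h).symm⟩

theorem primrec_prefixes : Primrec (prefixes : GroupWord (Fin n) → _) :=
  Primrec.list_map (Primrec.list_range.comp (Primrec.succ.comp Primrec.list_length))
    (Primrec.list_take.comp Primrec.snd Primrec.fst)

/-- The set `prefixWords S`, as a list. -/
def prefixList (S : List (GroupWord (Fin n))) : List (GroupWord (Fin n)) :=
  [] :: S.flatMap fun s => prefixes s ++ prefixes (invRev s)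

theorem mem_prefixList {S : List (GroupWord (Fin n))} {t : GroupWord (Fin n)} :
    t ∈ prefixList S ↔ t ∈ prefixWords {s | s ∈ S} := by
  simp [prefixList, prefixWords, mem_prefixes]

theorem primrec_prefixList : Primrec (prefixList : List (GroupWord (Fin n)) → _) :=
  Primrec.list_cons.comp (Primrec.const []) (Primrec.list_flatMap Primrec.id
    (Primrec.list_append.comp (primrec_prefixes.comp Primrec.snd)
      (primrec_prefixes.comp (primrec_invRev.comp Primrec.snd))))

theorem exists_prefixList_mul_inv_mem {S : List (GroupWord (Fin n))} {k : FreeGroup (Fin n)}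
    (hk : k ∈ wordSubgroup of S) {p : GroupWord (Fin n)} (hp : p <+: k.toWord) :
    ∃ t ∈ prefixList S, mk p * (mk t)⁻¹ ∈ wordSubgroup of S := by
  have hS : wordSubgroup of S = Subgroup.closure (mk '' {s | s ∈ S}) := by
    rw [wordSubgroup]
    congr 1
    ext g
    simp [wordEval_of]
  rw [hS] at hk ⊢
  obtain ⟨t, ht, h⟩ := exists_prefixWords_mul_inv_mem hk hp
  exact ⟨t, mem_prefixList.2 ht, h⟩

theorem mk_append_invRev (v w : GroupWord (Fin n)) : mk (v ++ invRev w) = mk v * (mk w)⁻¹ := by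
  rw [inv_mk, mul_mk]

/-- The words of `V` generate the intersection of the subgroups generated by `S` and by `S'`. The
certificate is a list `Z` of words that represents all cosets of the intersection that contain
prefixes of its elements: it is closed under appending letters, as long as this does not leave the
cosets of prefixes for `S` and for `S'`. -/
theorem semidecidable_generates_inf {V S S' : γ → List (GroupWord (Fin n))} (hV : Primrec V)
    (hS : Primrec S) (hS' : Primrec S') : Semidecidable fun c =>
      wordSubgroup of (V c) = wordSubgroup of (S c) ⊓ wordSubgroup of (S' c) := by
  let W := GroupWord (Fin n)
  let letters : List (Fin n × Bool) := List.finRange n ×ˢ [true, false]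
  have hletters : ∀ x, x ∈ letters := by
    rintro ⟨y, b⟩
    rw [List.mem_product]
    exact ⟨List.mem_finRange _, by cases b <;> simp⟩
  -- the coset of `z x` contains no prefix of an element of the subgroup generated by `S`
  let leaves : List W → W → Fin n × Bool → Prop := fun S z x =>
    ∀ t ∈ prefixList S, mk ((z ++ [x]) ++ invRev t) ∉ wordSubgroup of S
  let closed : List W → List W → W → Fin n × Bool → Prop := fun V Z z x =>
    ∃ z' ∈ [] :: Z, mk ((z ++ [x]) ++ invRev z') ∈ wordSubgroup of V
  have happ : Primrec fun q : W × (Fin n × Bool) => q.1 ++ [q.2] :=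
    Primrec.list_concat.comp Primrec.fst Primrec.snd
  have happ2 : Primrec fun q : (W × (Fin n × Bool)) × W => (q.1.1 ++ [q.1.2]) ++ invRev q.2 :=
    Primrec.list_append.comp (happ.comp Primrec.fst) (primrec_invRev.comp Primrec.snd)
  have hleaves : ∀ {δ : Type} [Primcodable δ] {S : δ → List W} {z : δ → W} {x : δ → Fin n × Bool},
      Primrec S → Primrec z → Primrec x → Semidecidable fun d => leaves (S d) (z d) (x d) := by
    intro δ _ S z x hS hz hx
    exact Semidecidable.forall_mem (p := fun d t =>
      mk ((z d ++ [x d]) ++ invRev t) ∉ wordSubgroup of (S d))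
      (semidecidable_notMem (happ2.comp (Primrec.pair (Primrec.pair (hz.comp Primrec.fst)
        (hx.comp Primrec.fst)) Primrec.snd)) (hS.comp Primrec.fst)) (primrec_prefixList.comp hS)
  have hclosed : ∀ {δ : Type} [Primcodable δ] {V Z : δ → List W} {z : δ → W}
      {x : δ → Fin n × Bool}, Primrec V → Primrec Z → Primrec z → Primrec x →
      Semidecidable fun d => closed (V d) (Z d) (z d) (x d) := by
    intro δ _ V Z z x hV hZ hz hx
    exact Semidecidable.exists_mem (p := fun d t =>
      mk ((z d ++ [x d]) ++ invRev t) ∈ wordSubgroup of (V d))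
      (semidecidable_mem (happ2.comp (Primrec.pair (Primrec.pair (hz.comp Primrec.fst)
        (hx.comp Primrec.fst)) Primrec.snd)) (hV.comp Primrec.fst))
      (Primrec.list_cons.comp (Primrec.const []) hZ)
  have h1 : Semidecidable fun d : (γ × List W) × W => ∀ x ∈ letters,
      closed (V d.1.1) d.1.2 d.2 x ∨ leaves (S d.1.1) d.2 x ∨ leaves (S' d.1.1) d.2 x := by
    have e1 : Primrec fun e : ((γ × List W) × W) × (Fin n × Bool) => e.1.1.1 :=
      Primrec.fst.comp (Primrec.fst.comp Primrec.fst)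
    refine Semidecidable.forall_mem (p := fun (d : (γ × List W) × W) (x : Fin n × Bool) =>
      closed (V d.1.1) d.1.2 d.2 x ∨ leaves (S d.1.1) d.2 x ∨ leaves (S' d.1.1) d.2 x)
      (.or (hclosed (hV.comp e1) (Primrec.snd.comp (Primrec.fst.comp Primrec.fst))
        (Primrec.snd.comp Primrec.fst) Primrec.snd)
      (.or (hleaves (hS.comp e1) (Primrec.snd.comp Primrec.fst) Primrec.snd)
        (hleaves (hS'.comp e1) (Primrec.snd.comp Primrec.fst) Primrec.snd))) (Primrec.const _)
  have e1 : Primrec fun d : (γ × List W) × W => d.1.1 := Primrec.fst.comp Primrec.fst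
  have h2 : Semidecidable fun d : (γ × List W) × W => mk d.2 ∈ wordSubgroup of (V d.1.1) ∨
      mk d.2 ∉ wordSubgroup of (S d.1.1) ∨ mk d.2 ∉ wordSubgroup of (S' d.1.1) :=
    (semidecidable_mem Primrec.snd (hV.comp e1)).or
      ((semidecidable_notMem Primrec.snd (hS.comp e1)).or
        (semidecidable_notMem Primrec.snd (hS'.comp e1)))
  have h3 := Semidecidable.exists_snd (p := fun c Z => ∀ z ∈ [] :: Z,
    (∀ x ∈ letters, closed (V c) Z z x ∨ leaves (S c) z x ∨ leaves (S' c) z x) ∧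
    (mk z ∈ wordSubgroup of (V c) ∨ mk z ∉ wordSubgroup of (S c) ∨
      mk z ∉ wordSubgroup of (S' c)))
    (Semidecidable.forall_mem (p := fun (d : γ × List W) z =>
      (∀ x ∈ letters, closed (V d.1) d.2 z x ∨ leaves (S d.1) z x ∨ leaves (S' d.1) z x) ∧
      (mk z ∈ wordSubgroup of (V d.1) ∨ mk z ∉ wordSubgroup of (S d.1) ∨
        mk z ∉ wordSubgroup of (S' d.1))) (h1.and h2)
      (Primrec.list_cons.comp (Primrec.const []) Primrec.snd))
  refine (((semidecidableWordProblem.le hV hS).and (semidecidableWordProblem.le hV hS')).and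
    h3).of_iff fun c => ?_
  generalize V c = V, S c = S, S' c = S'
  have step_iff : ∀ (z : W) (x : Fin n × Bool) (t : W),
      mk ((z ++ [x]) ++ invRev t) = mk z * mk [x] * (mk t)⁻¹ := fun z x t => by
    rw [mk_append_invRev, ← mul_mk]
  constructor
  · classical
    intro h
    have hVS : wordSubgroup of V ≤ wordSubgroup of S := h ▸ inf_le_left
    have hVS' : wordSubgroup of V ≤ wordSubgroup of S' := h ▸ inf_le_right
    let r : W × W → W := fun q =>
      if h : ∃ g, mk (g ++ invRev q.1) ∈ wordSubgroup of S ∧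
        mk (g ++ invRev q.2) ∈ wordSubgroup of S' then h.choose else []
    refine ⟨⟨hVS, hVS'⟩, (prefixList S ×ˢ prefixList S').map r, fun z _ => ⟨fun x _ => ?_, ?_⟩⟩
    · by_cases hz : leaves S z x
      · exact Or.inr (Or.inl hz)
      by_cases hz' : leaves S' z x
      · exact Or.inr (Or.inr hz')
      left
      simp only [leaves, not_forall, not_not] at hz hz'
      obtain ⟨t, ht, hzt⟩ := hz
      obtain ⟨t', ht', hzt'⟩ := hz'
      have H : ∃ g, mk (g ++ invRev t) ∈ wordSubgroup of S ∧
          mk (g ++ invRev t') ∈ wordSubgroup of S' := ⟨_, hzt, hzt'⟩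
      refine ⟨r (t, t'), List.mem_cons_of_mem _ (List.mem_map.2 ⟨(t, t'),
        List.mem_product.2 ⟨ht, ht'⟩, rfl⟩), ?_⟩
      rw [show r (t, t') = H.choose from dif_pos H]
      have h1 := mul_mem hzt (inv_mem H.choose_spec.1)
      have h2 := mul_mem hzt' (inv_mem H.choose_spec.2)
      rw [mk_append_invRev, mk_append_invRev, mul_inv_rev, inv_inv, mul_assoc,
        inv_mul_cancel_left] at h1 h2
      rw [h, mk_append_invRev]
      exact ⟨h1, h2⟩
    · rw [h, Subgroup.mem_inf]
      tauto
  · rintro ⟨⟨hVS, hVS'⟩, Z, hZ⟩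
    refine le_antisymm (le_inf hVS hVS') fun k hk => ?_
    obtain ⟨_, ⟨z, hz, rfl⟩, hkz⟩ := exists_mul_inv_mem_of_step (D := wordSubgroup of V)
      (Z := mk '' {z | z ∈ [] :: Z}) (k := k) ⟨[], List.mem_cons_self, rfl⟩ (by
        rintro p x hp _ ⟨z, hz, rfl⟩ hpz
        have leave : ∀ S, wordSubgroup of V ≤ wordSubgroup of S → k ∈ wordSubgroup of S →
            ¬ leaves S z x := by
          intro S hVS hk hl
          obtain ⟨t, ht, hpt⟩ := exists_prefixList_mul_inv_mem hk hp
          refine hl t ht ?_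
          rw [step_iff]
          rw [← mul_mk] at hpt
          have := mul_mem (inv_mem (hVS hpz)) hpt
          simpa only [mul_inv_rev, inv_inv, mul_assoc, inv_mul_cancel_left] using this
        rcases (hZ z hz).1 x (hletters x) with ⟨z', hz', h⟩ | h | h
        · refine ⟨_, ⟨z', hz', rfl⟩, ?_⟩
          rw [step_iff] at h
          rw [← mul_mk]
          simpa only [mul_assoc, inv_mul_cancel_left] using mul_mem hpz h
        · exact absurd h (leave S hVS hk.1)
        · exact absurd h (leave S' hVS' hk.2))
    have hzk : mk z = (k * (mk z)⁻¹)⁻¹ * k := by simp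
    rcases (hZ z hz).2 with h | h | h
    · rw [← inv_mul_cancel_right k (mk z)]
      exact mul_mem hkz h
    · exact absurd (hzk ▸ mul_mem (inv_mem (hVS hkz)) hk.1) h
    · exact absurd (hzk ▸ mul_mem (inv_mem (hVS' hkz)) hk.2) h

end FreeGroup

/-! ### Words in a free-abelian times free group -/

namespace ZF

open FreeGroup

variable {m n : ℕ} {γ : Type} [Primcodable γ]

theorem closure_range_gen (m n : ℕ) : Subgroup.closure (Set.range (gen m n)) = ⊤ := by
  rw [eq_top_iff]
  rintro ⟨a, w⟩ -
  set C := Subgroup.closure (Set.range (gen m n)) with hC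
  have ha : ((a, 1) : ZF m n) ∈ C := by
    have h : (⊤ : Subgroup (Multiplicative (Fin m → ℤ))) ≤ C.comap (MonoidHom.inl _ _) := by
      intro c _
      have hc : c = ∏ i, (Multiplicative.ofAdd (Pi.single i 1 : Fin m → ℤ)) ^ (c.toAdd i) := by
        apply Multiplicative.toAdd.injective
        rw [toAdd_prod]
        ext j
        simp [Finset.sum_apply, Pi.single_apply]
      rw [hc]
      refine Subgroup.prod_mem _ fun i _ => Subgroup.zpow_mem _ ?_ _
      have : gen m n (Sum.inl i) ∈ C := Subgroup.subset_closure ⟨Sum.inl i, rfl⟩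
      exact this
    exact h (Subgroup.mem_top a)
  have hw : ((1, w) : ZF m n) ∈ C := by
    have h : (⊤ : Subgroup (FreeGroup (Fin n))) ≤ C.comap (MonoidHom.inr _ _) := by
      rw [← FreeGroup.closure_range_of, Subgroup.closure_le]
      rintro _ ⟨j, rfl⟩
      have : gen m n (Sum.inr j) ∈ C := Subgroup.subset_closure ⟨Sum.inr j, rfl⟩
      exact this
    exact h (Subgroup.mem_top w)
  simpa using mul_mem ha hw

/-- The word in the free part that is obtained by deleting the letters `t_i`. -/
def freeWord (w : GroupWord (Fin m ⊕ Fin n)) : GroupWord (Fin n) :=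
  subst (Sum.elim (fun _ => []) fun j => [(j, true)]) w

theorem mk_freeWord (w : GroupWord (Fin m ⊕ Fin n)) :
    mk (freeWord w) = (wordEval (gen m n) w).2 := by
  rw [freeWord, mk_subst]
  have := map_wordEval (gen := gen m n) (MonoidHom.snd _ _) w
  rw [MonoidHom.coe_snd] at this
  rw [this, wordEval]
  congr 2
  ext a
  rcases a with i | j <;> rfl

theorem primrec_freeWord : Primrec (freeWord : GroupWord (Fin m ⊕ Fin n) → _) := by
  refine primrec_subst (φ := fun _ => Sum.elim (fun _ => []) fun j => [(j, true)]) ?_ Primrec.id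
  refine (Primrec.sumCasesOn (f := fun z : GroupWord (Fin m ⊕ Fin n) × (Fin m ⊕ Fin n) => z.2)
    (g := fun _ _ => ([] : GroupWord (Fin n))) (h := fun _ j => [(j, true)]) Primrec.snd
    (Primrec.const _) (Primrec.list_cons.comp (Primrec.pair Primrec.snd (Primrec.const true))
      (Primrec.const []))).of_eq fun z => ?_
  rcases z with ⟨_, _ | _⟩ <;> rfl

theorem freeProj_wordSubgroup (S : List (GroupWord (Fin m ⊕ Fin n))) :
    freeProj (wordSubgroup (gen m n) S) = wordSubgroup of (S.map freeWord) := by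
  rw [freeProj, wordSubgroup, MonoidHom.map_closure, wordSubgroup]
  congr 1
  ext g
  simp [wordEval_of, mk_freeWord]

/-- The vector in `ℤ^m` that is the abelian part of the element that a word represents. -/
def vec (w : GroupWord (Fin m ⊕ Fin n)) : Fin m → ℤ := (wordEval (gen m n) w).1.toAdd

/-- The homomorphism to the infinite cyclic group that is given by a linear functional on `ℤ^m`. -/
def functional (f : (Fin m → ℤ) →ₗ[ℤ] ℤ) : ZF m n →* FreeGroup (Fin 1) :=
  ((zpowersHom _ (of 0)).comp (AddMonoidHom.toMultiplicative f.toAddMonoidHom)).comp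
    (MonoidHom.fst _ _)

theorem functional_apply (f : (Fin m → ℤ) →ₗ[ℤ] ℤ) (x : ZF m n) :
    functional f x = of 0 ^ f x.1.toAdd := rfl

theorem of_zpow_injective :
    Function.Injective fun k : ℤ => (of (0 : Fin 1) : FreeGroup (Fin 1)) ^ k := by
  intro k l h
  have := congrArg (lift fun _ : Fin 1 => Multiplicative.ofAdd (1 : ℤ)) h
  simpa [← ofAdd_zsmul] using this

theorem exists_eq_of_zpow (x : FreeGroup (Fin 1)) : ∃ k : ℤ, x = of 0 ^ k := by
  have h : (⊤ : Subgroup (FreeGroup (Fin 1))) ≤ Subgroup.zpowers (of 0) := by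
    rw [← FreeGroup.closure_range_of, Subgroup.closure_le]
    rintro _ ⟨j, rfl⟩
    rw [Subsingleton.elim j 0]
    exact Subgroup.mem_zpowers _
  obtain ⟨k, hk⟩ := h (Subgroup.mem_top x)
  exact ⟨k, hk.symm⟩

/-- The value on `w` of the functional that takes the values `φ i` on the generators `t_i`, values
being represented by words in one letter. -/
def functionalWord (φ : Fin m → GroupWord (Fin 1)) (w : GroupWord (Fin m ⊕ Fin n)) :
    GroupWord (Fin 1) :=
  subst (Sum.elim φ fun _ => []) w

theorem mk_functionalWord {φ : Fin m → GroupWord (Fin 1)} {f : (Fin m → ℤ) →ₗ[ℤ] ℤ}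
    (h : ∀ i, mk (φ i) = of 0 ^ f (Pi.single i 1)) (w : GroupWord (Fin m ⊕ Fin n)) :
    mk (functionalWord φ w) = functional f (wordEval (gen m n) w) := by
  rw [functionalWord, mk_subst, map_wordEval, wordEval]
  congr 2
  ext a
  rcases a with i | j
  · exact h i
  · simp [functional_apply, gen, ← one_eq_mk]

theorem exists_functional (φ : Fin m → GroupWord (Fin 1)) :
    ∃ f : (Fin m → ℤ) →ₗ[ℤ] ℤ, ∀ i, mk (φ i) = of 0 ^ f (Pi.single i 1) := by
  choose k hk using fun i => exists_eq_of_zpow (mk (φ i))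
  refine ⟨(Pi.basisFun ℤ (Fin m)).constr ℤ k, fun i => ?_⟩
  rw [hk i, ← Pi.basisFun_apply, Module.Basis.constr_basis]

theorem exists_functionalWord (f : (Fin m → ℤ) →ₗ[ℤ] ℤ) :
    ∃ φ : Fin m → GroupWord (Fin 1), ∀ i, mk (φ i) = of 0 ^ f (Pi.single i 1) :=
  ⟨fun i => (of 0 ^ f (Pi.single i 1)).toWord, fun _ => mk_toWord⟩

theorem primrec_functionalWord : Primrec fun z : (Fin m → GroupWord (Fin 1)) ×
    GroupWord (Fin m ⊕ Fin n) => functionalWord z.1 z.2 := by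
  refine primrec_subst (φ := fun z : (Fin m → GroupWord (Fin 1)) × GroupWord (Fin m ⊕ Fin n) =>
    Sum.elim z.1 fun _ => []) ?_ Primrec.snd
  refine (Primrec.sumCasesOn (f := fun z : ((Fin m → GroupWord (Fin 1)) ×
    GroupWord (Fin m ⊕ Fin n)) × (Fin m ⊕ Fin n) => z.2) (g := fun z i => z.1.1 i)
    (h := fun _ _ => ([] : GroupWord (Fin 1))) Primrec.snd
    (Primrec.fin_app.comp (Primrec.fst.comp (Primrec.fst.comp Primrec.fst)) Primrec.snd)
    (Primrec.const _)).of_eq fun z => ?_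
  rcases z with ⟨_, _ | _⟩ <;> rfl

/-- To search for a linear functional is to search for words that represent its values. -/
theorem semidecidable_exists_functional {p : γ → (GroupWord (Fin m ⊕ Fin n) → FreeGroup (Fin 1)) →
    Prop} (hp : Semidecidable fun z : γ × (Fin m → GroupWord (Fin 1)) =>
      p z.1 fun w => mk (functionalWord z.2 w)) :
    Semidecidable fun c => ∃ f : (Fin m → ℤ) →ₗ[ℤ] ℤ,
      p c fun w => functional f (wordEval (gen m n) w) := by
  refine (Semidecidable.exists_snd (p := fun c (φ : Fin m → GroupWord (Fin 1)) =>
    p c fun w => mk (functionalWord φ w)) hp).of_iff fun c => ⟨?_, ?_⟩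
  · rintro ⟨f, hf⟩
    obtain ⟨φ, hφ⟩ := exists_functionalWord f
    exact ⟨φ, by simpa only [mk_functionalWord hφ] using hf⟩
  · rintro ⟨φ, hφ⟩
    obtain ⟨f, hf⟩ := exists_functional φ
    exact ⟨f, by simpa only [mk_functionalWord hf] using hφ⟩

theorem semidecidableWordProblem : SemidecidableWordProblem (gen m n) := by
  let δ : Fin m → Fin m → GroupWord (Fin 1) := fun i j => if j = i then [(0, true)] else []
  have hδ : Primrec δ := by
    rw [Primrec.fin_curry]
    exact Primrec.ite (Primrec.eq.comp Primrec.snd Primrec.fst) (Primrec.const _) (Primrec.const _)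
  let W := GroupWord (Fin m ⊕ Fin n)
  have h1 : Semidecidable fun z : W × W => ∀ i ∈ List.finRange m,
      mk (functionalWord (δ i) z.1) = mk (functionalWord (δ i) z.2) :=
    Semidecidable.forall_mem (p := fun (z : W × W) (i : Fin m) =>
      mk (functionalWord (δ i) z.1) = mk (functionalWord (δ i) z.2))
      (semidecidable_mk_eq
        (primrec_functionalWord.comp (Primrec.pair (hδ.comp Primrec.snd)
          (Primrec.fst.comp Primrec.fst)))
        (primrec_functionalWord.comp (Primrec.pair (hδ.comp Primrec.snd)
          (Primrec.snd.comp Primrec.fst)))) (Primrec.const _)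
  refine (Semidecidable.and (semidecidable_mk_eq (primrec_freeWord.comp Primrec.fst)
    (primrec_freeWord.comp Primrec.snd)) h1).of_iff fun z => ?_
  have hproj : ∀ i j, mk (δ i j) = of 0 ^ (LinearMap.proj (R := ℤ) (φ := fun _ : Fin m => ℤ) i)
      (Pi.single j 1) := by
    intro i j
    by_cases h : j = i
    · subst h; simp [δ]; rfl
    · simp [δ, h, Ne.symm h, ← one_eq_mk]
  simp only [mk_freeWord, mk_functionalWord (hproj _), functional_apply]
  constructor
  · intro h
    simp [h]
  · rintro ⟨h1, h2⟩
    refine Prod.ext (Multiplicative.toAdd.injective (funext fun i => ?_)) h1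
    exact of_zpow_injective (h2 i (List.mem_finRange i))

theorem semidecidable_free_eq {v w : γ → GroupWord (Fin m ⊕ Fin n)} (hv : Primrec v)
    (hw : Primrec w) :
    Semidecidable fun c => (wordEval (gen m n) (v c)).2 = (wordEval (gen m n) (w c)).2 :=
  (semidecidable_mk_eq (primrec_freeWord.comp hv) (primrec_freeWord.comp hw)).of_iff fun c => by
    rw [mk_freeWord, mk_freeWord]

theorem primrec_map_freeWord :
    Primrec fun S : List (GroupWord (Fin m ⊕ Fin n)) => S.map freeWord :=
  Primrec.list_map Primrec.id (primrec_freeWord.comp Primrec.snd)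

theorem semidecidable_mem_freeProj {w : γ → GroupWord (Fin m ⊕ Fin n)}
    {S : γ → List (GroupWord (Fin m ⊕ Fin n))} (hw : Primrec w) (hS : Primrec S) :
    Semidecidable fun c =>
      (wordEval (gen m n) (w c)).2 ∈ freeProj (wordSubgroup (gen m n) (S c)) :=
  (semidecidable_mem (primrec_freeWord.comp hw) (primrec_map_freeWord.comp hS)).of_iff fun c => by
    rw [freeProj_wordSubgroup, mk_freeWord]

theorem semidecidable_freeProj_generates_inf {V S S' : γ → List (GroupWord (Fin m ⊕ Fin n))}
    (hV : Primrec V) (hS : Primrec S) (hS' : Primrec S') : Semidecidable fun c =>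
      freeProj (wordSubgroup (gen m n) (V c)) =
        freeProj (wordSubgroup (gen m n) (S c)) ⊓ freeProj (wordSubgroup (gen m n) (S' c)) :=
  (semidecidable_generates_inf (primrec_map_freeWord.comp hV) (primrec_map_freeWord.comp hS)
    (primrec_map_freeWord.comp hS')).of_iff fun c => by simp only [freeProj_wordSubgroup]

/-- The words of `l` represent elements of `ℤ^m`. -/
def InLattice (l : List (GroupWord (Fin m ⊕ Fin n))) : Prop :=
  ∀ w ∈ l, (wordEval (gen m n) w).2 = 1

theorem semidecidable_inLattice {l : γ → List (GroupWord (Fin m ⊕ Fin n))} (hl : Primrec l) :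
    Semidecidable fun c => InLattice (l c) :=
  (Semidecidable.forall_mem (p := fun _ w => (wordEval (gen m n) w).2 =
      (wordEval (gen m n) []).2)
    (semidecidable_free_eq Primrec.snd (Primrec.const [])) hl).of_iff fun c => by
      simp [InLattice, wordEval_nil]

/-- Some linear functional vanishes on `l` and not on `w`. -/
def RatIndep (w : GroupWord (Fin m ⊕ Fin n)) (l : List (GroupWord (Fin m ⊕ Fin n))) : Prop :=
  ∃ f : (Fin m → ℤ) →ₗ[ℤ] ℤ, (∀ v ∈ l, functional f (wordEval (gen m n) v) = 1) ∧
    functional f (wordEval (gen m n) w) ≠ 1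

theorem semidecidable_ratIndep {w : γ → GroupWord (Fin m ⊕ Fin n)}
    {l : γ → List (GroupWord (Fin m ⊕ Fin n))} (hw : Primrec w) (hl : Primrec l) :
    Semidecidable fun c => RatIndep (w c) (l c) := by
  refine semidecidable_exists_functional (p := fun c F => (∀ v ∈ l c, F v = 1) ∧ F (w c) ≠ 1) ?_
  refine Semidecidable.and (Semidecidable.forall_mem (p := fun (z : γ ×
    (Fin m → GroupWord (Fin 1))) v => mk (functionalWord z.2 v) = mk [])
    (semidecidable_mk_eq (primrec_functionalWord.comp
      (Primrec.pair (Primrec.snd.comp Primrec.fst) Primrec.snd)) (Primrec.const []))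
    (hl.comp Primrec.fst)) ?_
  exact semidecidable_mk_ne (primrec_functionalWord.comp
      (Primrec.pair Primrec.snd (hw.comp Primrec.fst))) (Primrec.const [])

/-- Some linear functional takes a value on `w` that it does not take on the subgroup generated by
`l`. -/
def FunctionalSeparates (w : GroupWord (Fin m ⊕ Fin n))
    (l : List (GroupWord (Fin m ⊕ Fin n))) : Prop :=
  ∃ f : (Fin m → ℤ) →ₗ[ℤ] ℤ, functional f (wordEval (gen m n) w) ∉
    (wordSubgroup (gen m n) l).map (functional f)

theorem semidecidable_functionalSeparates {w : γ → GroupWord (Fin m ⊕ Fin n)}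
    {l : γ → List (GroupWord (Fin m ⊕ Fin n))} (hw : Primrec w) (hl : Primrec l) :
    Semidecidable fun c => FunctionalSeparates (w c) (l c) := by
  have h := semidecidable_exists_functional (m := m) (n := n) (p := fun c F =>
    F (w c) ∉ Subgroup.closure {g | ∃ v ∈ l c, F v = g}) (by
    refine (semidecidable_notMem (γ := γ × (Fin m → GroupWord (Fin 1)))
      (w := fun z => functionalWord z.2 (w z.1))
      (S := fun z => (l z.1).map (functionalWord z.2)) ?_ ?_).of_iff fun z => ?_
    · exact primrec_functionalWord.comp (Primrec.pair Primrec.snd (hw.comp Primrec.fst))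
    · exact Primrec.list_map (hl.comp Primrec.fst) (primrec_functionalWord.comp
        (Primrec.pair (Primrec.snd.comp Primrec.fst) Primrec.snd))
    · simp [wordSubgroup, wordEval_of])
  refine h.of_iff fun c => ?_
  have : ∀ f : (Fin m → ℤ) →ₗ[ℤ] ℤ, (wordSubgroup (gen m n) (l c)).map (functional f) =
      Subgroup.closure {g | ∃ v ∈ l c, functional f (wordEval (gen m n) v) = g} := fun f => by
    rw [map_wordSubgroup, wordSubgroup]
    congr 1
    ext g
    simp only [map_wordEval]
  simp only [FunctionalSeparates, this]

end ZF

/-! ### Lattices and linear functionals -/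

/-- A vector no multiple of which lies in `Λ` is separated from `Λ` by a functional: the quotient
by the torsion modulo `Λ` is free. -/
theorem exists_functional_of_forall_smul_notMem {m : ℕ} {Λ : Submodule ℤ (Fin m → ℤ)}
    {d : Fin m → ℤ} (h : ∀ N : ℕ, 0 < N → N • d ∉ Λ) :
    ∃ f : (Fin m → ℤ) →ₗ[ℤ] ℤ, (∀ x ∈ Λ, f x = 0) ∧ f d ≠ 0 := by
  let M := (Fin m → ℤ) ⧸ Λ
  let T := Submodule.torsion ℤ M
  have : Module.IsTorsionFree ℤ (M ⧸ T) := inferInstance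
  have : Module.Free ℤ (M ⧸ T) := Module.free_of_finite_type_torsion_free'
  let b := Module.Free.chooseBasis ℤ (M ⧸ T)
  let π : (Fin m → ℤ) →ₗ[ℤ] M ⧸ T := T.mkQ.comp Λ.mkQ
  have hd : π d ≠ 0 := by
    intro h0
    have h1 : Λ.mkQ d ∈ T := (Submodule.Quotient.mk_eq_zero T).1 h0
    obtain ⟨⟨a, ha⟩, hz⟩ := h1
    have hz' : a • Λ.mkQ d = 0 := hz
    rw [← map_smul, Submodule.mkQ_apply, Submodule.Quotient.mk_eq_zero] at hz'
    have ha0 : a ≠ 0 := nonZeroDivisors.ne_zero ha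
    refine h a.natAbs (Int.natAbs_pos.2 ha0) ?_
    rcases Int.natAbs_eq a with e | e
    · rw [e, natCast_zsmul] at hz'; exact hz'
    · rw [e, neg_smul, natCast_zsmul, neg_mem_iff] at hz'; exact hz'
  obtain ⟨i, hi⟩ : ∃ i, b.repr (π d) i ≠ 0 := by
    by_contra! hall
    exact hd (b.repr.map_eq_zero_iff.1 (Finsupp.ext hall))
  refine ⟨(b.coord i).comp π, fun x hx => ?_, hi⟩
  have : π x = 0 := by
    rw [LinearMap.comp_apply, Submodule.mkQ_apply Λ, (Submodule.Quotient.mk_eq_zero Λ).2 hx,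
      map_zero]
  rw [LinearMap.comp_apply, this, map_zero]

/-- A vector outside `Λ` is separated from `Λ` by the values of a functional: clear the denominators
of a character of the quotient with values in `ℚ / ℤ`. -/
theorem exists_functional_of_notMem {m : ℕ} {Λ : Submodule ℤ (Fin m → ℤ)}
    {d : Fin m → ℤ} (h : d ∉ Λ) :
    ∃ f : (Fin m → ℤ) →ₗ[ℤ] ℤ, ∀ x ∈ Λ, f x ≠ f d := by
  have hd : (Λ.mkQ d) ≠ 0 := fun h0 => h ((Submodule.Quotient.mk_eq_zero Λ).1 h0)
  obtain ⟨χ, hχ⟩ := CharacterModule.exists_character_apply_ne_zero_of_ne_zero hd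
  let χ' : (Fin m → ℤ) →+ AddCircle (1 : ℚ) := χ.comp Λ.mkQ.toAddMonoidHom
  choose r hr using fun i : Fin m => QuotientAddGroup.mk_surjective (χ' (Pi.single i 1))
  -- a common denominator of the values of the character on the standard basis
  let q : ℕ := ∏ i, (r i).den
  have hq : q ≠ 0 := Finset.prod_ne_zero_iff.2 fun i _ => (r i).den_ne_zero
  have hint : ∀ i, ∃ k : ℤ, (k : ℚ) = q * r i := fun i => by
    refine ⟨(∏ j ∈ Finset.univ.erase i, (r j).den : ℕ) * (r i).num, ?_⟩
    have : q = (∏ j ∈ Finset.univ.erase i, (r j).den) * (r i).den :=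
      (Finset.prod_erase_mul _ _ (Finset.mem_univ i)).symm
    rw [this]
    push_cast
    rw [mul_assoc, mul_comm ((r i).den : ℚ), Rat.mul_den_eq_num]
  choose k hk using hint
  let f : (Fin m → ℤ) →ₗ[ℤ] ℤ := (Pi.basisFun ℤ (Fin m)).constr ℤ k
  have hf : ∀ x, χ' x = (((f x : ℚ) / q : ℚ) : AddCircle (1 : ℚ)) := by
    let ψ : (Fin m → ℤ) →+ AddCircle (1 : ℚ) :=
      (QuotientAddGroup.mk' _).comp ((AddMonoidHom.mulRight ((q : ℚ)⁻¹)).comp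
        ((Int.castAddHom ℚ).comp f.toAddMonoidHom))
    have hψ : χ' = ψ := by
      refine AddMonoidHom.toIntLinearMap_injective ((Pi.basisFun ℤ (Fin m)).ext fun i => ?_)
      rw [Pi.basisFun_apply]
      change χ' (Pi.single i 1) = (((f (Pi.single i 1) : ℚ) * (q : ℚ)⁻¹ : ℚ) : AddCircle (1 : ℚ))
      have : f (Pi.single i 1) = k i := by
        rw [← Pi.basisFun_apply, Module.Basis.constr_basis]
      rw [this, hk, ← hr i, mul_comm (q : ℚ), mul_assoc,
        mul_inv_cancel₀ (by exact_mod_cast hq), mul_one]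
    intro x
    rw [hψ, div_eq_mul_inv]
    rfl
  refine ⟨f, fun x hx e => hχ ?_⟩
  have h1 : χ' x = χ' d := by rw [hf, hf, e]
  have h2 : χ' x = 0 := by
    change χ (Λ.mkQ x) = 0
    rw [Submodule.mkQ_apply, (Submodule.Quotient.mk_eq_zero Λ).2 hx, map_zero]
  exact h1.symm.trans h2

namespace ZF

open FreeGroup

variable {m n : ℕ} {γ : Type} [Primcodable γ]

/-- The intersection `H ∩ ℤ^m`, as a subgroup of `ℤ^m × F_n`. -/
def latticePart (H : Subgroup (ZF m n)) : Subgroup (ZF m n) := H ⊓ (MonoidHom.snd _ _).ker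

theorem mem_latticePart {H : Subgroup (ZF m n)} {x : ZF m n} :
    x ∈ latticePart H ↔ x ∈ H ∧ x.2 = 1 := Iff.rfl

theorem eq_of_freeProj_le {E H : Subgroup (ZF m n)} (hE : E ≤ H)
    (hf : freeProj H ≤ freeProj E) (hz : latticePart H ≤ E) : E = H :=
  le_antisymm hE (le_of_freeProj_le hE hf fun _ ha => hz ⟨ha, rfl⟩)

theorem latticePart_fg (H : Subgroup (ZF m n)) : (latticePart H).FG := by
  rw [fg_iff_freeProj_fg]
  refine (Subgroup.fg_iff _).2 ⟨{1}, ?_, Set.finite_singleton _⟩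
  rw [Subgroup.closure_singleton_one, eq_comm, eq_bot_iff]
  rintro _ ⟨x, hx, rfl⟩
  exact hx.2

theorem commute_of_snd_eq_one {x : ZF m n} (hx : x.2 = 1) (y : ZF m n) : x * y = y * x :=
  Prod.ext (mul_comm _ _) (by simp [hx])

theorem InLattice.snd_eq_one {l : List (GroupWord (Fin m ⊕ Fin n))} (hl : InLattice l) {x : ZF m n}
    (hx : x ∈ wordSubgroup (gen m n) l) : x.2 = 1 :=
  (wordSubgroup_le (gen := gen m n) (S := l)
    (P := (MonoidHom.snd (Multiplicative (Fin m → ℤ)) (FreeGroup (Fin n))).ker)).2 hl hx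

theorem functional_eq_one_iff {f : (Fin m → ℤ) →ₗ[ℤ] ℤ} {x : ZF m n} :
    functional f x = 1 ↔ f x.1.toAdd = 0 := by
  rw [functional_apply, ← zpow_zero (of (0 : Fin 1))]
  exact of_zpow_injective.eq_iff

/-- The subgroup of `ℤ^m` generated by the abelian parts of a list of words. -/
def latticeSpan (l : List (GroupWord (Fin m ⊕ Fin n))) : Submodule ℤ (Fin m → ℤ) :=
  Submodule.span ℤ {v | ∃ w ∈ l, vec w = v}

theorem vec_mem_latticeSpan {l : List (GroupWord (Fin m ⊕ Fin n))} {w : GroupWord (Fin m ⊕ Fin n)}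
    (hw : w ∈ l) : vec w ∈ latticeSpan l := Submodule.subset_span ⟨w, hw, rfl⟩

theorem mem_latticeSpan {l : List (GroupWord (Fin m ⊕ Fin n))} {v : Fin m → ℤ} :
    v ∈ latticeSpan l ↔ ∃ x ∈ wordSubgroup (gen m n) l, x.1.toAdd = v := by
  constructor
  · intro hv
    induction hv using Submodule.span_induction with
    | mem v hv =>
      obtain ⟨w, hw, rfl⟩ := hv
      exact ⟨_, wordEval_mem_wordSubgroup hw, rfl⟩
    | zero => exact ⟨1, one_mem _, rfl⟩
    | add v w _ _ hv hw =>
      obtain ⟨x, hx, rfl⟩ := hv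
      obtain ⟨y, hy, rfl⟩ := hw
      exact ⟨x * y, mul_mem hx hy, rfl⟩
    | smul a v _ hv =>
      obtain ⟨x, hx, rfl⟩ := hv
      exact ⟨x ^ a, zpow_mem hx a, rfl⟩
  · rintro ⟨x, hx, rfl⟩
    induction hx using Subgroup.closure_induction with
    | mem x hx =>
      obtain ⟨w, hw, rfl⟩ := hx
      exact vec_mem_latticeSpan hw
    | one => exact zero_mem _
    | mul x y _ _ hx hy => exact add_mem hx hy
    | inv x _ hx => exact neg_mem hx

theorem InLattice.mem_iff {l : List (GroupWord (Fin m ⊕ Fin n))} (hl : InLattice l) {x : ZF m n}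
    (hx : x.2 = 1) : x ∈ wordSubgroup (gen m n) l ↔ x.1.toAdd ∈ latticeSpan l := by
  refine ⟨fun h => mem_latticeSpan.2 ⟨x, h, rfl⟩, fun h => ?_⟩
  obtain ⟨y, hy, e⟩ := mem_latticeSpan.1 h
  have : y = x := Prod.ext e ((hl.snd_eq_one hy).trans hx.symm)
  exact this ▸ hy

theorem latticeSpan_append (l l' : List (GroupWord (Fin m ⊕ Fin n))) :
    latticeSpan (l ++ l') = latticeSpan l ⊔ latticeSpan l' := by
  rw [latticeSpan, latticeSpan, latticeSpan, ← Submodule.span_union]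
  congr 1
  ext v
  simp [or_and_right, exists_or]

theorem ratIndep_iff {w : GroupWord (Fin m ⊕ Fin n)} {l : List (GroupWord (Fin m ⊕ Fin n))} :
    RatIndep w l ↔ ∀ N : ℕ, 0 < N → N • vec w ∉ latticeSpan l := by
  simp only [RatIndep, functional_eq_one_iff, Ne]
  constructor
  · rintro ⟨f, hl, hf⟩ N hN hmem
    have : latticeSpan l ≤ LinearMap.ker f := by
      rw [latticeSpan, Submodule.span_le]
      rintro _ ⟨v, hv, rfl⟩
      exact hl v hv
    have h := this hmem
    rw [LinearMap.mem_ker, map_nsmul] at h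
    exact hf ((smul_eq_zero.1 h).resolve_left hN.ne')
  · intro h
    obtain ⟨f, hf, hd⟩ := exists_functional_of_forall_smul_notMem h
    exact ⟨f, fun v hv => hf _ (vec_mem_latticeSpan hv), hd⟩

theorem functionalSeparates_iff {w : GroupWord (Fin m ⊕ Fin n)}
    {l : List (GroupWord (Fin m ⊕ Fin n))} :
    FunctionalSeparates w l ↔ vec w ∉ latticeSpan l := by
  constructor
  · rintro ⟨f, hf⟩ hmem
    obtain ⟨x, hx, e⟩ := mem_latticeSpan.1 hmem
    exact hf ⟨x, hx, by rw [functional_apply, functional_apply, e]; rfl⟩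
  · intro h
    obtain ⟨f, hf⟩ := exists_functional_of_notMem h
    refine ⟨f, ?_⟩
    rintro ⟨x, hx, e⟩
    rw [functional_apply, functional_apply] at e
    exact hf _ (mem_latticeSpan.2 ⟨x, hx, rfl⟩) (of_zpow_injective e)

/-- The abelian parts of the words of `l` are linearly independent. -/
def LatticeIndep (l : List (GroupWord (Fin m ⊕ Fin n))) : Prop :=
  LinearIndependent ℤ fun i : Fin l.length => vec (l.get i)

/-- Vectors are linearly independent if and only if for each of them some functional vanishes on all
the others and not on it. -/
theorem latticeIndep_iff {l : List (GroupWord (Fin m ⊕ Fin n))} : LatticeIndep l ↔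
    ∀ i ∈ List.range l.length, ∃ f : (Fin m → ℤ) →ₗ[ℤ] ℤ,
      (∀ j ∈ List.range l.length, j = i ∨ functional f (wordEval (gen m n) (l.getD j [])) = 1) ∧
        functional f (wordEval (gen m n) (l.getD i [])) ≠ 1 := by
  simp only [functional_eq_one_iff, Ne, List.mem_range]
  rw [LatticeIndep]
  constructor
  · intro h i hi
    obtain ⟨f, hf, hd⟩ := exists_functional_of_forall_smul_notMem
      (d := vec (l.get ⟨i, hi⟩)) (Λ := Submodule.span ℤ
        ((fun i : Fin l.length => vec (l.get i)) '' (Set.univ \ {⟨i, hi⟩}))) (fun N hN hmem => by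
          have := (linearIndependent_iff_eq_zero_of_smul_mem_span.1 h) ⟨i, hi⟩ (N : ℤ)
            (by rwa [natCast_zsmul])
          omega)
    refine ⟨f, fun j hj => ?_, by rw [List.getD_eq_getElem _ _ hi]; exact hd⟩
    rw [List.getD_eq_getElem _ _ hj]
    refine or_iff_not_imp_left.2 fun hji => hf _ (Submodule.subset_span
      ⟨⟨j, hj⟩, ⟨trivial, fun e => hji (congrArg Fin.val e)⟩, rfl⟩)
  · intro h
    rw [linearIndependent_iff_eq_zero_of_smul_mem_span]
    rintro ⟨i, hi⟩ a ha
    obtain ⟨f, hf, hd⟩ := h i hi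
    rw [List.getD_eq_getElem _ _ hi] at hd
    have : Submodule.span ℤ ((fun i : Fin l.length => vec (l.get i)) '' (Set.univ \ {⟨i, hi⟩})) ≤
        LinearMap.ker f := by
      rw [Submodule.span_le]
      rintro _ ⟨⟨j, hj⟩, ⟨-, hji⟩, rfl⟩
      have := (hf j hj).resolve_left fun e => hji (Fin.ext e)
      rwa [List.getD_eq_getElem _ _ hj] at this
    have h0 := this ha
    rw [LinearMap.mem_ker, map_smul] at h0
    exact (smul_eq_zero.1 h0).resolve_right hd

theorem semidecidable_latticeIndep {l : γ → List (GroupWord (Fin m ⊕ Fin n))} (hl : Primrec l) :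
    Semidecidable fun c => LatticeIndep (l c) := by
  simp only [latticeIndep_iff]
  refine Semidecidable.forall_mem (p := fun c i => ∃ f : (Fin m → ℤ) →ₗ[ℤ] ℤ,
      (∀ j ∈ List.range (l c).length, j = i ∨
        functional f (wordEval (gen m n) ((l c).getD j [])) = 1) ∧
        functional f (wordEval (gen m n) ((l c).getD i [])) ≠ 1) ?_
    (Primrec.list_range.comp (Primrec.list_length.comp hl))
  refine semidecidable_exists_functional (γ := γ × ℕ) (p := fun c F =>
    (∀ j ∈ List.range (l c.1).length, j = c.2 ∨ F ((l c.1).getD j []) = 1) ∧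
      F ((l c.1).getD c.2 []) ≠ 1) ?_
  have hget := Primrec.list_getD ([] : GroupWord (Fin m ⊕ Fin n))
  have h1 : Primrec fun z : (γ × ℕ) × (Fin m → GroupWord (Fin 1)) => l z.1.1 :=
    hl.comp (Primrec.fst.comp Primrec.fst)
  refine Semidecidable.and (Semidecidable.forall_mem (p := fun (z : (γ × ℕ) ×
    (Fin m → GroupWord (Fin 1))) (j : ℕ) => j = z.1.2 ∨
      mk (functionalWord z.2 ((l z.1.1).getD j [])) = mk []) (.or (.of_primrec ?_) ?_)
    (Primrec.list_range.comp (Primrec.list_length.comp h1)))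
    (semidecidable_mk_ne (primrec_functionalWord.comp (Primrec.pair Primrec.snd
      (hget.comp h1 (Primrec.snd.comp Primrec.fst)))) (Primrec.const []))
  · exact Primrec.eq.comp Primrec.snd (Primrec.snd.comp (Primrec.fst.comp Primrec.fst))
  · exact semidecidable_mk_eq (primrec_functionalWord.comp (Primrec.pair
      (Primrec.snd.comp Primrec.fst) (hget.comp (h1.comp Primrec.fst) Primrec.snd)))
      (Primrec.const [])

end ZF

/-! ### Lattice parts and their intersections -/

namespace FreeGroup

theorem freelyIndependent_iff {α : Type} {U : List (GroupWord α)} {k : ℕ} {g : Fin k → FreeGroup α}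
    (h : U.map mk = List.ofFn g) : FreelyIndependent U ↔ Function.Injective (lift g) := by
  obtain rfl : U.length = k := by simpa using congrArg List.length h
  have : g = fun i => mk (U.get i) := by
    exact (List.ofFn_injective ((List.ofFn_getElem_eq_map _ _).trans h)).symm
  rw [FreelyIndependent, this]

theorem lift_basis_injective {ι G : Type*} [Group G] {J : Subgroup G} (b : FreeGroupBasis ι J) :
    Function.Injective (lift fun i => (b i : G)) := by
  have : (lift fun i => (b i : G)) = J.subtype.comp b.repr.symm.toMonoidHom := by
    ext i
    simp
    rfl
  rw [this]
  exact J.subtype_injective.comp b.repr.symm.injective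

end FreeGroup

namespace ZF

open FreeGroup

variable {m n : ℕ} {γ : Type} [Primcodable γ]

theorem latticeIndep_iff_linearIndependent {l : List (GroupWord (Fin m ⊕ Fin n))} {k : ℕ}
    {g : Fin k → Fin m → ℤ} (h : l.map vec = List.ofFn g) :
    LatticeIndep l ↔ LinearIndependent ℤ g := by
  obtain rfl : l.length = k := by simpa using congrArg List.length h
  have : g = fun i => vec (l.get i) := by
    exact (List.ofFn_injective ((List.ofFn_getElem_eq_map _ _).trans h)).symm
  rw [LatticeIndep, this]

theorem freelyIndependent_map_freeWord {U : List (GroupWord (Fin m ⊕ Fin n))} :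
    FreelyIndependent (U.map freeWord) ↔
      Function.Injective (lift fun i : Fin U.length => (wordEval (gen m n) (U.get i)).2) := by
  refine freelyIndependent_iff (Eq.trans ?_
    (List.ofFn_getElem_eq_map U fun w => (wordEval (gen m n) w).2).symm)
  simp [Function.comp_def, mk_freeWord]

theorem snd_lift {ι : Type*} (u : ι → ZF m n) (y : FreeGroup ι) :
    (lift u y).2 = lift (fun i => (u i).2) y := by
  have : (MonoidHom.snd _ _).comp (lift u) = lift fun i => (u i).2 := by
    ext i
    simp
  rw [← this]
  rfl

theorem InLattice.normal {l : List (GroupWord (Fin m ⊕ Fin n))} (hl : InLattice l) :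
    (wordSubgroup (gen m n) l).Normal :=
  ⟨fun x hx g => by
    rwa [← commute_of_snd_eq_one (hl.snd_eq_one hx), mul_inv_cancel_right]⟩

theorem exists_mul_lift {l U : List (GroupWord (Fin m ⊕ Fin n))} (hl : InLattice l) {x : ZF m n}
    (hx : x ∈ wordSubgroup (gen m n) (l ++ U)) : ∃ a ∈ wordSubgroup (gen m n) l,
      ∃ y, x = a * lift (fun i : Fin U.length => wordEval (gen m n) (U.get i)) y := by
  have := hl.normal
  rw [wordSubgroup_append, Subgroup.mem_sup_of_normal_left] at hx
  obtain ⟨a, ha, z, hz, rfl⟩ := hx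
  have hU : wordSubgroup (gen m n) U ≤
      (lift fun i : Fin U.length => wordEval (gen m n) (U.get i)).range := by
    rw [wordSubgroup_le]
    intro w hw
    obtain ⟨i, rfl⟩ := List.get_of_mem hw
    exact ⟨of i, lift_apply_of⟩
  obtain ⟨y, rfl⟩ := hU hz
  exact ⟨a, ha, y, rfl⟩

theorem latticePart_of_freelyIndependent {l U : List (GroupWord (Fin m ⊕ Fin n))}
    (hl : InLattice l) (hU : FreelyIndependent (U.map freeWord)) :
    latticePart (wordSubgroup (gen m n) (l ++ U)) = wordSubgroup (gen m n) l := by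
  refine le_antisymm ?_ ?_
  · rintro x ⟨hx, hx2⟩
    obtain ⟨a, ha, y, rfl⟩ := exists_mul_lift hl hx
    replace hx2 : a.2 * _ = 1 := hx2
    rw [hl.snd_eq_one ha, one_mul, snd_lift] at hx2
    rw [freelyIndependent_map_freeWord.1 hU (hx2.trans (_root_.map_one _).symm), _root_.map_one,
      mul_one]
    exact ha
  · intro x hx
    rw [mem_latticePart, wordSubgroup_append]
    exact ⟨Subgroup.mem_sup_left hx, hl.snd_eq_one hx⟩

/-- Lifts of a free basis of `H π` complete generators of the lattice part to generators of `H`. -/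
theorem exists_freelyIndependent {H : Subgroup (ZF m n)} (hH : H.FG) :
    ∃ U : List (GroupWord (Fin m ⊕ Fin n)), FreelyIndependent (U.map freeWord) ∧
      ∀ l, wordSubgroup (gen m n) l = latticePart H → wordSubgroup (gen m n) (l ++ U) = H := by
  obtain ⟨k, ⟨b⟩⟩ := exists_finite_basis (fg_iff_freeProj_fg.1 hH)
  choose h hh hb using fun i => mem_freeProj.1 (b i).2
  obtain ⟨U, hU⟩ := exists_map_wordEval (closure_range_gen m n) (List.ofFn h)
  refine ⟨U, ?_, fun l hl => ?_⟩
  · rw [freelyIndependent_iff (g := fun i => (b i : FreeGroup (Fin n)))]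
    · exact lift_basis_injective b
    · have : (U.map freeWord).map mk = (U.map (wordEval (gen m n))).map Prod.snd := by
        simp [Function.comp_def, mk_freeWord]
      rw [this, hU, List.map_ofFn]
      congr 1
      exact funext hb
  · have hUH : ∀ i, h i ∈ wordSubgroup (gen m n) U := fun i => by
      have : h i ∈ U.map (wordEval (gen m n)) := by
        rw [hU]
        exact List.mem_ofFn.2 ⟨i, rfl⟩
      obtain ⟨w, hw, e⟩ := List.mem_map.1 this
      exact e ▸ wordEval_mem_wordSubgroup hw
    rw [wordSubgroup_append, hl]
    refine eq_of_freeProj_le (sup_le inf_le_left (wordSubgroup_le.2 fun w hw => ?_)) ?_ le_sup_left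
    · have : wordEval (gen m n) w ∈ List.ofFn h := hU ▸ List.mem_map_of_mem hw
      obtain ⟨i, hi⟩ := List.mem_ofFn.1 this
      exact hi ▸ hh i
    · intro x hx
      exact b.mem_of_forall_mem (P := (freeProj (latticePart H ⊔
        wordSubgroup (gen m n) U)).subgroupOf (freeProj H))
        (fun i => mem_freeProj.2 ⟨h i, Subgroup.mem_sup_right (hUH i), hb i⟩) ⟨x, hx⟩

theorem InLattice.of_eq_latticePart {l : List (GroupWord (Fin m ⊕ Fin n))} {H : Subgroup (ZF m n)}
    (h : wordSubgroup (gen m n) l = latticePart H) : InLattice l := fun w hw => by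
  have := wordEval_mem_wordSubgroup (gen := gen m n) hw
  rw [h] at this
  exact this.2

/-- A list `l` generates the lattice part if a freely independent list completes it to a list of
generators. -/
theorem semidecidable_eq_latticePart {l S : γ → List (GroupWord (Fin m ⊕ Fin n))} (hl : Primrec l)
    (hS : Primrec S) : Semidecidable fun c =>
      wordSubgroup (gen m n) (l c) = latticePart (wordSubgroup (gen m n) (S c)) := by
  refine ((semidecidable_inLattice hl).and (Semidecidable.exists_snd
    (p := fun c U => wordSubgroup (gen m n) (l c ++ U) = wordSubgroup (gen m n) (S c) ∧
      FreelyIndependent (U.map freeWord)) (.and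
      (semidecidableWordProblem.wordSubgroup_eq
        (Primrec.list_append.comp (hl.comp Primrec.fst) Primrec.snd) (hS.comp Primrec.fst))
      (semidecidable_freelyIndependent.comp (primrec_map_freeWord.comp Primrec.snd))))).of_iff
    fun c => ⟨fun h => ⟨.of_eq_latticePart h, ?_⟩, ?_⟩
  · obtain ⟨U, hU, H⟩ := exists_freelyIndependent (wordSubgroup_fg (gen := gen m n) (S c))
    exact ⟨U, H _ h, hU⟩
  · rintro ⟨hlc, U, h, hU⟩
    rw [← h, latticePart_of_freelyIndependent hlc hU]

theorem vec_append_invRev (v w : GroupWord (Fin m ⊕ Fin n)) :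
    vec (v ++ invRev w) = vec v - vec w := by
  rw [vec, wordEval_append, wordEval_invRev, sub_eq_add_neg]
  rfl

theorem exists_vec_eq (v : Fin m → ℤ) :
    ∃ w : GroupWord (Fin m ⊕ Fin n), wordEval (gen m n) w = (Multiplicative.ofAdd v, 1) :=
  exists_wordEval (closure_range_gen m n) _

theorem exists_latticeIndep (H : Subgroup (ZF m n)) : ∃ l : List (GroupWord (Fin m ⊕ Fin n)),
    InLattice l ∧ LatticeIndep l ∧ wordSubgroup (gen m n) l = latticePart H := by
  obtain ⟨l₀, h₀⟩ := exists_wordSubgroup_eq (closure_range_gen m n) (latticePart_fg H)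
  have hl₀ := InLattice.of_eq_latticePart h₀
  let b := Module.finBasis ℤ (latticeSpan l₀)
  choose w hw using fun i => exists_vec_eq (n := n) (b i : Fin m → ℤ)
  have hl : InLattice (List.ofFn w) := fun v hv => by
    obtain ⟨i, rfl⟩ := List.mem_ofFn.1 hv
    rw [hw]
  have hspan : latticeSpan (List.ofFn w) = latticeSpan l₀ := by
    have h1 : {v | ∃ u ∈ List.ofFn w, vec u = v} = (latticeSpan l₀).subtype '' Set.range b := by
      ext v
      simp [List.mem_ofFn, vec, hw]
    rw [latticeSpan, h1, Submodule.span_image, b.span_eq, Submodule.map_top,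
      Submodule.range_subtype]
  refine ⟨List.ofFn w, hl, ?_, ?_⟩
  · rw [latticeIndep_iff_linearIndependent (g := fun i => (b i : Fin m → ℤ))]
    · exact b.linearIndependent.map' (latticeSpan l₀).subtype (Submodule.ker_subtype _)
    · rw [List.map_ofFn]
      congr 1
      ext1 i
      simp [vec, hw]
  · rw [← h₀]
    ext x
    by_cases hx : x.2 = 1
    · rw [hl.mem_iff hx, hl₀.mem_iff hx, hspan]
    · exact ⟨fun h => absurd (hl.snd_eq_one h) hx, fun h => absurd (hl₀.snd_eq_one h) hx⟩

/-- The pair of the elements that `v` and `v'` represent is a product of pairs from `L` and their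
inverses. -/
def PairMem (L : List (GroupWord (Fin m ⊕ Fin n) × GroupWord (Fin m ⊕ Fin n)))
    (v v' : GroupWord (Fin m ⊕ Fin n)) : Prop :=
  ∃ z : GroupWord ℕ,
    wordEval (gen m n) (subst (fun i => (L.getD i ([], [])).1) z) = wordEval (gen m n) v ∧
    wordEval (gen m n) (subst (fun i => (L.getD i ([], [])).2) z) = wordEval (gen m n) v'

/-- The subgroup generated by pairs of elements that a list of pairs of words represents. -/
def pairSubgroup (L : List (GroupWord (Fin m ⊕ Fin n) × GroupWord (Fin m ⊕ Fin n))) :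
    Subgroup (ZF m n × ZF m n) :=
  Subgroup.closure {g | ∃ p ∈ L, (wordEval (gen m n) p.1, wordEval (gen m n) p.2) = g}

theorem pairMem_iff {L : List (GroupWord (Fin m ⊕ Fin n) × GroupWord (Fin m ⊕ Fin n))}
    {v v' : GroupWord (Fin m ⊕ Fin n)} :
    PairMem L v v' ↔ (wordEval (gen m n) v, wordEval (gen m n) v') ∈ pairSubgroup L := by
  let g : ℕ → ZF m n × ZF m n := fun i =>
    (wordEval (gen m n) (L.getD i ([], [])).1, wordEval (gen m n) (L.getD i ([], [])).2)
  have hg : pairSubgroup L = (lift g).range := by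
    refine le_antisymm ?_ (range_lift_le ?_)
    · rw [pairSubgroup, Subgroup.closure_le]
      rintro _ ⟨p, hp, rfl⟩
      obtain ⟨i, hi, rfl⟩ := List.getElem_of_mem hp
      refine ⟨of i, ?_⟩
      rw [lift_apply_of]
      simp only [g, List.getD_eq_getElem _ _ hi]
    · rintro _ ⟨i, rfl⟩
      rcases lt_or_ge i L.length with hi | hi
      · refine Subgroup.subset_closure ⟨L[i], List.getElem_mem hi, ?_⟩
        simp only [g, List.getD_eq_getElem _ _ hi]
      · simp only [g, List.getD_eq_default _ _ hi]
        exact one_mem _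
  have h1 : ∀ z, wordEval (gen m n) (subst (fun i => (L.getD i ([], [])).1) z) =
      (wordEval g z).1 := fun z => by
    rw [wordEval_subst]
    exact (map_wordEval (gen := g) (MonoidHom.fst (ZF m n) (ZF m n)) z).symm
  have h2 : ∀ z, wordEval (gen m n) (subst (fun i => (L.getD i ([], [])).2) z) =
      (wordEval g z).2 := fun z => by
    rw [wordEval_subst]
    exact (map_wordEval (gen := g) (MonoidHom.snd (ZF m n) (ZF m n)) z).symm
  rw [hg, PairMem]
  constructor
  · rintro ⟨z, e1, e2⟩
    exact ⟨mk z, Prod.ext ((h1 z).symm.trans e1) ((h2 z).symm.trans e2)⟩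
  · rintro ⟨y, hy⟩
    have : wordEval g y.toWord = (wordEval (gen m n) v, wordEval (gen m n) v') := by
      rw [wordEval, mk_toWord, hy]
    exact ⟨y.toWord, by rw [h1, this], by rw [h2, this]⟩

theorem semidecidable_pairMem
    {L : γ → List (GroupWord (Fin m ⊕ Fin n) × GroupWord (Fin m ⊕ Fin n))}
    {v v' : γ → GroupWord (Fin m ⊕ Fin n)} (hL : Primrec L) (hv : Primrec v) (hv' : Primrec v') :
    Semidecidable fun c => PairMem (L c) (v c) (v' c) := by
  have hget : Primrec fun z : (γ × GroupWord ℕ) × ℕ => (L z.1.1).getD z.2 ([], []) :=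
    (Primrec.list_getD _).comp (hL.comp (Primrec.fst.comp Primrec.fst)) Primrec.snd
  refine Semidecidable.exists_snd (p := fun c z =>
    wordEval (gen m n) (subst (fun i => ((L c).getD i ([], [])).1) z) = wordEval (gen m n) (v c) ∧
    wordEval (gen m n) (subst (fun i => ((L c).getD i ([], [])).2) z) = wordEval (gen m n) (v' c))
    (.and (semidecidableWordProblem.eq
      (primrec_subst (γ := γ × GroupWord ℕ) (φ := fun x i => ((L x.1).getD i ([], [])).1)
        (Primrec.fst.comp hget) Primrec.snd) (hv.comp Primrec.fst))
    (semidecidableWordProblem.eq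
      (primrec_subst (γ := γ × GroupWord ℕ) (φ := fun x i => ((L x.1).getD i ([], [])).2)
        (Primrec.snd.comp hget) Primrec.snd) (hv'.comp Primrec.fst)))

end ZF

/-! ### Generators of the intersection of two lattices -/

namespace ZF

open FreeGroup

variable {m n : ℕ} {γ : Type} [Primcodable γ]

/-- The pairs `(w, w)` for the words `w` of `A`, followed by the pairs of `Q`. -/
def diagonalAppend (A : List (GroupWord (Fin m ⊕ Fin n)))
    (Q : List (GroupWord (Fin m ⊕ Fin n) × GroupWord (Fin m ⊕ Fin n))) :
    List (GroupWord (Fin m ⊕ Fin n) × GroupWord (Fin m ⊕ Fin n)) :=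
  A.map (fun w => (w, w)) ++ Q

theorem primrec_diagonalAppend {A : γ → List (GroupWord (Fin m ⊕ Fin n))}
    {Q : γ → List (GroupWord (Fin m ⊕ Fin n) × GroupWord (Fin m ⊕ Fin n))} (hA : Primrec A)
    (hQ : Primrec Q) : Primrec fun c => diagonalAppend (A c) (Q c) :=
  Primrec.list_append.comp (Primrec.list_map hA (Primrec.pair Primrec.snd Primrec.snd)) hQ

/-- The words `v w⁻¹` for the pairs `(v, w)` of `Q`. -/
def differences (Q : List (GroupWord (Fin m ⊕ Fin n) × GroupWord (Fin m ⊕ Fin n))) :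
    List (GroupWord (Fin m ⊕ Fin n)) :=
  Q.map fun q => q.1 ++ invRev q.2

theorem primrec_differences : Primrec (differences (m := m) (n := n)) :=
  Primrec.list_map Primrec.id (Primrec.list_append.comp (Primrec.fst.comp Primrec.snd)
    (primrec_invRev.comp (Primrec.snd.comp Primrec.snd)))

/-- If the differences of the pairs in `Q` are linearly independent, a pair `(x, x)` that is a
product of pairs `(a, a)` and pairs in `Q` is a product of pairs `(a, a)`. -/
theorem mem_latticeSpan_of_diagonal_mem {A : List (GroupWord (Fin m ⊕ Fin n))}
    {Q : List (GroupWord (Fin m ⊕ Fin n) × GroupWord (Fin m ⊕ Fin n))}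
    (hQ : LatticeIndep (differences Q)) {x : ZF m n}
    (hx : (x, x) ∈ pairSubgroup (diagonalAppend A Q)) : x.1.toAdd ∈ latticeSpan A := by
  let V := Fin m → ℤ
  let q : Fin Q.length → V × V := fun i => (vec (Q.get i).1, vec (Q.get i).2)
  have hq : LinearIndependent ℤ fun i => (q i).1 - (q i).2 := by
    refine (latticeIndep_iff_linearIndependent (Eq.trans ?_
      (List.ofFn_getElem_eq_map Q fun p => vec p.1 - vec p.2).symm)).1 hQ
    simp [differences, Function.comp_def, vec_append_invRev]
  let P : Submodule ℤ (V × V) :=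
    (latticeSpan A).map (LinearMap.prod LinearMap.id LinearMap.id) ⊔
      LinearMap.range (Fintype.linearCombination ℤ q)
  have hP : ∀ t ∈ pairSubgroup (diagonalAppend A Q), (t.1.1.toAdd, t.2.1.toAdd) ∈ P := by
    intro t ht
    induction ht using Subgroup.closure_induction with
    | mem t ht =>
      obtain ⟨p, hp, rfl⟩ := ht
      rcases List.mem_append.1 hp with h | h
      · obtain ⟨w, hw, rfl⟩ := List.mem_map.1 h
        exact Submodule.mem_sup_left ⟨vec w, vec_mem_latticeSpan hw, rfl⟩
      · obtain ⟨i, rfl⟩ := List.get_of_mem h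
        refine Submodule.mem_sup_right ⟨Pi.single i 1, ?_⟩
        rw [Fintype.linearCombination_apply_single, one_smul]
        rfl
    | one => exact zero_mem _
    | mul s t _ _ hs ht => exact add_mem hs ht
    | inv t _ ht => exact neg_mem ht
  obtain ⟨_, ⟨a, ha, rfl⟩, _, ⟨c, rfl⟩, e⟩ := Submodule.mem_sup.1 (hP _ hx)
  rw [Fintype.linearCombination_apply] at e
  have e1 : a + ∑ i, c i • (q i).1 = x.1.toAdd := by
    simpa [Prod.fst_sum] using congrArg Prod.fst e
  have e2 : a + ∑ i, c i • (q i).2 = x.1.toAdd := by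
    simpa [Prod.snd_sum] using congrArg Prod.snd e
  have hc : ∀ i, c i = 0 := by
    refine Fintype.linearIndependent_iff.1 hq c ?_
    simp only [smul_sub, Finset.sum_sub_distrib]
    rw [sub_eq_zero]
    exact add_left_cancel (e1.trans e2.symm)
  have : a = x.1.toAdd := by simpa [hc] using e1
  exact this ▸ ha

/-- A basis of the image of the difference map on a product of lattices lifts to a complement of
the diagonal. -/
theorem exists_differences {A l l' : List (GroupWord (Fin m ⊕ Fin n))}
    (hl : InLattice l) (hl' : InLattice l')
    (hA : wordSubgroup (gen m n) A = wordSubgroup (gen m n) l ⊓ wordSubgroup (gen m n) l') :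
    ∃ Q : List (GroupWord (Fin m ⊕ Fin n) × GroupWord (Fin m ⊕ Fin n)),
      LatticeIndep (differences Q) ∧ ∀ x ∈ wordSubgroup (gen m n) l,
        ∀ x' ∈ wordSubgroup (gen m n) l', (x, x') ∈ pairSubgroup (diagonalAppend A Q) := by
  let V := Fin m → ℤ
  let b := Module.finBasis ℤ (latticeSpan l ⊔ latticeSpan l' : Submodule ℤ V)
  choose y hy y' hy' hb using fun i => Submodule.mem_sup.1 (b i).2
  choose w hw using fun i => exists_vec_eq (n := n) (y i)
  choose w' hw' using fun i => exists_vec_eq (n := n) (-(y' i))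
  let Q := List.ofFn fun i => (w i, w' i)
  let ι : Multiplicative (V × V) →* ZF m n × ZF m n := MonoidHom.mk'
    (fun v => ((Multiplicative.ofAdd v.toAdd.1, 1), (Multiplicative.ofAdd v.toAdd.2, 1)))
    fun v v' => by simp
  let P : AddSubgroup (V × V) :=
    Subgroup.toAddSubgroup' ((pairSubgroup (diagonalAppend A Q)).comap ι)
  have hdiag : ∀ z ∈ latticeSpan l ⊓ latticeSpan l', (z, z) ∈ P := by
    rintro z ⟨hz, hz'⟩
    have hzA : ((Multiplicative.ofAdd z, 1) : ZF m n) ∈ wordSubgroup (gen m n) A := by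
      rw [hA]
      exact ⟨(hl.mem_iff rfl).2 hz, (hl'.mem_iff rfl).2 hz'⟩
    have : wordSubgroup (gen m n) A ≤ (pairSubgroup (diagonalAppend A Q)).comap
        ((MonoidHom.id _).prod (MonoidHom.id _)) := wordSubgroup_le.2 fun v hv =>
      Subgroup.subset_closure ⟨(v, v), List.mem_append_left _ (List.mem_map_of_mem hv), rfl⟩
    exact this hzA
  have hQP : ∀ i, (y i, -(y' i)) ∈ P := fun i => by
    refine Subgroup.subset_closure ⟨(w i, w' i), List.mem_append_right _
      (List.mem_ofFn.2 ⟨i, rfl⟩), ?_⟩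
    simp only [hw, hw']
    rfl
  refine ⟨Q, ?_, fun x hx x' hx' => ?_⟩
  · rw [latticeIndep_iff_linearIndependent (g := fun i => (b i : V))]
    · exact b.linearIndependent.map' (Submodule.subtype _) (Submodule.ker_subtype _)
    · rw [differences, List.map_map, List.map_ofFn]
      congr 1
      ext1 i
      change vec (w i ++ invRev (w' i)) = (b i : V)
      rw [vec_append_invRev, vec, vec, hw, hw', ← hb]
      simp
  · have hv := (hl.mem_iff (hl.snd_eq_one hx)).1 hx
    have hv' := (hl'.mem_iff (hl'.snd_eq_one hx')).1 hx'
    set v := x.1.toAdd with hvdef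
    set v' := x'.1.toAdd with hvdef'
    have hsub : v - v' ∈ latticeSpan l ⊔ latticeSpan l' :=
      sub_mem (Submodule.mem_sup_left hv) (Submodule.mem_sup_right hv')
    let c := b.repr ⟨_, hsub⟩
    have hc : ∑ i, c i • (y i + y' i) = v - v' := by
      have := congrArg (Submodule.subtype _) (b.sum_repr ⟨_, hsub⟩)
      rw [map_sum] at this
      simpa only [map_smul, Submodule.subtype_apply, ← hb] using this
    have hz : v - ∑ i, c i • y i = v' + ∑ i, c i • y' i := by
      simp only [smul_add, Finset.sum_add_distrib] at hc
      rw [sub_eq_iff_eq_add, add_assoc, add_comm (∑ i, c i • y' i), hc]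
      abel
    have hmem : (v, v') ∈ P := by
      have h1 := hdiag (v - ∑ i, c i • y i)
        ⟨sub_mem hv (sum_mem fun i _ => Submodule.smul_mem _ _ (hy i)), by
          rw [hz]
          exact add_mem hv' (sum_mem fun i _ => Submodule.smul_mem _ _ (hy' i))⟩
      have h2 : ∑ i, c i • (y i, -(y' i)) ∈ P := sum_mem fun i _ => zsmul_mem (hQP i) _
      have h3 : (v, v') = (v - ∑ i, c i • y i, v - ∑ i, c i • y i) +
          ∑ i, c i • (y i, -(y' i)) := by
        refine Prod.ext ?_ ?_
        · simp [Prod.fst_sum]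
        · rw [Prod.snd_add, hz]
          simp [Prod.snd_sum]
      rw [h3]
      exact add_mem h1 h2
    have : (x, x') = ι (Multiplicative.ofAdd (v, v')) :=
      Prod.ext (Prod.ext rfl (hl.snd_eq_one hx)) (Prod.ext rfl (hl'.snd_eq_one hx'))
    rw [this]
    exact hmem

theorem semidecidable_eq_inf {A l l' : γ → List (GroupWord (Fin m ⊕ Fin n))} (hA : Primrec A)
    (hl : Primrec l) (hl' : Primrec l') : Semidecidable fun c =>
      InLattice (l c) ∧ InLattice (l' c) ∧ wordSubgroup (gen m n) (A c) =
        wordSubgroup (gen m n) (l c) ⊓ wordSubgroup (gen m n) (l' c) := by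
  have hL : Primrec fun z : (γ × List (GroupWord (Fin m ⊕ Fin n) × GroupWord (Fin m ⊕ Fin n))) ×
      GroupWord (Fin m ⊕ Fin n) => diagonalAppend (A z.1.1) z.1.2 :=
    primrec_diagonalAppend (hA.comp (Primrec.fst.comp Primrec.fst))
      (Primrec.snd.comp Primrec.fst)
  refine ((semidecidable_inLattice hl).and ((semidecidable_inLattice hl').and
    (.and (semidecidableWordProblem.le hA hl) (.and (semidecidableWordProblem.le hA hl')
    (Semidecidable.exists_snd (p := fun c Q => LatticeIndep (differences Q) ∧
      (∀ v ∈ l c, PairMem (diagonalAppend (A c) Q) v []) ∧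
      ∀ v ∈ l' c, PairMem (diagonalAppend (A c) Q) [] v) ?_))))).of_iff fun c => ?_
  · refine .and (semidecidable_latticeIndep (primrec_differences.comp Primrec.snd)) (.and ?_ ?_)
    · exact Semidecidable.forall_mem (α := γ × List (GroupWord (Fin m ⊕ Fin n) × _))
        (p := fun z v => PairMem (diagonalAppend (A z.1) z.2) v [])
        (semidecidable_pairMem hL Primrec.snd (Primrec.const [])) (hl.comp Primrec.fst)
    · exact Semidecidable.forall_mem (α := γ × List (GroupWord (Fin m ⊕ Fin n) × _))
        (p := fun z v => PairMem (diagonalAppend (A z.1) z.2) [] v)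
        (semidecidable_pairMem hL (Primrec.const []) Primrec.snd) (hl'.comp Primrec.fst)
  · refine and_congr_right fun hlc => and_congr_right fun hlc' => ⟨fun h => ?_, ?_⟩
    · obtain ⟨Q, hQ, hmem⟩ := exists_differences hlc hlc' h
      refine ⟨h ▸ inf_le_left, h ▸ inf_le_right, Q, hQ, fun v hv => pairMem_iff.2 ?_,
        fun v hv => pairMem_iff.2 ?_⟩
      · exact hmem _ (wordEval_mem_wordSubgroup hv) _ (one_mem _)
      · exact hmem _ (one_mem _) _ (wordEval_mem_wordSubgroup hv)
    · rintro ⟨h, h', Q, hQ, h1, h2⟩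
      refine le_antisymm (le_inf h h') fun x hx => ?_
      have hAc : InLattice (A c) := fun w hw => hlc.snd_eq_one (h (wordEval_mem_wordSubgroup hw))
      rw [hAc.mem_iff (hlc.snd_eq_one hx.1)]
      refine mem_latticeSpan_of_diagonal_mem hQ ?_
      have i1 : wordSubgroup (gen m n) (l c) ≤
          (pairSubgroup (diagonalAppend (A c) Q)).comap (MonoidHom.inl _ _) :=
        wordSubgroup_le.2 fun v hv => pairMem_iff.1 (h1 v hv)
      have i2 : wordSubgroup (gen m n) (l' c) ≤
          (pairSubgroup (diagonalAppend (A c) Q)).comap (MonoidHom.inr _ _) :=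
        wordSubgroup_le.2 fun v hv => pairMem_iff.1 (h2 v hv)
      have k1 : ((x, 1) : ZF m n × ZF m n) ∈ pairSubgroup (diagonalAppend (A c) Q) := i1 hx.1
      have k2 : ((1, x) : ZF m n × ZF m n) ∈ pairSubgroup (diagonalAppend (A c) Q) := i2 hx.2
      simpa using mul_mem k1 k2

end ZF

/-! ### The intersection of two subgroups -/

namespace ZF

open FreeGroup

variable {m n : ℕ} {γ : Type} [Primcodable γ]

theorem mem_abelianPart_iff {l : List (GroupWord (Fin m ⊕ Fin n))} {H : Subgroup (ZF m n)}
    (h : wordSubgroup (gen m n) l = latticePart H) {v : Fin m → ℤ} :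
    v ∈ abelianPart H ↔ v ∈ latticeSpan l := by
  have h1 := (InLattice.of_eq_latticePart h).mem_iff (x := (Multiplicative.ofAdd v, 1)) rfl
  rw [h, mem_latticePart] at h1
  rw [mem_abelianPart]
  exact ⟨fun hv => h1.1 ⟨hv, rfl⟩, fun hv => (h1.2 hv).1⟩

theorem mem_abelianPart_sup_iff {l l' : List (GroupWord (Fin m ⊕ Fin n))} {H H' : Subgroup (ZF m n)}
    (h : wordSubgroup (gen m n) l = latticePart H)
    (h' : wordSubgroup (gen m n) l' = latticePart H') {v : Fin m → ℤ} :
    v ∈ abelianPart H ⊔ abelianPart H' ↔ v ∈ latticeSpan (l ++ l') := by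
  simp only [latticeSpan_append, AddSubgroup.mem_sup, Submodule.mem_sup, mem_abelianPart_iff h,
    mem_abelianPart_iff h']

/-- The words `u` and `u'` represent lifts of `x` to the subgroups generated by `S` and `S'`, and
the lists `l` and `l'` generate the lattice parts of these subgroups. -/
def IsLiftData (S S' : List (GroupWord (Fin m ⊕ Fin n))) (x : FreeGroup (Fin n))
    (u u' : GroupWord (Fin m ⊕ Fin n)) (l l' : List (GroupWord (Fin m ⊕ Fin n))) : Prop :=
  (wordEval (gen m n) u ∈ wordSubgroup (gen m n) S ∧ (wordEval (gen m n) u).2 = x) ∧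
  (wordEval (gen m n) u' ∈ wordSubgroup (gen m n) S' ∧ (wordEval (gen m n) u').2 = x) ∧
  wordSubgroup (gen m n) l = latticePart (wordSubgroup (gen m n) S) ∧
  wordSubgroup (gen m n) l' = latticePart (wordSubgroup (gen m n) S')

theorem exists_isLiftData {S S' : List (GroupWord (Fin m ⊕ Fin n))} {x : FreeGroup (Fin n)}
    (hx : x ∈ freeProj (wordSubgroup (gen m n) S) ⊓ freeProj (wordSubgroup (gen m n) S')) :
    ∃ u u' l l', IsLiftData S S' x u u' l l' := by
  obtain ⟨h, hh, e⟩ := mem_freeProj.1 hx.1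
  obtain ⟨h', hh', e'⟩ := mem_freeProj.1 hx.2
  obtain ⟨u, rfl⟩ := exists_wordEval (closure_range_gen m n) h
  obtain ⟨u', rfl⟩ := exists_wordEval (closure_range_gen m n) h'
  obtain ⟨l, hl⟩ := exists_wordSubgroup_eq (closure_range_gen m n)
    (latticePart_fg (wordSubgroup (gen m n) S))
  obtain ⟨l', hl'⟩ := exists_wordSubgroup_eq (closure_range_gen m n)
    (latticePart_fg (wordSubgroup (gen m n) S'))
  exact ⟨u, u', l, l', ⟨hh, e⟩, ⟨hh', e'⟩, hl, hl'⟩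

theorem IsLiftData.mem_inf {S S' : List (GroupWord (Fin m ⊕ Fin n))} {x : FreeGroup (Fin n)}
    {u u' : GroupWord (Fin m ⊕ Fin n)} {l l' : List (GroupWord (Fin m ⊕ Fin n))}
    (h : IsLiftData S S' x u u' l l') :
    x ∈ freeProj (wordSubgroup (gen m n) S) ⊓ freeProj (wordSubgroup (gen m n) S') :=
  ⟨⟨_, h.1.1, h.1.2⟩, ⟨_, h.2.1.1, h.2.1.2⟩⟩

/-- A power of `x` lies in `(H ∩ H') π` if and only if the corresponding multiple of the difference
of the lifts of `x` lies in the sum of the lattice parts. -/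
theorem IsLiftData.pow_mem_iff {S S' : List (GroupWord (Fin m ⊕ Fin n))} {x : FreeGroup (Fin n)}
    {u u' : GroupWord (Fin m ⊕ Fin n)} {l l' : List (GroupWord (Fin m ⊕ Fin n))}
    (h : IsLiftData S S' x u u' l l') (N : ℕ) :
    x ^ N ∈ freeProj (wordSubgroup (gen m n) S ⊓ wordSubgroup (gen m n) S') ↔
      N • vec (u ++ invRev u') ∈ latticeSpan (l ++ l') := by
  obtain ⟨⟨hu, e⟩, ⟨hu', e'⟩, hl, hl'⟩ := h
  rw [← mem_abelianPart_sup_iff hl hl', vec_append_invRev]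
  have := mem_freeProj_inf_iff (pow_mem hu N) (pow_mem hu' N) (by simp [e, e'])
  simpa [e, smul_sub, vec] using this

theorem semidecidable_exists_isLiftData {S S' : γ → List (GroupWord (Fin m ⊕ Fin n))}
    {y : γ → GroupWord (Fin m ⊕ Fin n)} (hS : Primrec S) (hS' : Primrec S') (hy : Primrec y)
    {p : GroupWord (Fin m ⊕ Fin n) → List (GroupWord (Fin m ⊕ Fin n)) → Prop}
    (hp : ∀ {δ : Type} [Primcodable δ] {w : δ → GroupWord (Fin m ⊕ Fin n)}
      {l : δ → List (GroupWord (Fin m ⊕ Fin n))}, Primrec w → Primrec l →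
      Semidecidable fun d => p (w d) (l d)) :
    Semidecidable fun c => ∃ u u' l l',
      IsLiftData (S c) (S' c) (wordEval (gen m n) (y c)).2 u u' l l' ∧
        p (u ++ invRev u') (l ++ l') := by
  let Wd := GroupWord (Fin m ⊕ Fin n)
  have hc : Primrec fun z : γ × (Wd × Wd) × List Wd × List Wd => z.1 := Primrec.fst
  have hu : Primrec fun z : γ × (Wd × Wd) × List Wd × List Wd => z.2.1.1 :=
    Primrec.fst.comp (Primrec.fst.comp Primrec.snd)
  have hu' : Primrec fun z : γ × (Wd × Wd) × List Wd × List Wd => z.2.1.2 :=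
    Primrec.snd.comp (Primrec.fst.comp Primrec.snd)
  have hl : Primrec fun z : γ × (Wd × Wd) × List Wd × List Wd => z.2.2.1 :=
    Primrec.fst.comp (Primrec.snd.comp Primrec.snd)
  have hl' : Primrec fun z : γ × (Wd × Wd) × List Wd × List Wd => z.2.2.2 :=
    Primrec.snd.comp (Primrec.snd.comp Primrec.snd)
  refine (Semidecidable.exists_snd (p := fun c (q : (Wd × Wd) × List Wd × List Wd) =>
    IsLiftData (S c) (S' c) (wordEval (gen m n) (y c)).2 q.1.1 q.1.2 q.2.1 q.2.2 ∧
      p (q.1.1 ++ invRev q.1.2) (q.2.1 ++ q.2.2)) (.and (.and ?_ (.and ?_ (.and ?_ ?_)))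
        ?_)).of_iff fun c => ?_
  · exact (semidecidableWordProblem.mem hu (hS.comp hc)).and (semidecidable_free_eq hu (hy.comp hc))
  · exact (semidecidableWordProblem.mem hu' (hS'.comp hc)).and
      (semidecidable_free_eq hu' (hy.comp hc))
  · exact semidecidable_eq_latticePart hl (hS.comp hc)
  · exact semidecidable_eq_latticePart hl' (hS'.comp hc)
  · exact hp (Primrec.list_append.comp hu (primrec_invRev.comp hu'))
      (Primrec.list_append.comp hl hl')
  · exact ⟨fun ⟨u, u', l, l', h⟩ => ⟨((u, u'), l, l'), h⟩,
      fun ⟨q, h⟩ => ⟨q.1.1, q.1.2, q.2.1, q.2.2, h⟩⟩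

theorem semidecidable_notMem_freeProj_inf {S S' : γ → List (GroupWord (Fin m ⊕ Fin n))}
    {y : γ → GroupWord (Fin m ⊕ Fin n)} (hS : Primrec S) (hS' : Primrec S') (hy : Primrec y) :
    Semidecidable fun c =>
      (wordEval (gen m n) (y c)).2 ∈
        freeProj (wordSubgroup (gen m n) (S c)) ⊓ freeProj (wordSubgroup (gen m n) (S' c)) ∧
      (wordEval (gen m n) (y c)).2 ∉
        freeProj (wordSubgroup (gen m n) (S c) ⊓ wordSubgroup (gen m n) (S' c)) := by
  refine (semidecidable_exists_isLiftData hS hS' hy (p := FunctionalSeparates)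
    semidecidable_functionalSeparates).of_iff fun c => ⟨?_, ?_⟩
  · rintro ⟨hK, hJ⟩
    obtain ⟨u, u', l, l', h⟩ := exists_isLiftData hK
    have := h.pow_mem_iff 1
    rw [pow_one, one_smul] at this
    exact ⟨u, u', l, l', h, functionalSeparates_iff.2 fun hm => hJ (this.2 hm)⟩
  · rintro ⟨u, u', l, l', h, hsep⟩
    have := h.pow_mem_iff 1
    rw [pow_one, one_smul] at this
    exact ⟨h.mem_inf, fun hJ => functionalSeparates_iff.1 hsep (this.1 hJ)⟩

/-- The element `x` of `H π ∩ H' π` has infinite order modulo `(H ∩ H') π`. -/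
def HasInfiniteOrder (H H' : Subgroup (ZF m n)) (x : FreeGroup (Fin n)) : Prop :=
  x ∈ freeProj H ⊓ freeProj H' ∧ ∀ N : ℕ, 0 < N → x ^ N ∉ freeProj (H ⊓ H')

theorem semidecidable_hasInfiniteOrder {S S' : γ → List (GroupWord (Fin m ⊕ Fin n))}
    {y : γ → GroupWord (Fin m ⊕ Fin n)} (hS : Primrec S) (hS' : Primrec S') (hy : Primrec y) :
    Semidecidable fun c => HasInfiniteOrder (wordSubgroup (gen m n) (S c))
      (wordSubgroup (gen m n) (S' c)) (wordEval (gen m n) (y c)).2 := by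
  refine (semidecidable_exists_isLiftData hS hS' hy (p := RatIndep)
    semidecidable_ratIndep).of_iff fun c => ⟨?_, ?_⟩
  · rintro ⟨hK, hJ⟩
    obtain ⟨u, u', l, l', h⟩ := exists_isLiftData hK
    exact ⟨u, u', l, l', h, ratIndep_iff.2 fun N hN hm => hJ N hN ((h.pow_mem_iff N).2 hm)⟩
  · rintro ⟨u, u', l, l', h, hind⟩
    exact ⟨h.mem_inf, fun N hN hJ => ratIndep_iff.1 hind N hN ((h.pow_mem_iff N).1 hJ)⟩

theorem not_diffTorsion_iff {H H' : Subgroup (ZF m n)} :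
    ¬ DiffTorsion H H' ↔ ∃ x, HasInfiniteOrder H H' x := by
  constructor
  · intro h
    by_contra! hx
    refine h (diffTorsion_of_finite_quotient fun k hk => ?_)
    by_contra! hN
    exact hx k ⟨hk, hN⟩
  · rintro ⟨x, hx, hN⟩ h
    obtain ⟨N, hN0, hm⟩ := exists_pow_mem_of_diffTorsion h hx
    exact hN N hN0 hm

theorem exists_snd_wordEval_eq (x : FreeGroup (Fin n)) :
    ∃ w : GroupWord (Fin m ⊕ Fin n), (wordEval (gen m n) w).2 = x := by
  obtain ⟨w, hw⟩ := exists_wordEval (closure_range_gen m n) ((1, x) : ZF m n)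
  exact ⟨w, by rw [hw]⟩

/-- Infinite generation: the certificate consists of two elements of `H π ∩ H' π` that do not
commute and an element of infinite order modulo `(H ∩ H') π`. -/
theorem semidecidable_not_fg_inf {S S' : γ → List (GroupWord (Fin m ⊕ Fin n))} (hS : Primrec S)
    (hS' : Primrec S') : Semidecidable fun c =>
      ¬ (wordSubgroup (gen m n) (S c) ⊓ wordSubgroup (gen m n) (S' c)).FG := by
  let Wd := GroupWord (Fin m ⊕ Fin n)
  have mem : ∀ {T : γ → List Wd} {w : γ × Wd × Wd → Wd}, Primrec T → Primrec w →
      Semidecidable fun z : γ × Wd × Wd =>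
        (wordEval (gen m n) (w z)).2 ∈ freeProj (wordSubgroup (gen m n) (T z.1)) :=
    fun hT hw => semidecidable_mem_freeProj hw (hT.comp Primrec.fst)
  have h1 : Primrec fun z : γ × Wd × Wd => z.2.1 := Primrec.fst.comp Primrec.snd
  have h2 : Primrec fun z : γ × Wd × Wd => z.2.2 := Primrec.snd.comp Primrec.snd
  refine ((Semidecidable.exists_snd (p := fun c (q : Wd × Wd) =>
    (((wordEval (gen m n) q.1).2 ∈ freeProj (wordSubgroup (gen m n) (S c)) ∧
      (wordEval (gen m n) q.1).2 ∈ freeProj (wordSubgroup (gen m n) (S' c))) ∧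
    ((wordEval (gen m n) q.2).2 ∈ freeProj (wordSubgroup (gen m n) (S c)) ∧
      (wordEval (gen m n) q.2).2 ∈ freeProj (wordSubgroup (gen m n) (S' c)))) ∧
    mk (freeWord (q.1 ++ q.2)) ≠ mk (freeWord (q.2 ++ q.1)))
    (.and (.and (.and (mem hS h1) (mem hS' h1)) (.and (mem hS h2) (mem hS' h2)))
      (semidecidable_mk_ne (primrec_freeWord.comp (Primrec.list_append.comp h1 h2))
        (primrec_freeWord.comp (Primrec.list_append.comp h2 h1))))).and
    (Semidecidable.exists_snd (p := fun c y => HasInfiniteOrder (wordSubgroup (gen m n) (S c))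
      (wordSubgroup (gen m n) (S' c)) (wordEval (gen m n) y).2)
      (semidecidable_hasInfiniteOrder (hS.comp Primrec.fst) (hS'.comp Primrec.fst)
        Primrec.snd))).of_iff fun c => ?_
  rw [fg_inf_iff (wordSubgroup_fg _) (wordSubgroup_fg _), not_or, not_diffTorsion_iff]
  have happ : ∀ v w : GroupWord (Fin m ⊕ Fin n), (wordEval (gen m n) (v ++ w)).2 =
      (wordEval (gen m n) v).2 * (wordEval (gen m n) w).2 := fun v w => by
    rw [wordEval_append, Prod.snd_mul]
  simp only [mk_freeWord]
  refine and_congr ⟨fun h => ?_, ?_⟩ ⟨?_, fun ⟨y, hy⟩ => ⟨_, hy⟩⟩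
  · push Not at h
    obtain ⟨x, hx, y, hy, hxy⟩ := h
    obtain ⟨v, rfl⟩ := exists_snd_wordEval_eq (m := m) x
    obtain ⟨w, rfl⟩ := exists_snd_wordEval_eq (m := m) y
    exact ⟨(v, w), ⟨hx, hy⟩, fun e => hxy ((happ v w).symm.trans (e.trans (happ w v)))⟩
  · rintro ⟨q, ⟨hx, hy⟩, hxy⟩ h
    exact hxy ((happ _ _).trans ((h _ hx _ hy).trans (happ _ _).symm))
  · rintro ⟨x, hx⟩
    obtain ⟨v, rfl⟩ := exists_snd_wordEval_eq (m := m) x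
    exact ⟨v, hx⟩

end ZF

/-! ### Generators of the intersection -/

namespace ZF

open FreeGroup

variable {m n : ℕ} {γ : Type} [Primcodable γ]

/-- The words of `V` represent elements whose free parts generate `H π ∩ H' π`, for the subgroups
`H` and `H'` generated by `S` and `S'`. -/
def GeneratesFreePart (V S S' : List (GroupWord (Fin m ⊕ Fin n))) : Prop :=
  freeProj (wordSubgroup (gen m n) V) =
    freeProj (wordSubgroup (gen m n) S) ⊓ freeProj (wordSubgroup (gen m n) S')

theorem exists_generatesFreePart (S S' : List (GroupWord (Fin m ⊕ Fin n))) :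
    ∃ V, GeneratesFreePart V S S' := by
  have hK := FreeGroup.fg_inf (fg_iff_freeProj_fg.1 (wordSubgroup_fg (gen := gen m n) S))
    (fg_iff_freeProj_fg.1 (wordSubgroup_fg (gen := gen m n) S'))
  obtain ⟨V, hV⟩ := exists_wordSubgroup_eq (closure_range_gen m n)
    (Subgroup.FG.map hK (MonoidHom.inr (Multiplicative (Fin m → ℤ)) _))
  refine ⟨V, ?_⟩
  rw [GeneratesFreePart, hV, freeProj, Subgroup.map_map, MonoidHom.snd_comp_inr, Subgroup.map_id]

/-- The cosets of `E π` that the words of `[] :: Y` represent are permuted among themselves by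
the generators `V` and their inverses. -/
def ClosedUnder (Y V E : List (GroupWord (Fin m ⊕ Fin n))) : Prop :=
  ∀ y ∈ [] :: Y, ∀ v ∈ V ++ V.map invRev, ∃ y' ∈ [] :: Y,
    (wordEval (gen m n) (y ++ v ++ invRev y')).2 ∈ freeProj (wordSubgroup (gen m n) E)

theorem snd_wordEval_append_invRev (y v y' : GroupWord (Fin m ⊕ Fin n)) :
    (wordEval (gen m n) (y ++ v ++ invRev y')).2 =
      (wordEval (gen m n) y).2 * (wordEval (gen m n) v).2 * (wordEval (gen m n) y').2⁻¹ := by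
  rw [wordEval_append, wordEval_append, wordEval_invRev]
  rfl

theorem ClosedUnder.exists_mul_inv_mem {Y V E : List (GroupWord (Fin m ⊕ Fin n))}
    (h : ClosedUnder Y V E) {k : FreeGroup (Fin n)}
    (hk : k ∈ freeProj (wordSubgroup (gen m n) V)) :
    ∃ y ∈ [] :: Y, k * (wordEval (gen m n) y).2⁻¹ ∈ freeProj (wordSubgroup (gen m n) E) := by
  have step : ∀ k : FreeGroup (Fin n), ∀ v ∈ V ++ V.map invRev, (∃ y ∈ [] :: Y,
      k * (wordEval (gen m n) y).2⁻¹ ∈ freeProj (wordSubgroup (gen m n) E)) →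
      ∃ y ∈ [] :: Y, k * (wordEval (gen m n) v).2 * (wordEval (gen m n) y).2⁻¹ ∈
        freeProj (wordSubgroup (gen m n) E) := by
    rintro k v hv ⟨y, hy, hky⟩
    obtain ⟨y', hy', hyv⟩ := h y hy v hv
    rw [snd_wordEval_append_invRev] at hyv
    refine ⟨y', hy', ?_⟩
    simpa only [mul_assoc, inv_mul_cancel_left] using mul_mem hky hyv
  rw [freeProj_wordSubgroup, wordSubgroup] at hk
  induction hk using Subgroup.closure_induction_right with
  | one => exact ⟨[], List.mem_cons_self, by simp [wordEval_nil]⟩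
  | mul_right k _ g hg ih =>
    obtain ⟨_, hw, rfl⟩ := hg
    obtain ⟨v, hv, rfl⟩ := List.mem_map.1 hw
    rw [wordEval_of, mk_freeWord]
    exact step k v (List.mem_append_left _ hv) ih
  | mul_inv_cancel k _ g hg ih =>
    obtain ⟨_, hw, rfl⟩ := hg
    obtain ⟨v, hv, rfl⟩ := List.mem_map.1 hw
    have := step k (invRev v) (List.mem_append_right _ (List.mem_map_of_mem hv)) ih
    rw [wordEval_invRev] at this
    rw [wordEval_of, mk_freeWord]
    exact this

/-- A certificate that `(H ∩ H') π ≤ E π` when `E ≤ H ∩ H'`: representatives of the cosets of `E π`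
in `H π ∩ H' π`, each of which lies in `E π` or outside `(H ∩ H') π`; or else a generator of
`H π ∩ H' π` that has infinite order modulo `(H ∩ H') π`. -/
def FreePartCertificate (E S S' V Y : List (GroupWord (Fin m ⊕ Fin n)))
    (v : GroupWord (Fin m ⊕ Fin n)) : Prop :=
  (GeneratesFreePart V S S' ∧ ClosedUnder Y V E ∧ ∀ y ∈ [] :: Y,
    (wordEval (gen m n) y).2 ∈ freeProj (wordSubgroup (gen m n) E) ∨
      (wordEval (gen m n) y).2 ∈ freeProj (wordSubgroup (gen m n) S) ⊓
        freeProj (wordSubgroup (gen m n) S') ∧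
      (wordEval (gen m n) y).2 ∉ freeProj (wordSubgroup (gen m n) S ⊓ wordSubgroup (gen m n) S')) ∨
  (GeneratesFreePart [v] S S' ∧
    HasInfiniteOrder (wordSubgroup (gen m n) S) (wordSubgroup (gen m n) S')
      (wordEval (gen m n) v).2)

theorem mem_freeProj_singleton {v : GroupWord (Fin m ⊕ Fin n)} {x : FreeGroup (Fin n)} :
    x ∈ freeProj (wordSubgroup (gen m n) [v]) ↔ ∃ a : ℤ, (wordEval (gen m n) v).2 ^ a = x := by
  rw [freeProj_wordSubgroup, ← Subgroup.mem_zpowers_iff, Subgroup.zpowers_eq_closure, wordSubgroup]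
  have : {g | ∃ w ∈ [v].map freeWord, wordEval of w = g} = {(wordEval (gen m n) v).2} := by
    ext g
    simp [wordEval_of, mk_freeWord, eq_comm]
  rw [this]

theorem HasInfiniteOrder.zpow_notMem {H H' : Subgroup (ZF m n)} {x : FreeGroup (Fin n)}
    (h : HasInfiniteOrder H H' x) {a : ℤ} (ha : a ≠ 0) : x ^ a ∉ freeProj (H ⊓ H') := by
  intro hm
  refine h.2 a.natAbs (Int.natAbs_pos.2 ha) ?_
  rw [← zpow_natCast]
  rcases Int.natAbs_eq a with e | e
  · rwa [← e]
  · rw [e, zpow_neg, inv_mem_iff] at hm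
    exact hm

theorem FreePartCertificate.le {E S S' V Y : List (GroupWord (Fin m ⊕ Fin n))}
    {v : GroupWord (Fin m ⊕ Fin n)} (h : FreePartCertificate E S S' V Y v)
    (hE : wordSubgroup (gen m n) E ≤ wordSubgroup (gen m n) S ⊓ wordSubgroup (gen m n) S') :
    freeProj (wordSubgroup (gen m n) S ⊓ wordSubgroup (gen m n) S') ≤
      freeProj (wordSubgroup (gen m n) E) := by
  intro k hk
  have hkK := freeProj_inf_le _ _ hk
  rcases h with ⟨hV, hY, hout⟩ | ⟨hv, hord⟩
  · rw [← hV] at hkK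
    obtain ⟨y, hy, hky⟩ := hY.exists_mul_inv_mem hkK
    have hyJ : (wordEval (gen m n) y).2 ∈
        freeProj (wordSubgroup (gen m n) S ⊓ wordSubgroup (gen m n) S') := by
      have := mul_mem (inv_mem (freeProj_mono hE hky)) hk
      simpa using this
    have hyE := (hout y hy).resolve_right fun h => h.2 hyJ
    simpa using mul_mem hky hyE
  · rw [← hv] at hkK
    obtain ⟨a, rfl⟩ := mem_freeProj_singleton.1 hkK
    by_cases ha : a = 0
    · rw [ha, zpow_zero]
      exact one_mem _
    · exact absurd hk (hord.zpow_notMem ha)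

theorem exists_coset_representatives {G : Type*} [Group G] (N : Subgroup G) [Finite (G ⧸ N)] :
    ∃ R : List G, ∀ g : G, ∃ r ∈ R, g * r⁻¹ ∈ N := by
  have := Fintype.ofFinite (G ⧸ N)
  refine ⟨(Finset.univ : Finset (G ⧸ N)).toList.map fun q => q.out⁻¹, fun g =>
    ⟨_, List.mem_map.2 ⟨QuotientGroup.mk g⁻¹, by simp, rfl⟩, ?_⟩⟩
  rw [inv_inv, ← inv_inv g, inv_inv g⁻¹]
  have := QuotientGroup.eq.1 (QuotientGroup.out_eq' (QuotientGroup.mk g⁻¹ : G ⧸ N)).symm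
  simpa using this

theorem exists_freePartCertificate {E S S' : List (GroupWord (Fin m ⊕ Fin n))}
    (hE : wordSubgroup (gen m n) E = wordSubgroup (gen m n) S ⊓ wordSubgroup (gen m n) S') :
    ∃ V Y v, FreePartCertificate E S S' V Y v := by
  have hfg : (wordSubgroup (gen m n) S ⊓ wordSubgroup (gen m n) S').FG := hE ▸ wordSubgroup_fg E
  have hK := FreeGroup.fg_inf (fg_iff_freeProj_fg.1 (wordSubgroup_fg (gen := gen m n) S))
    (fg_iff_freeProj_fg.1 (wordSubgroup_fg (gen := gen m n) S'))
  by_cases hD : DiffTorsion (wordSubgroup (gen m n) S) (wordSubgroup (gen m n) S')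
  · have := finite_quotient_of_diffTorsion (wordSubgroup_fg S) (wordSubgroup_fg S') hD
    obtain ⟨R, hR⟩ := exists_coset_representatives
      (interProj (wordSubgroup (gen m n) S) (wordSubgroup (gen m n) S'))
    obtain ⟨Y, hY⟩ := exists_map_wordEval (closure_range_gen m n)
      (R.map fun r => ((1, r.1) : ZF m n))
    obtain ⟨V, hV⟩ := exists_generatesFreePart S S'
    have hYK : ∀ y ∈ [] :: Y, (wordEval (gen m n) y).2 ∈
        freeProj (wordSubgroup (gen m n) S) ⊓ freeProj (wordSubgroup (gen m n) S') := by
      intro y hy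
      rcases List.mem_cons.1 hy with rfl | hy
      · rw [wordEval_nil]
        exact one_mem _
      · have : wordEval (gen m n) y ∈ R.map fun r => ((1, r.1) : ZF m n) :=
          hY ▸ List.mem_map_of_mem hy
        obtain ⟨r, -, e⟩ := List.mem_map.1 this
        rw [← e]
        exact r.2
    have hVK : ∀ v ∈ V ++ V.map invRev, (wordEval (gen m n) v).2 ∈
        freeProj (wordSubgroup (gen m n) S) ⊓ freeProj (wordSubgroup (gen m n) S') := by
      have hVK : ∀ v ∈ V, (wordEval (gen m n) v).2 ∈
          freeProj (wordSubgroup (gen m n) S) ⊓ freeProj (wordSubgroup (gen m n) S') :=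
        fun v hv => hV ▸ ⟨_, wordEval_mem_wordSubgroup hv, rfl⟩
      intro v hv
      rcases List.mem_append.1 hv with hv | hv
      · exact hVK v hv
      · obtain ⟨w, hw, rfl⟩ := List.mem_map.1 hv
        rw [wordEval_invRev]
        exact inv_mem (hVK w hw)
    refine ⟨V, Y, [], Or.inl ⟨hV, fun y hy v hv => ?_, fun y hy => ?_⟩⟩
    · obtain ⟨r, hr, hmem⟩ := hR ⟨_, mul_mem (hYK y hy) (hVK v hv)⟩
      have : ((1, r.1) : ZF m n) ∈ Y.map (wordEval (gen m n)) :=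
        hY ▸ List.mem_map_of_mem (f := fun r => ((1, r.1) : ZF m n)) hr
      obtain ⟨y', hy', e⟩ := List.mem_map.1 this
      refine ⟨y', List.mem_cons_of_mem _ hy', ?_⟩
      rw [snd_wordEval_append_invRev, e, hE]
      exact hmem
    · rw [hE]
      have := hYK y hy
      tauto
  · have hcomm := ((fg_inf_iff (wordSubgroup_fg S) (wordSubgroup_fg S')).1 hfg).resolve_right hD
    obtain ⟨x, hx⟩ := not_diffTorsion_iff.1 hD
    obtain ⟨k, ⟨b⟩⟩ := exists_finite_basis hK
    have hsub : Subsingleton (Fin k) := subsingleton_of_commute fun x y =>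
        b.repr.symm.injective <| by
      rw [_root_.map_mul, _root_.map_mul]
      exact Subtype.ext (hcomm _ (Subtype.prop _) _ (Subtype.prop _))
    obtain ⟨g, hg, hgen⟩ : ∃ g ∈ freeProj (wordSubgroup (gen m n) S) ⊓
        freeProj (wordSubgroup (gen m n) S'), ∀ x ∈ freeProj (wordSubgroup (gen m n) S) ⊓
        freeProj (wordSubgroup (gen m n) S'), x ∈ Subgroup.zpowers g := by
      rcases isEmpty_or_nonempty (Fin k) with h | ⟨⟨i⟩⟩
      · exact ⟨1, one_mem _, fun x hx => b.mem_of_forall_mem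
          (P := (Subgroup.zpowers (1 : FreeGroup (Fin n))).subgroupOf _) (fun i => h.elim i)
          ⟨x, hx⟩⟩
      · refine ⟨b i, (b i).2, fun x hx => b.mem_of_forall_mem
          (P := (Subgroup.zpowers (b i : FreeGroup (Fin n))).subgroupOf _) (fun j => ?_) ⟨x, hx⟩⟩
        rw [Subsingleton.elim j i]
        exact Subgroup.mem_zpowers (b i : FreeGroup (Fin n))
    obtain ⟨v, rfl⟩ := exists_snd_wordEval_eq (m := m) g
    refine ⟨[], [], v, Or.inr ⟨?_, hg, fun N hN hm => ?_⟩⟩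
    · refine le_antisymm (fun x hx => ?_) fun x hx =>
        mem_freeProj_singleton.2 (Subgroup.mem_zpowers_iff.1 (hgen x hx))
      obtain ⟨a, rfl⟩ := mem_freeProj_singleton.1 hx
      exact zpow_mem hg a
    · obtain ⟨a, rfl⟩ := Subgroup.mem_zpowers_iff.1 (hgen x hx.1)
      refine hx.2 N hN ?_
      have : ((wordEval (gen m n) v).2 ^ a) ^ N = ((wordEval (gen m n) v).2 ^ N) ^ a := by
        rw [← zpow_natCast, ← zpow_mul, mul_comm, zpow_mul, zpow_natCast]
      rw [this]
      exact zpow_mem hm a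

theorem semidecidable_freePartCertificate {E S S' V Y : γ → List (GroupWord (Fin m ⊕ Fin n))}
    {v : γ → GroupWord (Fin m ⊕ Fin n)} (hE : Primrec E) (hS : Primrec S) (hS' : Primrec S')
    (hV : Primrec V) (hY : Primrec Y) (hv : Primrec v) :
    Semidecidable fun c => FreePartCertificate (E c) (S c) (S' c) (V c) (Y c) (v c) := by
  let Wd := GroupWord (Fin m ⊕ Fin n)
  have hY0 : Primrec fun c => ([] : Wd) :: Y c := Primrec.list_cons.comp (Primrec.const []) hY
  refine .or (.and (semidecidable_freeProj_generates_inf hV hS hS') (.and ?_ ?_))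
    (.and (semidecidable_freeProj_generates_inf (Primrec.list_cons.comp hv (Primrec.const []))
      hS hS') (semidecidable_hasInfiniteOrder hS hS' hv))
  · have f1 : Primrec fun z : ((γ × Wd) × Wd) × Wd => z.1.1.1 :=
      Primrec.fst.comp (Primrec.fst.comp Primrec.fst)
    have f2 : Primrec fun z : ((γ × Wd) × Wd) × Wd => z.1.1.2 :=
      Primrec.snd.comp (Primrec.fst.comp Primrec.fst)
    have f3 : Primrec fun z : ((γ × Wd) × Wd) × Wd => z.1.2 := Primrec.snd.comp Primrec.fst
    have h1 : Semidecidable fun z : (γ × Wd) × Wd => ∃ y' ∈ [] :: Y z.1.1,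
        (wordEval (gen m n) (z.1.2 ++ z.2 ++ invRev y')).2 ∈
          freeProj (wordSubgroup (gen m n) (E z.1.1)) :=
      Semidecidable.exists_mem (p := fun (z : (γ × Wd) × Wd) (y' : Wd) =>
        (wordEval (gen m n) (z.1.2 ++ z.2 ++ invRev y')).2 ∈
          freeProj (wordSubgroup (gen m n) (E z.1.1)))
        (semidecidable_mem_freeProj (Primrec.list_append.comp (Primrec.list_append.comp f2 f3)
          (primrec_invRev.comp Primrec.snd)) (hE.comp f1))
        (hY0.comp (Primrec.fst.comp Primrec.fst))
    have hVV : Primrec fun c => V c ++ (V c).map invRev :=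
      Primrec.list_append.comp hV (Primrec.list_map hV (primrec_invRev.comp Primrec.snd))
    have h2 : Semidecidable fun z : γ × Wd => ∀ v ∈ V z.1 ++ (V z.1).map invRev,
        ∃ y' ∈ [] :: Y z.1, (wordEval (gen m n) (z.2 ++ v ++ invRev y')).2 ∈
          freeProj (wordSubgroup (gen m n) (E z.1)) :=
      Semidecidable.forall_mem (p := fun (z : γ × Wd) (v : Wd) => ∃ y' ∈ [] :: Y z.1,
        (wordEval (gen m n) (z.2 ++ v ++ invRev y')).2 ∈
          freeProj (wordSubgroup (gen m n) (E z.1))) h1 (hVV.comp Primrec.fst)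
    exact Semidecidable.forall_mem (p := fun (c : γ) (y : Wd) => ∀ v ∈ V c ++ (V c).map invRev,
      ∃ y' ∈ [] :: Y c, (wordEval (gen m n) (y ++ v ++ invRev y')).2 ∈
        freeProj (wordSubgroup (gen m n) (E c))) h2 hY0
  · exact Semidecidable.forall_mem (p := fun (c : γ) (y : Wd) =>
      (wordEval (gen m n) y).2 ∈ freeProj (wordSubgroup (gen m n) (E c)) ∨
      (wordEval (gen m n) y).2 ∈ freeProj (wordSubgroup (gen m n) (S c)) ⊓
        freeProj (wordSubgroup (gen m n) (S' c)) ∧ (wordEval (gen m n) y).2 ∉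
          freeProj (wordSubgroup (gen m n) (S c) ⊓ wordSubgroup (gen m n) (S' c)))
      (.or (semidecidable_mem_freeProj Primrec.snd (hE.comp Primrec.fst))
        (semidecidable_notMem_freeProj_inf (hS.comp Primrec.fst) (hS'.comp Primrec.fst)
          Primrec.snd)) hY0

theorem latticePart_inf (H H' : Subgroup (ZF m n)) :
    latticePart (H ⊓ H') = latticePart H ⊓ latticePart H' :=
  inf_inf_distrib_right _ _ _

/-- The words of `E` generate the intersection: the certificate shows separately that they generate
its lattice part and its free part. -/
theorem semidecidable_eq_wordSubgroup_inf {E S S' : γ → List (GroupWord (Fin m ⊕ Fin n))}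
    (hE : Primrec E) (hS : Primrec S) (hS' : Primrec S') : Semidecidable fun c =>
      wordSubgroup (gen m n) (E c) =
        wordSubgroup (gen m n) (S c) ⊓ wordSubgroup (gen m n) (S' c) := by
  let Wd := GroupWord (Fin m ⊕ Fin n)
  have hlat : Semidecidable fun c => ∃ A : (List Wd × List Wd) × List Wd,
      (wordSubgroup (gen m n) A.1.1 = latticePart (wordSubgroup (gen m n) (S c)) ∧
      wordSubgroup (gen m n) A.1.2 = latticePart (wordSubgroup (gen m n) (S' c))) ∧
      (InLattice A.1.1 ∧ InLattice A.1.2 ∧ wordSubgroup (gen m n) A.2 =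
        wordSubgroup (gen m n) A.1.1 ⊓ wordSubgroup (gen m n) A.1.2) ∧
      wordSubgroup (gen m n) A.2 ≤ wordSubgroup (gen m n) (E c) := by
    have f1 : Primrec fun z : γ × (List Wd × List Wd) × List Wd => z.2.1.1 :=
      Primrec.fst.comp (Primrec.fst.comp Primrec.snd)
    have f2 : Primrec fun z : γ × (List Wd × List Wd) × List Wd => z.2.1.2 :=
      Primrec.snd.comp (Primrec.fst.comp Primrec.snd)
    have f3 : Primrec fun z : γ × (List Wd × List Wd) × List Wd => z.2.2 :=
      Primrec.snd.comp Primrec.snd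
    exact Semidecidable.exists_snd (p := fun c (A : (List Wd × List Wd) × List Wd) =>
      (wordSubgroup (gen m n) A.1.1 = latticePart (wordSubgroup (gen m n) (S c)) ∧
      wordSubgroup (gen m n) A.1.2 = latticePart (wordSubgroup (gen m n) (S' c))) ∧
      (InLattice A.1.1 ∧ InLattice A.1.2 ∧ wordSubgroup (gen m n) A.2 =
        wordSubgroup (gen m n) A.1.1 ⊓ wordSubgroup (gen m n) A.1.2) ∧
      wordSubgroup (gen m n) A.2 ≤ wordSubgroup (gen m n) (E c))
      (.and (.and (semidecidable_eq_latticePart f1 (hS.comp Primrec.fst))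
        (semidecidable_eq_latticePart f2 (hS'.comp Primrec.fst)))
        (.and (semidecidable_eq_inf f3 f1 f2)
          (semidecidableWordProblem.le f3 (hE.comp Primrec.fst))))
  have hfree : Semidecidable fun c => ∃ V : (List Wd × List Wd) × Wd,
      FreePartCertificate (E c) (S c) (S' c) V.1.1 V.1.2 V.2 :=
    Semidecidable.exists_snd (p := fun c (V : (List Wd × List Wd) × Wd) =>
      FreePartCertificate (E c) (S c) (S' c) V.1.1 V.1.2 V.2)
      (semidecidable_freePartCertificate (hE.comp Primrec.fst) (hS.comp Primrec.fst)
        (hS'.comp Primrec.fst) (Primrec.fst.comp (Primrec.fst.comp Primrec.snd))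
        (Primrec.snd.comp (Primrec.fst.comp Primrec.snd)) (Primrec.snd.comp Primrec.snd))
  refine ((semidecidableWordProblem.le hE hS).and ((semidecidableWordProblem.le hE hS').and
    (hlat.and hfree))).of_iff fun c => ⟨fun h => ?_, ?_⟩
  · obtain ⟨l, hl⟩ := exists_wordSubgroup_eq (closure_range_gen m n)
      (latticePart_fg (wordSubgroup (gen m n) (S c)))
    obtain ⟨l', hl'⟩ := exists_wordSubgroup_eq (closure_range_gen m n)
      (latticePart_fg (wordSubgroup (gen m n) (S' c)))
    obtain ⟨A, hA⟩ := exists_wordSubgroup_eq (closure_range_gen m n)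
      (latticePart_fg (wordSubgroup (gen m n) (E c)))
    obtain ⟨V, Y, v, hV⟩ := exists_freePartCertificate h
    exact ⟨h.le.trans inf_le_left, h.le.trans inf_le_right,
      ⟨((l, l'), A), ⟨hl, hl'⟩, ⟨.of_eq_latticePart hl, .of_eq_latticePart hl',
        by rw [hA, hl, hl', h, latticePart_inf]⟩, hA.trans_le inf_le_left⟩, ((V, Y), v), hV⟩
  · rintro ⟨h1, h2, ⟨⟨⟨l, l'⟩, A⟩, ⟨hl, hl'⟩, ⟨-, -, hA⟩, hAE⟩, V, hV⟩
    refine eq_of_freeProj_le (le_inf h1 h2) (hV.le (le_inf h1 h2)) ?_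
    rw [latticePart_inf, ← hl, ← hl', ← hA]
    exact hAE

end ZF

/-! ### Bases of free-abelian times free groups -/

namespace FreeGroup

/-- A central element commutes with a letter that differs from the first letter of its reduced
word. -/
theorem eq_one_of_forall_commute {X : Type*} [Nontrivial X] {z : FreeGroup X}
    (h : ∀ c, of c * z = z * of c) : z = 1 := by
  classical
  by_contra hz
  obtain ⟨⟨a, b⟩, t, ht⟩ := List.exists_cons_of_ne_nil fun e => hz (toWord_eq_nil_iff.1 e)
  obtain ⟨c, hc⟩ := exists_ne a
  have h1 : toWord (of c * z) = (c, true) :: z.toWord := by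
    rw [toWord_mul, toWord_of, List.singleton_append, reduce.cons, reduce_toWord, ht]
    simp [hc]
  have h2 : toWord (z * of c) = reduce (z.toWord ++ [(c, true)]) := by
    rw [toWord_mul, toWord_of]
  have h3 : (c, true) :: z.toWord = z.toWord ++ [(c, true)] := by
    refine List.Sublist.eq_of_length ?_ (by simp)
    rw [← h1, h c, h2]
    exact (reduce.red).sublist
  rw [ht] at h3
  simp [hc] at h3

end FreeGroup

open scoped IsMulCommutative

/-- A linearly independent family of central elements that generates all central elements is an
abelian basis of the center. -/
theorem exists_center_equiv {H ι : Type} [Group H] {a : ι → H} (hc : ∀ i, a i ∈ Subgroup.center H)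
    (hli : LinearIndependent ℤ fun i => Additive.ofMul (⟨a i, hc i⟩ : Subgroup.center H))
    (hs : Subgroup.center H ≤ Subgroup.closure (Set.range a)) :
    ∃ e : Multiplicative (ι →₀ ℤ) ≃* Subgroup.center H,
      ∀ i, (e (Multiplicative.ofAdd (Finsupp.single i 1)) : H) = a i := by
  let v : ι → Additive (Subgroup.center H) := fun i => Additive.ofMul ⟨a i, hc i⟩
  have hspan : ∀ x ∈ Subgroup.closure (Set.range a), ∃ y ∈ Submodule.span ℤ (Set.range v),
      ((Additive.toMul y : Subgroup.center H) : H) = x := by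
    intro x hx
    induction hx using Subgroup.closure_induction with
    | mem x hx =>
      obtain ⟨i, rfl⟩ := hx
      exact ⟨v i, Submodule.subset_span ⟨i, rfl⟩, rfl⟩
    | one => exact ⟨0, zero_mem _, rfl⟩
    | mul x y _ _ hx hy =>
      obtain ⟨x', hx', rfl⟩ := hx
      obtain ⟨y', hy', rfl⟩ := hy
      exact ⟨x' + y', add_mem hx' hy', rfl⟩
    | inv x _ hx =>
      obtain ⟨x', hx', rfl⟩ := hx
      exact ⟨-x', neg_mem hx', rfl⟩
  have htop : ⊤ ≤ Submodule.span ℤ (Set.range v) := by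
    intro x _
    obtain ⟨y, hy, e⟩ := hspan _ (hs (Additive.toMul x).2)
    have : y = x := Additive.toMul.injective (Subtype.ext e)
    exact this ▸ hy
  let b := Module.Basis.mk hli htop
  refine ⟨AddEquiv.toMultiplicativeLeft b.repr.symm.toAddEquiv, fun i => ?_⟩
  have h1 : b.repr.symm (Finsupp.single i 1) = v i := by
    rw [Module.Basis.repr_symm_single_one]
    exact Module.Basis.mk_apply hli htop i
  exact congrArg
    (fun y : Additive (Subgroup.center H) => ((Additive.toMul y : Subgroup.center H) : H)) h1

namespace ZF

open FreeGroup

variable {m n : ℕ} {γ : Type} [Primcodable γ]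

section

variable {α G : Type} [Group G] {gen : α → G}

theorem mem_closure_range {K : Subgroup G} {A : List (GroupWord α)} {a : Fin A.length → K}
    (ha : ∀ i, (a i : G) = wordEval gen (A.get i)) {x : K} (hx : (x : G) ∈ wordSubgroup gen A) :
    x ∈ Subgroup.closure (Set.range a) := by
  have : wordSubgroup gen A ≤ (Subgroup.closure (Set.range a)).map K.subtype :=
    wordSubgroup_le.2 fun w hw => by
      obtain ⟨i, rfl⟩ := List.get_of_mem hw
      exact ⟨a i, Subgroup.subset_closure ⟨i, rfl⟩, ha i⟩
  obtain ⟨y, hy, e⟩ := this hx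
  exact (Subtype.ext e : y = x) ▸ hy

theorem closure_range_union_eq_top {A B : List (GroupWord α)}
    {a : Fin A.length → wordSubgroup gen (A ++ B)} {b : Fin B.length → wordSubgroup gen (A ++ B)}
    (ha : ∀ i, (a i : G) = wordEval gen (A.get i)) (hb : ∀ i, (b i : G) = wordEval gen (B.get i)) :
    Subgroup.closure (Set.range a ∪ Set.range b) = ⊤ := by
  rw [eq_top_iff]
  rintro ⟨x, hx⟩ -
  have : wordSubgroup gen (A ++ B) ≤ (Subgroup.closure (Set.range a ∪ Set.range b)).map
      (wordSubgroup gen (A ++ B)).subtype := wordSubgroup_le.2 fun w hw => by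
    rcases List.mem_append.1 hw with hw | hw
    · obtain ⟨i, rfl⟩ := List.get_of_mem hw
      exact ⟨a i, Subgroup.subset_closure (Or.inl ⟨i, rfl⟩), ha i⟩
    · obtain ⟨i, rfl⟩ := List.get_of_mem hw
      exact ⟨b i, Subgroup.subset_closure (Or.inr ⟨i, rfl⟩), hb i⟩
  obtain ⟨y, hy, e⟩ := this hx
  exact (Subtype.ext e : y = ⟨x, hx⟩) ▸ hy

end

/-- The abelian part, as an additive homomorphism on the center of a subgroup. -/
def centerVec (J : Subgroup (ZF m n)) : Additive (Subgroup.center J) →+ (Fin m → ℤ) :=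
  MonoidHom.toAdditiveLeft
    ((MonoidHom.fst _ _).comp (J.subtype.comp (Subgroup.center J).subtype))

/-- Linearly independent vectors together with a number of freely independent elements that is not
`1` form a basis: an element of the center commutes with the freely independent elements, so that
its free part is trivial. -/
theorem wordsFormBasis_of_freelyIndependent {A B : List (GroupWord (Fin m ⊕ Fin n))}
    (hA : InLattice A) (hli : LatticeIndep A) (hB : FreelyIndependent (B.map freeWord))
    (h1 : B.length ≠ 1) : WordsFormBasis (gen m n) (wordSubgroup (gen m n) (A ++ B)) A B := by
  set J := wordSubgroup (gen m n) (A ++ B) with hJ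
  let a : Fin A.length → J := fun i =>
    ⟨wordEval (gen m n) (A.get i),
      wordEval_mem_wordSubgroup (List.mem_append_left _ (List.get_mem A i))⟩
  let b : Fin B.length → J := fun i =>
    ⟨wordEval (gen m n) (B.get i),
      wordEval_mem_wordSubgroup (List.mem_append_right _ (List.get_mem B i))⟩
  have hB' := freelyIndependent_map_freeWord.1 hB
  have hac : ∀ i, a i ∈ Subgroup.center J := fun i => Subgroup.mem_center_iff.2 fun x =>
    Subtype.ext (commute_of_snd_eq_one (hA _ (List.get_mem A i)) _).symm
  refine ⟨a, b, fun _ => rfl, fun _ => rfl, exists_center_equiv hac ?_ fun x hx => ?_, ?_,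
    closure_range_union_eq_top (fun _ => rfl) fun _ => rfl⟩
  · exact LinearIndependent.of_comp (centerVec J).toIntLinearMap hli
  · refine mem_closure_range (fun _ => rfl) ?_
    obtain ⟨c, hc, y, hxy⟩ := exists_mul_lift hA x.2
    have hy : y = 1 := by
      rcases Nat.lt_or_ge B.length 1 with h0 | h0
      · have : IsEmpty (Fin B.length) := ⟨fun i => absurd i.2 (by omega)⟩
        exact Subsingleton.elim _ _
      · have : Nontrivial (Fin B.length) := Fin.nontrivial_iff_two_le.2 (by omega)
        refine eq_one_of_forall_commute fun i => hB' ?_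
        have := congrArg (fun z : J => (z : ZF m n).2) (Subgroup.mem_center_iff.1 hx (b i))
        simp only [Subgroup.coe_mul, Prod.snd_mul, hxy, hA.snd_eq_one hc, one_mul, snd_lift] at this
        rw [_root_.map_mul, _root_.map_mul, lift_apply_of]
        exact this
    rw [hxy, hy, _root_.map_one, mul_one]
    exact hc
  · rcases Nat.lt_or_ge B.length 1 with h0 | h0
    · exact Or.inl (⟨fun i => absurd i.2 (by omega)⟩)
    · right
      have hinj : Function.Injective (lift b) := by
        intro y z hyz
        refine hB' ?_
        have hb : ∀ y, ((lift b y : J) : ZF m n).2 =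
            lift (fun i : Fin B.length => (wordEval (gen m n) (B.get i)).2) y := by
          intro y
          rw [← snd_lift]
          have : J.subtype.comp (lift b) = lift fun i => wordEval (gen m n) (B.get i) := by
            ext i : 1
            simp [b]
          rw [← this]
          rfl
        rw [← hb, ← hb, hyz]
      refine ⟨(lift b).range, ?_, .ofRepr (MonoidHom.ofInjective hinj).symm, fun j => ?_⟩
      · obtain ⟨y, z, hyz⟩ : ∃ y z : FreeGroup (Fin B.length), y * z ≠ z * y := by
          by_contra! h
          have := subsingleton_of_commute h
          rw [Fin.subsingleton_iff_le_one] at this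
          omega
        exact ⟨_, ⟨y, rfl⟩, _, ⟨z, rfl⟩, fun e => hyz (hinj (by
          rw [_root_.map_mul, _root_.map_mul, e]))⟩
      · change lift b (of j) = b j
        rw [lift_apply_of]

/-- Linearly independent vectors together with one element that has a nontrivial free part form a
basis of an abelian group. -/
theorem wordsFormBasis_cons {g : GroupWord (Fin m ⊕ Fin n)} {A : List (GroupWord (Fin m ⊕ Fin n))}
    (hA : InLattice A) (hli : LatticeIndep A) (hg : (wordEval (gen m n) g).2 ≠ 1) :
    WordsFormBasis (gen m n) (wordSubgroup (gen m n) ((g :: A) ++ [])) (g :: A) [] := by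
  set J := wordSubgroup (gen m n) ((g :: A) ++ []) with hJ
  let a : Fin (g :: A).length → J := fun i =>
    ⟨wordEval (gen m n) ((g :: A).get i),
      wordEval_mem_wordSubgroup (List.mem_append_left _ (List.get_mem (g :: A) i))⟩
  have hcomm : ∀ v ∈ g :: A, ∀ w ∈ g :: A, wordEval (gen m n) w * wordEval (gen m n) v =
      wordEval (gen m n) v * wordEval (gen m n) w := by
    intro v hv w hw
    rcases List.mem_cons.1 hv with rfl | hv
    · rcases List.mem_cons.1 hw with rfl | hw
      · rfl
      · exact commute_of_snd_eq_one (hA w hw) _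
    · exact (commute_of_snd_eq_one (hA v hv) _).symm
  have hac : ∀ i, a i ∈ Subgroup.center J := fun i => by
    have : J ≤ Subgroup.centralizer {(a i : ZF m n)} := wordSubgroup_le.2 fun w hw => by
      rw [Subgroup.mem_centralizer_singleton_iff]
      exact hcomm _ (List.get_mem (g :: A) i) w (by simpa using hw)
    exact Subgroup.mem_center_iff.2 fun x => Subtype.ext
      (Subgroup.mem_centralizer_singleton_iff.1 (this x.2))
  refine ⟨a, fun i => i.elim0, fun _ => rfl, fun i => i.elim0, exists_center_equiv hac ?_
    fun x _ => mem_closure_range (fun _ => rfl) ?_, Or.inl (inferInstanceAs (IsEmpty (Fin 0))),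
    closure_range_union_eq_top (fun _ => rfl) fun i => i.elim0⟩
  · let v : Fin A.length → Additive (Subgroup.center J) := fun i =>
      Additive.ofMul ⟨a i.succ, hac i.succ⟩
    have hv : LinearIndependent ℤ v := LinearIndependent.of_comp (centerVec J).toIntLinearMap hli
    have hcons := LinearIndependent.finCons' (Additive.ofMul ⟨a 0, hac 0⟩) v hv fun c y hy hc => by
      -- the free parts of the vectors are trivial, that of `g` is not
      let P : Additive (Subgroup.center J) →+ Additive (FreeGroup (Fin n)) :=
        MonoidHom.toAdditive ((MonoidHom.snd _ _).comp
          (J.subtype.comp (Subgroup.center J).subtype))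
      have hyP : P y = 0 := by
        clear hc
        induction hy using Submodule.span_induction with
        | mem y hy =>
          obtain ⟨i, rfl⟩ := hy
          exact hA _ (List.get_mem A i)
        | zero => exact map_zero P
        | add y z _ _ hy hz => rw [map_add, hy, hz, add_zero]
        | smul c y _ hy => rw [map_zsmul, hy, zsmul_zero]
      have h0 := congrArg P hc
      rw [map_add, hyP, add_zero, map_zero, map_zsmul] at h0
      have h0' : (wordEval (gen m n) g).2 ^ c = 1 := h0
      by_contra hc0
      exact hg ((IsMulTorsionFree.zpow_eq_one_iff_left hc0).1 h0')
    have e : (fun i : Fin (A.length + 1) =>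
        Additive.ofMul (⟨a i, hac i⟩ : Subgroup.center J)) = Fin.cons _ v :=
      funext (Fin.cases rfl fun _ => rfl)
    rw [← e] at hcons
    exact hcons
  · simpa only [hJ, List.append_nil] using x.2

/-- The words of `A` and `B` form a basis of the subgroup that they generate, in one of two ways:
`A` is an abelian basis of a lattice and `B` is freely independent modulo `ℤ^m`; or `B` is empty,
and `A` becomes an abelian basis of a lattice when its first word is removed, which represents an
element outside `ℤ^m`. -/
def IsBasisPair (A B : List (GroupWord (Fin m ⊕ Fin n))) : Prop :=
  (InLattice A ∧ LatticeIndep A ∧ FreelyIndependent (B.map freeWord) ∧ B.length ≠ 1) ∨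
  ∃ q : GroupWord (Fin m ⊕ Fin n) × List (GroupWord (Fin m ⊕ Fin n)),
    (A = q.1 :: q.2 ∧ B = []) ∧ InLattice q.2 ∧ LatticeIndep q.2 ∧
      mk (freeWord q.1) ≠ mk []

theorem IsBasisPair.wordsFormBasis {A B : List (GroupWord (Fin m ⊕ Fin n))} (h : IsBasisPair A B) :
    WordsFormBasis (gen m n) (wordSubgroup (gen m n) (A ++ B)) A B := by
  rcases h with ⟨hA, hli, hB, h1⟩ | ⟨⟨g, A⟩, ⟨rfl, rfl⟩, hA, hli, hg⟩
  · exact wordsFormBasis_of_freelyIndependent hA hli hB h1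
  · rw [mk_freeWord, ← one_eq_mk] at hg
    exact wordsFormBasis_cons hA hli hg

theorem exists_isBasisPair {J : Subgroup (ZF m n)} (hJ : J.FG) :
    ∃ A B : List (GroupWord (Fin m ⊕ Fin n)), IsBasisPair A B ∧
      wordSubgroup (gen m n) (A ++ B) = J := by
  obtain ⟨A, hA, hli, hAJ⟩ := exists_latticeIndep J
  obtain ⟨B, hB, hBJ⟩ := exists_freelyIndependent hJ
  by_cases h1 : B.length = 1
  · obtain ⟨g, rfl⟩ := List.length_eq_one_iff.1 h1
    refine ⟨g :: A, [], Or.inr ⟨(g, A), ⟨rfl, rfl⟩, hA, hli, fun e => ?_⟩, ?_⟩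
    · have h0 := freelyIndependent_map_freeWord.1 hB (a₁ := of ⟨0, by simp⟩) (a₂ := 1) (by
        rw [mk_freeWord, ← one_eq_mk] at e
        rw [lift_apply_of, _root_.map_one]
        exact e)
      exact of_ne_one _ h0
    · rw [List.append_nil, ← hBJ A hAJ, wordSubgroup_append, ← List.singleton_append,
        wordSubgroup_append, sup_comm]
  · exact ⟨A, B, Or.inl ⟨hA, hli, hB, h1⟩, hBJ A hAJ⟩

theorem semidecidable_isBasisPair {A B : γ → List (GroupWord (Fin m ⊕ Fin n))} (hA : Primrec A)
    (hB : Primrec B) : Semidecidable fun c => IsBasisPair (A c) (B c) := by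
  let Wd := GroupWord (Fin m ⊕ Fin n)
  have h1 : Primrec fun z : γ × Wd × List Wd => z.2.1 := Primrec.fst.comp Primrec.snd
  have h2 : Primrec fun z : γ × Wd × List Wd => z.2.2 := Primrec.snd.comp Primrec.snd
  refine .or (.and (semidecidable_inLattice hA) (.and (semidecidable_latticeIndep hA)
    (.and (semidecidable_freelyIndependent.comp (primrec_map_freeWord.comp hB)) (.of_primrec ?_))))
    (Semidecidable.exists_snd (p := fun c (q : Wd × List Wd) => (A c = q.1 :: q.2 ∧ B c = []) ∧
      InLattice q.2 ∧ LatticeIndep q.2 ∧ mk (freeWord q.1) ≠ mk [])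
      (.and (.and (.of_primrec ?_) (.of_primrec ?_)) (.and (semidecidable_inLattice h2)
        (.and (semidecidable_latticeIndep h2) (semidecidable_mk_ne (primrec_freeWord.comp h1)
          (Primrec.const _))))))
  · exact (Primrec.eq.comp (Primrec.list_length.comp hB) (Primrec.const 1)).not
  · exact Primrec.eq.comp (hA.comp Primrec.fst) (Primrec.list_cons.comp h1 h2)
  · exact Primrec.eq.comp (hB.comp Primrec.fst) (Primrec.const [])

/-! ### The algorithm -/

/-- The answers that an algorithm for the Subgroup Intersection Problem may give. -/
def IsAnswer (S S' : List (GroupWord (Fin m ⊕ Fin n))) :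
    Option (List (GroupWord (Fin m ⊕ Fin n)) × List (GroupWord (Fin m ⊕ Fin n))) → Prop
  | none => ¬ (wordSubgroup (gen m n) S ⊓ wordSubgroup (gen m n) S').FG
  | some (A, B) => IsBasisPair A B ∧
      wordSubgroup (gen m n) (A ++ B) = wordSubgroup (gen m n) S ⊓ wordSubgroup (gen m n) S'

theorem semidecidable_isAnswer : Semidecidable fun z :
    (List (GroupWord (Fin m ⊕ Fin n)) × List (GroupWord (Fin m ⊕ Fin n))) ×
      Option (List (GroupWord (Fin m ⊕ Fin n)) × List (GroupWord (Fin m ⊕ Fin n))) =>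
    IsAnswer z.1.1 z.1.2 z.2 := by
  let T := List (GroupWord (Fin m ⊕ Fin n)) × List (GroupWord (Fin m ⊕ Fin n))
  have hA : Primrec fun z : (T × Option T) × T => z.2.1 := Primrec.fst.comp Primrec.snd
  have hB : Primrec fun z : (T × Option T) × T => z.2.2 := Primrec.snd.comp Primrec.snd
  have hS : Primrec fun z : T × Option T => z.1.1 := Primrec.fst.comp Primrec.fst
  have hS' : Primrec fun z : T × Option T => z.1.2 := Primrec.snd.comp Primrec.fst
  have hnone : Semidecidable fun z : T × Option T => z.2 = none :=
    .of_primrec (Primrec.eq.comp Primrec.snd (Primrec.const none))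
  have hsome : Semidecidable fun z : (T × Option T) × T => z.1.2 = some z.2 :=
    .of_primrec (Primrec.eq.comp (Primrec.snd.comp Primrec.fst)
      (Primrec.option_some.comp Primrec.snd))
  refine (Semidecidable.or (hnone.and (semidecidable_not_fg_inf hS hS'))
    (Semidecidable.exists_snd (p := fun (z : T × Option T) (q : T) => z.2 = some q ∧
      IsBasisPair q.1 q.2 ∧ wordSubgroup (gen m n) (q.1 ++ q.2) =
        wordSubgroup (gen m n) z.1.1 ⊓ wordSubgroup (gen m n) z.1.2)
      (hsome.and ((semidecidable_isBasisPair hA hB).and (semidecidable_eq_wordSubgroup_inf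
        (Primrec.list_append.comp hA hB) (hS.comp Primrec.fst)
        (hS'.comp Primrec.fst)))))).of_iff fun z => ?_
  obtain ⟨⟨S, S'⟩, _ | ⟨A, B⟩⟩ := z
  · simp [IsAnswer]
  · simp [IsAnswer]

theorem exists_isAnswer (S S' : List (GroupWord (Fin m ⊕ Fin n))) : ∃ o, IsAnswer S S' o := by
  by_cases h : (wordSubgroup (gen m n) S ⊓ wordSubgroup (gen m n) S').FG
  · obtain ⟨A, B, hAB⟩ := exists_isBasisPair h
    exact ⟨some (A, B), hAB⟩
  · exact ⟨none, h⟩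

end ZF

theorem mainTheorem4 (m n : ℕ) :
    (∃ f : List (GroupWord (Fin m ⊕ Fin n)) × List (GroupWord (Fin m ⊕ Fin n)) →
        Option (List (GroupWord (Fin m ⊕ Fin n)) × List (GroupWord (Fin m ⊕ Fin n))),
      Computable f ∧
      SolvesSubgroupIntersectionProblem (ZF.gen m n)
        (fun p => (f p).map fun AB => AB.1 ++ AB.2) ∧
      ∀ S S' A B, f (S, S') = some (A, B) →
        WordsFormBasis (ZF.gen m n)
          (wordSubgroup (ZF.gen m n) S ⊓ wordSubgroup (ZF.gen m n) S') A B) ∧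
    ∀ H H' : Subgroup (ZF m n), H.FG → H'.FG →
      Nonempty (ZF.Coordinates H H') ∧
      ∀ D : ZF.Coordinates H H',
        (H ⊓ H').FG ↔ (D.n₃ = 1 ∧ D.M = ⊥) ∨ Module.finrank ℤ D.M = D.n₃ := by
  refine ⟨?_, fun _ _ hH hH' =>
    ⟨ZF.nonempty_coordinates hH hH', ZF.Coordinates.fg_inf_iff hH hH'⟩⟩
  obtain ⟨f, hf, hans⟩ := Semidecidable.exists_computable
    (R := fun (p : List (GroupWord (Fin m ⊕ Fin n)) × List (GroupWord (Fin m ⊕ Fin n))) o =>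
      ZF.IsAnswer p.1 p.2 o) ZF.semidecidable_isAnswer fun p => ZF.exists_isAnswer p.1 p.2
  refine ⟨f, hf, ⟨Computable.option_map hf (Primrec.list_append.comp (Primrec.fst.comp Primrec.snd)
    (Primrec.snd.comp Primrec.snd)).to_comp, fun S S' => ?_⟩, fun S S' A B h => ?_⟩
  · dsimp only
    have := hans (S, S')
    rcases h : f (S, S') with _ | ⟨A, B⟩
    · rw [h] at this
      exact ⟨⟨fun _ => this, fun _ => rfl⟩, nofun⟩
    · rw [h] at this
      refine ⟨⟨nofun, fun hfg => absurd ?_ hfg⟩, fun E hE => Option.some.inj hE ▸ this.2⟩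
      rw [← this.2]
      exact wordSubgroup_fg _
  · have := hans (S, S')
    rw [h] at this
    rw [← this.2]
    exact this.1.wordsFormBasis
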